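/- **Setting.** Let $d\in\{2,3\}$, $\mathrm{Re}>0$, $\mathrm{We}>0$, $0<\varepsilon\le 1$. Let $\mathcal D\subset\mathbb R^d$ be a bounded polyhedral domain with a fixed conforming mesh consisting of finitely many $d$-simplices $K$ (the cells). Define * $V_h$: the continuous vector fields $\overline{\mathcal D}\to\mathbb R^d$ that are polynomial of degree at most $d$ on every cell and vanish on $\partial\mathcal D$; * $Q_h$: the (discontinuous) functions that are polynomial of degree at most $d-1$ on every cell; * $S_h$: the fields of symmetric $d\times d$ matrices that are constant on every cell. Write $(\nabla u)_{ij}=\partial_j u_i$, $(w\cdot\nabla u)_i=\sum_j w_j\partial_j u_i$ and $A:B=\sum_{i,j}A_{ij}B_{ij}$. On an internal facet $E$ (a facet shared by two cells) with unit normal $n$, the superscripts $+$ and $-$ denote the downstream and upstream values with respect to the vector field $u_h^n$, and $[\![A]\!]=A^+-A^-$. **Scheme.** Given $u_h^n\in V_h$ with $\int_{\mathcal D} q\,\mathrm{div}\,u_h^n=0$ for all $q\in Q_h$, a positive definite $A_h^n\in S_h$ (i.e. positive definite on every cell), and $\delta t>0$, find $(u_h^{n+1},p_h^{n+1},A_h^{n+1})\in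 V_h\times Q_h\times S_h$ such that for all $(v,q,B)\in V_h\times Q_h\times S_h$ $$\begin{aligned} &\sum_K\int_K\Big(\mathrm{Re}\Big(\tfrac{u_h^{n+1}-u_h^n}{\delta t}+u_h^n\cdot\nabla u_h^{n+1}\Big)\cdot v-p_h^{n+1}\,\mathrm{div}\,v+q\,\mathrm{div}\,u_h^{n+1}+(1-\varepsilon)\nabla u_h^{n+1}:\nabla v+\tfrac{\varepsilon}{\mathrm{We}}A_h^{n+1}:\nabla v\\ &\qquad+\tfrac1{\mathrm{We}}(A_h^{n+1}-I):B+\tfrac{A_h^{n+1}-A_h^n}{\delta t}:B-\big(\nabla u_h^{n+1}A_h^{n+1}+A_h^{n+1}(\nabla u_h^{n+1})^T\big):B\Big)\\ &\quad+\sum_{E}\int_{E}|u_h^n\cdot n|\,[\![A_h^{n+1}]\!]:B^+=0, \end{aligned}$$ where $E$ runs over the internal facets. The discrete free energy is $$F_h^n=\frac{\mathrm{Re}}2\int_{\mathcal D}|u_h^n|^2+\frac{\varepsilon}{2\,\mathrm{We}}\int_{\mathcal D}\mathrm{tr}\,(A_h^n-\ln A_h^n-I).$$ **Theorem.** For the given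 mesh and parameters and every $M\in\mathbb R$ there is a constant $c_0>0$ such that for all timesteps $0<\delta t<c_0$ and all data $(u_h^n,A_h^n)$ as above with $F_h^n\le M$: 1. The scheme has a solution $(u_h^{n+1},p_h^{n+1},A_h^{n+1})$ with $A_h^{n+1}$ positive definite. It is unique in the following sense: $(u',p',A')$ is a solution with $A'$ positive definite if and only if $u'=u_h^{n+1}$, $A'=A_h^{n+1}$ and $p'-p_h^{n+1}$ belongs to $N_h=\{q\in Q_h:\int_{\mathcal D}q\,\mathrm{div}\,v=0\ \ \forall v\in V_h\}$, the space of pressures that the scheme does not see. 2. This solution satisfies $$F_h^{n+1}-F_h^n+\int_{\mathcal D}\frac{\mathrm{Re}}2|u_h^{n+1}-u_h^n|^2+\delta t\int_{\mathcal D}\Big((1-\varepsilon)|\nabla u_h^{n+1}|^2+\frac{\varepsilon}{2\,\mathrm{We}^2}\mathrm{tr}\big(A_h^{n+1}+(A_h^{n+1})^{-1}-2I\big)\Big)\le0 .$$ 3. If the velocity–pressure pair is stable on the mesh, i.e. every $q\in Q_h$ with $\int_{\mathcal D}q=0$ equals $\mathrm{div}\,v$ for some $v\in V_h$, then there is exactly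 one solution $(u_h^{n+1},p_h^{n+1},A_h^{n+1})$ with $\int_{\mathcal D}p_h^{n+1}=0$ and $A_h^{n+1}$ positive definite. (Since $F_h^{n+1}\le F_h^n$, the same $c_0$ serves all the steps of the scheme started from data with $F_h^0\le M$.) -/

import Mathlib

open MeasureTheory
open scoped Matrix

noncomputable section

namespace OldroydB

/-- A conforming simplicial mesh of a bounded polyhedral domain of `ℝ^d`: a finite simplicial
complex in which every face is a face of a `d`-dimensional simplex. -/
structure SimplicialMesh (d : ℕ) extends
    Geometry.SimplicialComplex ℝ (EuclideanSpace ℝ (Fin d)) where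
  finite_faces : faces.Finite
  pure : ∀ s ∈ faces, ∃ t ∈ faces, s ⊆ t ∧ t.card = d + 1

namespace SimplicialMesh

variable {d : ℕ} (T : SimplicialMesh d)

/-- The mesh cells: the `d`-dimensional simplices, given by their sets of vertices. -/
abbrev Cell : Type :=
  {s : Finset (EuclideanSpace ℝ (Fin d)) // s ∈ T.faces ∧ s.card = d + 1}

instance : Finite T.Cell :=
  (T.finite_faces.subset (fun _ h => h.1) :
    {s | s ∈ T.faces ∧ s.card = d + 1}.Finite).to_subtype

instance : Fintype T.Cell := Fintype.ofFinite _

/-- The closed simplex occupied by a cell. -/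
def region {T : SimplicialMesh d} (K : T.Cell) : Set (EuclideanSpace ℝ (Fin d)) :=
  convexHull ℝ (K.1 : Set (EuclideanSpace ℝ (Fin d)))

/-- The integral over the domain of a cellwise defined function, i.e. the sum over the cells of
the Lebesgue integrals over the cells. -/
def integral (f : T.Cell → EuclideanSpace ℝ (Fin d) → ℝ) : ℝ :=
  ∑ K, ∫ x in region K, f K x

/-! ### Discrete fields

A discrete scalar field is given by its polynomial on each cell; it may jump across the cells. -/

/-- Cellwise polynomial scalar fields. -/
abbrev ScalarField : Type := T.Cell → MvPolynomial (Fin d) ℝ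

/-- Cellwise polynomial vector fields. -/
abbrev VectorField : Type := T.Cell → Fin d → MvPolynomial (Fin d) ℝ

/-- Cellwise constant tensor fields. -/
abbrev TensorField : Type := T.Cell → Matrix (Fin d) (Fin d) ℝ

end SimplicialMesh

/-- Value of a polynomial at a point. -/
def value {d : ℕ} (p : MvPolynomial (Fin d) ℝ) (x : EuclideanSpace ℝ (Fin d)) : ℝ :=
  MvPolynomial.eval (fun i => x i) p

/-- Value of a polynomial vector field at a point. -/
def vecValue {d : ℕ} (v : Fin d → MvPolynomial (Fin d) ℝ) (x : EuclideanSpace ℝ (Fin d)) :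
    Fin d → ℝ :=
  fun i => value (v i) x

/-- The velocity gradient, `(∇v)_{ij} = ∂_j v_i`. -/
def gradValue {d : ℕ} (v : Fin d → MvPolynomial (Fin d) ℝ) (x : EuclideanSpace ℝ (Fin d)) :
    Matrix (Fin d) (Fin d) ℝ :=
  Matrix.of fun i j => value (MvPolynomial.pderiv j (v i)) x

/-- The divergence `∑ ∂_i v_i` of a polynomial vector field. -/
def divPoly {d : ℕ} (v : Fin d → MvPolynomial (Fin d) ℝ) : MvPolynomial (Fin d) ℝ :=
  ∑ i, MvPolynomial.pderiv i (v i)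

/-- The contraction `A : B = ∑_{ij} A_{ij} B_{ij}`. -/
def ddot {d : ℕ} (A B : Matrix (Fin d) (Fin d) ℝ) : ℝ := ∑ i, ∑ j, A i j * B i j

namespace SimplicialMesh

variable {d : ℕ} (T : SimplicialMesh d)

/-! ### Finite element spaces -/

/-- The velocity space `(P_d)^d`: continuous vector fields that are polynomials of total degree at
most `d` on every cell and vanish on the boundary of the domain. -/
def velocitySpace : Set T.VectorField :=
  {v | (∀ K i, v K i ∈ MvPolynomial.restrictTotalDegree (Fin d) ℝ d) ∧
    (∀ K L, ∀ x ∈ region K ∩ region L, vecValue (v K) x = vecValue (v L) x) ∧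
    (∀ K, ∀ x ∈ region K ∩ frontier T.space, vecValue (v K) x = 0)}

/-- The pressure space `P_{d-1,disc}`: discontinuous cellwise polynomials of total degree at most
`d - 1`. -/
def pressureSpace : Set T.ScalarField :=
  {q | ∀ K, q K ∈ MvPolynomial.restrictTotalDegree (Fin d) ℝ (d - 1)}

/-- The space `(P_0)^{d(d+1)/2}` of cellwise constant symmetric tensors. -/
def tensorSpace : Set T.TensorField := {B | ∀ K, (B K).IsSymm}

/-- The pressure-divergence pairing `∫ q div v`. -/
def divForm (q : T.ScalarField) (v : T.VectorField) : ℝ :=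
  T.integral fun K x => value (q K) x * value (divPoly (v K)) x

/-- Discretely divergence-free velocities: `∫ q div v = 0` for every discrete pressure `q`. -/
def divFreeSpace : Set T.VectorField :=
  {v | v ∈ T.velocitySpace ∧ ∀ q ∈ T.pressureSpace, T.divForm q v = 0}

/-- Pressure modes that the discrete momentum equation does not see. -/
def pressureModes : Set T.ScalarField :=
  {q | q ∈ T.pressureSpace ∧ ∀ v ∈ T.velocitySpace, T.divForm q v = 0}

/-- Discrete pressures with zero mean over the domain. -/
def meanZeroPressureSpace : Set T.ScalarField :=
  {q | q ∈ T.pressureSpace ∧ T.integral (fun K x => value (q K) x) = 0}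

/-- The velocity-pressure pair is stable on the mesh: every discrete pressure with zero mean is the
divergence of a discrete velocity (on a fixed mesh this is the inf-sup condition). -/
def StablePair : Prop :=
  ∀ q ∈ T.meanZeroPressureSpace, ∃ v ∈ T.velocitySpace, ∀ K, divPoly (v K) = q K

/-! ### The upwind term -/

open Classical in
/-- The common vertices of two cells. -/
def commonFace {T : SimplicialMesh d} (K L : T.Cell) : Finset (EuclideanSpace ℝ (Fin d)) :=
  K.1 ∩ L.1

/-- The unit normal to the common facet of two neighbouring cells, pointing from `K` into `L`: the
normalised component orthogonal to the facet of the vector joining the barycentres. -/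
def unitNormal {T : SimplicialMesh d} (K L : T.Cell) : EuclideanSpace ℝ (Fin d) :=
  let w : EuclideanSpace ℝ (Fin d) :=
    (vectorSpan ℝ (commonFace K L : Set (EuclideanSpace ℝ (Fin d))))ᗮ.starProjection
      (L.1.centroid ℝ id - K.1.centroid ℝ id)
  ‖w‖⁻¹ • w

open Classical in
/-- The discontinuous Galerkin advection term `∑_E ∫_E |u · n| ⟦A⟧ : B⁺`, summed over the internal
facets `E` with respect to the surface measure, where `⟦A⟧ = A⁺ - A⁻` and `+` is the downstream
side. Every facet is counted once for each of its two orientations `(K, L)`, and the positive part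
of `u · n` keeps, at each of its points, the orientation for which `L` is the downstream cell. -/
def upwindForm (u : T.VectorField) (A B : T.TensorField) : ℝ :=
  ∑ K : T.Cell, ∑ L : T.Cell,
    if (commonFace K L).card = d then
      ∫ x in convexHull ℝ (commonFace K L : Set (EuclideanSpace ℝ (Fin d))),
        max (∑ i, vecValue (u K) x i * unitNormal K L i) 0 * ddot (A L - A K) (B L) ∂μHE[d - 1]
    else 0

/-! ### The scheme -/

/-- The left-hand side of the variational formulation of one step of the scheme, from the state
`(u₀, A₀)` to `(u, p, A)`, tested against `(v, q, B)`. -/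
def weakForm (Re We ε δt : ℝ) (u₀ : T.VectorField) (A₀ : T.TensorField)
    (u : T.VectorField) (p : T.ScalarField) (A : T.TensorField)
    (v : T.VectorField) (q : T.ScalarField) (B : T.TensorField) : ℝ :=
  T.integral (fun K x =>
    Re * ((δt⁻¹ • (vecValue (u K) x - vecValue (u₀ K) x)
        + gradValue (u K) x *ᵥ vecValue (u₀ K) x) ⬝ᵥ vecValue (v K) x)
      - value (p K) x * value (divPoly (v K)) x
      + value (q K) x * value (divPoly (u K)) x
      + (1 - ε) * ddot (gradValue (u K) x) (gradValue (v K) x)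
      + ε / We * ddot (A K) (gradValue (v K) x)
      + 1 / We * ddot (A K - 1) (B K)
      + ddot (δt⁻¹ • (A K - A₀ K)) (B K)
      - ddot (gradValue (u K) x * A K + A K * (gradValue (u K) x)ᵀ) (B K))
    + T.upwindForm u₀ A B

/-- `(u, p, A)` solves one step of the scheme from the state `(u₀, A₀)`, and all the values of `A`
are positive definite. -/
def IsPosDefSolution (Re We ε δt : ℝ) (u₀ : T.VectorField) (A₀ : T.TensorField)
    (u : T.VectorField) (p : T.ScalarField) (A : T.TensorField) : Prop :=
  u ∈ T.velocitySpace ∧ p ∈ T.pressureSpace ∧ A ∈ T.tensorSpace ∧ (∀ K, (A K).PosDef) ∧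
    ∀ v ∈ T.velocitySpace, ∀ q ∈ T.pressureSpace, ∀ B ∈ T.tensorSpace,
      T.weakForm Re We ε δt u₀ A₀ u p A v q B = 0

/-- The discrete free energy `Re/2 ∫ |u|² + ε/(2We) ∫ tr (A - ln A - I)`; the logarithm of a
symmetric matrix is given by the functional calculus. -/
def freeEnergy (Re We ε : ℝ) (u : T.VectorField) (A : T.TensorField) : ℝ :=
  Re / 2 * T.integral (fun K x => vecValue (u K) x ⬝ᵥ vecValue (u K) x)
    + ε / (2 * We) * T.integral (fun K _ => (A K - cfc Real.log (A K) - 1).trace)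

/-- The dissipation `∫ Re/2 |u - u₀|² + δt ∫ ((1-ε)|∇u|² + ε/(2We²) tr (A + A⁻¹ - 2I))` of one
step of the scheme. -/
def dissipation (Re We ε δt : ℝ) (u₀ u : T.VectorField) (A : T.TensorField) : ℝ :=
  T.integral (fun K x => Re / 2 *
      ((vecValue (u K) x - vecValue (u₀ K) x) ⬝ᵥ (vecValue (u K) x - vecValue (u₀ K) x)))
    + δt * T.integral (fun K x =>
        (1 - ε) * ddot (gradValue (u K) x) (gradValue (u K) x)
          + ε / (2 * We ^ 2) * (A K + (A K)⁻¹ - (2 : ℝ) • (1 : Matrix (Fin d) (Fin d) ℝ)).trace)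

end SimplicialMesh

end OldroydB

end

/-! The free energy controls everything. Its density `tr (A - ln A - I)` is the sum of `x - ln x -
1` over the eigenvalues of `A`, which blows up both at zero and at infinity. Hence `F ≤ M` bounds
the velocity in `L²`, bounds `A`, and keeps the eigenvalues of `A` above some `m > 0`, with
constants depending only on the mesh, the parameters and `M` (`exists_bound_of_freeEnergy_le`).

The energy estimate (`freeEnergy_add_dissipation_le`) comes from testing with `(u, p, ε/(2We) (I -
A⁻¹))`; the tensor is admissible because `A` is cellwise constant, so that `A⁻¹` stays in the space.
The pressure terms cancel. The divergence of `u₀` belongs to the pressure space, so `u₀` is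
divergence-free pointwise and convection does no work. The stretching term cancels the stress term
up to a multiple of `∫ div u = 0`. Concavity of `ln det` bounds the time difference and the upwind
jumps below by differences of the energy density; the flux-weighted differences sum to zero, because
the net flux of `u₀` out of every cell is zero. All this rests on the divergence theorem on the
mesh: Fubini and the fundamental theorem of calculus along the edges of one simplex
(`integral_deriv_edge`), then the fact that a facet of a cell either belongs to exactly one other
cell or lies on the boundary.

For existence, testing only with divergence-free velocities removes the pressure and leaves one
implicit Euler step `y - y₀ + δt G(y₀, y) = 0` in a finite-dimensional Euclidean space, with `G`
bounded and Lipschitz in `y` on balls (`isLipschitzOnBalls_evolutionForm`). For small `δt` the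
Banach fixed point theorem gives a solution within `r` of `y₀` (`exists_implicitEuler_step`), where
`r` is so small that the tensor stays positive definite. The pressure is recovered by duality
(`exists_pressure`).

Uniqueness is global: another positive definite solution might lie far from `y₀`, but it also
satisfies the energy estimate, so its energy is at most `M` and it lies in the ball of radius `R`
given by the a priori bound, where the Lipschitz constant of `δt G` is at most one half. The
pressure is determined up to the modes the scheme does not see; these contain the constants, and
stability of the pair leaves no nonzero mode of zero mean. -/

noncomputable section

namespace OldroydB

/-! ### Eigenvalues, `ln det` and the energy density of a positive definite matrix -/

section MatrixFacts

variable {n : Type*} [Fintype n] [DecidableEq n]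

theorem trace_cfc {A : Matrix n n ℝ} (hA : A.IsHermitian) (f : ℝ → ℝ) :
    (cfc f A).trace = ∑ i, f (hA.eigenvalues i) := by
  rw [hA.cfc_eq, Matrix.IsHermitian.cfc, Unitary.conjStarAlgAut_apply, Matrix.trace_mul_cycle,
    Unitary.coe_star_mul_self, one_mul, Matrix.trace_diagonal]
  simp

theorem trace_eq_sum_eigenvalues {A : Matrix n n ℝ} (hA : A.IsHermitian) :
    A.trace = ∑ i, hA.eigenvalues i := by
  simpa using hA.trace_eq_sum_eigenvalues

theorem log_det_eq_sum {A : Matrix n n ℝ} (hA : A.PosDef) :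
    Real.log A.det = ∑ i, Real.log (hA.isHermitian.eigenvalues i) := by
  rw [hA.isHermitian.det_eq_prod_eigenvalues, ← Real.log_prod]
  · simp
  · exact fun i _ => (hA.eigenvalues_pos i).ne'

/-- Sum `ln x ≤ x - 1` over the eigenvalues. -/
theorem log_det_le_trace_sub_card {A : Matrix n n ℝ} (hA : A.PosDef) :
    Real.log A.det ≤ A.trace - Fintype.card n := by
  rw [log_det_eq_sum hA, trace_eq_sum_eigenvalues hA.isHermitian]
  have : (Fintype.card n : ℝ) = ∑ _i : n, (1 : ℝ) := by simp
  rw [this, ← Finset.sum_sub_distrib]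
  exact Finset.sum_le_sum fun i _ => Real.log_le_sub_one_of_pos (hA.eigenvalues_pos i)

open scoped MatrixOrder in
theorem exists_eq_conjTranspose_mul_self {A : Matrix n n ℝ} (hA : A.PosSemidef) :
    ∃ C : Matrix n n ℝ, A = Cᴴ * C := by
  obtain ⟨X, hX, -, h⟩ := CFC.exists_sqrt_of_isSelfAdjoint_of_quasispectrumRestricts
    hA.isHermitian (QuasispectrumRestricts.nnreal_of_nonneg hA.nonneg)
  refine ⟨X, ?_⟩
  rw [← h, ← Matrix.star_eq_conjTranspose, hX.star_eq]

/-- This is the tangent inequality for the concave function `ln det` at `B`. Writing `B⁻¹ = Cᴴ C`,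
it is the inequality at the identity applied to `C A Cᴴ`. -/
theorem log_det_sub_log_det_le {A B : Matrix n n ℝ} (hA : A.PosDef) (hB : B.PosDef) :
    Real.log A.det - Real.log B.det ≤ (A * B⁻¹).trace - Fintype.card n := by
  obtain ⟨C, hC⟩ := exists_eq_conjTranspose_mul_self hB.inv.posSemidef
  have hdet : C.det * C.det = B.det⁻¹ := by
    have := congrArg Matrix.det hC
    rw [Matrix.det_mul, Matrix.det_conjTranspose, Matrix.det_nonsing_inv] at this
    simpa using this.symm
  have hC0 : C.det ≠ 0 := by
    intro h
    have := hB.det_pos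
    rw [h] at hdet
    simp only [mul_zero, zero_eq_inv] at hdet
    exact this.ne hdet
  have hpd : (C * A * Cᴴ).PosDef := by
    refine hA.mul_mul_conjTranspose_same ?_
    exact Matrix.vecMul_injective_of_isUnit ((Matrix.isUnit_iff_isUnit_det _).2 hC0.isUnit)
  have h := log_det_le_trace_sub_card hpd
  have hd : (C * A * Cᴴ).det = A.det * B.det⁻¹ := by
    rw [Matrix.det_mul, Matrix.det_mul, Matrix.det_conjTranspose, ← hdet]
    simp; ring
  rw [hd, Real.log_mul hA.det_pos.ne' (inv_ne_zero hB.det_pos.ne'), Real.log_inv] at h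
  have e : (C * A * Cᴴ).trace = (A * (Cᴴ * C)).trace := by
    rw [Matrix.trace_mul_cycle, Matrix.trace_mul_comm]
  rw [hC]
  linarith

theorem trace_sub_cfc_log {A : Matrix n n ℝ} (hA : A.PosDef) :
    (A - cfc Real.log A - 1).trace = A.trace - Real.log A.det - Fintype.card n := by
  rw [Matrix.trace_sub, Matrix.trace_sub, trace_cfc hA.isHermitian, log_det_eq_sum hA,
    Matrix.trace_one]

theorem trace_sub_cfc_log_nonneg {A : Matrix n n ℝ} (hA : A.PosDef) :
    0 ≤ (A - cfc Real.log A - 1).trace := by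
  rw [trace_sub_cfc_log hA]
  linarith [log_det_le_trace_sub_card hA]

theorem trace_sub_cfc_log_eq_sum {A : Matrix n n ℝ} (hA : A.PosDef) :
    (A - cfc Real.log A - 1).trace =
      ∑ i, (hA.isHermitian.eigenvalues i - Real.log (hA.isHermitian.eigenvalues i) - 1) := by
  rw [Matrix.trace_sub, Matrix.trace_sub, trace_cfc hA.isHermitian,
    trace_eq_sum_eigenvalues hA.isHermitian, Matrix.trace_one]
  simp [Finset.sum_sub_distrib]

/-- Add the bound of `ln det` by the trace for `A` and for `A⁻¹`: the logarithms cancel. -/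
theorem trace_add_inv_sub_two_nonneg {A : Matrix n n ℝ} (hA : A.PosDef) :
    0 ≤ (A + A⁻¹ - (2 : ℝ) • (1 : Matrix n n ℝ)).trace := by
  have h1 := log_det_le_trace_sub_card hA
  have h2 := log_det_le_trace_sub_card hA.inv
  rw [Matrix.det_nonsing_inv, Ring.inverse_eq_inv', Real.log_inv] at h2
  rw [Matrix.trace_sub, Matrix.trace_add, Matrix.trace_smul, Matrix.trace_one, smul_eq_mul]
  linarith

/-- All the terms `x - ln x - 1` are nonnegative, so each is at most `M`; dropping `x > 0` leaves
`-ln x - 1 ≤ M`. -/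
theorem le_eigenvalues_of_trace_le {A : Matrix n n ℝ} (hA : A.PosDef) {M : ℝ}
    (hM : (A - cfc Real.log A - 1).trace ≤ M) (i : n) :
    Real.exp (-1 - M) ≤ hA.isHermitian.eigenvalues i := by
  rw [trace_sub_cfc_log_eq_sum hA] at hM
  have hpos := hA.eigenvalues_pos i
  have h1 := Finset.single_le_sum (f := fun i => hA.isHermitian.eigenvalues i -
    Real.log (hA.isHermitian.eigenvalues i) - 1)
    (fun j _ => by linarith [Real.log_le_sub_one_of_pos (hA.eigenvalues_pos j)]) (Finset.mem_univ i)
  rw [← Real.exp_log hpos]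
  refine Real.exp_le_exp.2 ?_
  linarith

/-- Eigenvalue by eigenvalue, `ln x ≤ x / 2`, which follows from `ln (x / 2) ≤ x / 2 - 1` and `ln 2
< 1`. -/
theorem trace_le_of_trace_le {A : Matrix n n ℝ} (hA : A.PosDef) {M : ℝ}
    (hM : (A - cfc Real.log A - 1).trace ≤ M) : A.trace ≤ 2 * (M + Fintype.card n) := by
  rw [trace_sub_cfc_log_eq_sum hA] at hM
  rw [trace_eq_sum_eigenvalues hA.isHermitian]
  have key : ∑ i, (hA.isHermitian.eigenvalues i / 2 - 1) ≤ M := by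
    refine le_trans (Finset.sum_le_sum fun i _ => ?_) hM
    have hpos := hA.eigenvalues_pos i
    have h1 := Real.log_le_sub_one_of_pos (half_pos hpos)
    rw [Real.log_div hpos.ne' two_ne_zero] at h1
    have h2 := Real.log_two_lt_d9
    linarith
  rw [Finset.sum_sub_distrib, ← Finset.sum_div] at key
  simp at key
  linarith

theorem trace_mul_self_le {A : Matrix n n ℝ} (hA : A.PosDef) : (A * A).trace ≤ A.trace ^ 2 := by
  have h : (cfc (fun x : ℝ => x * x) A) = A * A := by
    have hs : IsSelfAdjoint A := hA.isHermitian
    have hc : ∀ f : ℝ → ℝ, ContinuousOn f (spectrum ℝ A) := fun f =>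
      (Matrix.finite_real_spectrum (A := A)).continuousOn f
    rw [cfc_mul (fun x : ℝ => x) (fun x => x) A (hc _) (hc _), cfc_id' ℝ A]
  rw [← h, trace_cfc hA.isHermitian, trace_eq_sum_eigenvalues hA.isHermitian]
  simp_rw [← pow_two]
  exact Finset.sum_sq_le_sq_sum_of_nonneg fun i _ => (hA.eigenvalues_pos i).le

theorem dotProduct_mulVec_ge {A : Matrix n n ℝ} (hA : A.IsHermitian) {m : ℝ}
    (hm : ∀ i, m ≤ hA.eigenvalues i) (x : n → ℝ) : m * (x ⬝ᵥ x) ≤ x ⬝ᵥ (A *ᵥ x) := by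
  have h : (A - m • (1 : Matrix n n ℝ)).PosSemidef := by
    have e : A - m • (1 : Matrix n n ℝ) = (hA.eigenvectorUnitary : Matrix n n ℝ) *
        Matrix.diagonal (fun i => hA.eigenvalues i - m) *
        (hA.eigenvectorUnitary : Matrix n n ℝ)ᴴ := by
      conv_lhs => rw [hA.spectral_theorem, Unitary.conjStarAlgAut_apply]
      have : (Matrix.diagonal (fun i => hA.eigenvalues i - m) : Matrix n n ℝ) =
          Matrix.diagonal hA.eigenvalues - m • (1 : Matrix n n ℝ) := by
        rw [← Matrix.diagonal_one, ← Matrix.diagonal_smul, Matrix.diagonal_sub]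
        simp
      rw [this, Matrix.mul_sub, Matrix.sub_mul]
      have hU : (hA.eigenvectorUnitary : Matrix n n ℝ) *
          (hA.eigenvectorUnitary : Matrix n n ℝ)ᴴ = 1 :=
        Unitary.coe_mul_star_self hA.eigenvectorUnitary
      rw [Matrix.mul_smul, mul_one, Matrix.smul_mul, hU]
      rfl
    rw [e]
    exact (Matrix.PosSemidef.diagonal fun i => sub_nonneg.2 (hm i)).mul_mul_conjTranspose_same _
  have := h.re_dotProduct_nonneg x
  simp only [Matrix.sub_mulVec, Matrix.smul_mulVec, Matrix.one_mulVec, dotProduct_sub,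
    dotProduct_smul, star_trivial, RCLike.re_to_real, smul_eq_mul] at this
  linarith

end MatrixFacts

variable {d : ℕ}

theorem ddot_eq_trace (A B : Matrix (Fin d) (Fin d) ℝ) : ddot A B = (A * Bᵀ).trace := by
  simp [ddot, Matrix.trace, Matrix.mul_apply]

theorem ddot_self_nonneg (A : Matrix (Fin d) (Fin d) ℝ) : 0 ≤ ddot A A :=
  Finset.sum_nonneg fun _ _ => Finset.sum_nonneg fun _ _ => mul_self_nonneg _

/-- Cauchy–Schwarz for `D` against the rank-one matrix `x xᵀ`. -/
theorem sq_dotProduct_mulVec_le (D : Matrix (Fin d) (Fin d) ℝ) (x : Fin d → ℝ) :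
    (x ⬝ᵥ (D *ᵥ x)) ^ 2 ≤ ddot D D * (x ⬝ᵥ x) ^ 2 := by
  have h := Finset.sum_mul_sq_le_sq_mul_sq (Finset.univ : Finset (Fin d × Fin d))
    (fun p => D p.1 p.2) (fun p => x p.1 * x p.2)
  simp only [Fintype.sum_prod_type] at h
  convert! h using 2
  · simp only [dotProduct, Matrix.mulVec, Finset.mul_sum]
    exact Finset.sum_congr rfl fun i _ => Finset.sum_congr rfl fun j _ => by ring
  · simp [ddot, pow_two]
  · simp only [dotProduct, pow_two, Finset.sum_mul_sum]
    exact Finset.sum_congr rfl fun i _ => Finset.sum_congr rfl fun j _ => by ring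

/-- A symmetric matrix close to one with eigenvalues at least `m` is positive definite. -/
theorem posDef_of_ddot_sub_lt {A A₀ : Matrix (Fin d) (Fin d) ℝ} (hA : A.IsSymm)
    (hA₀ : A₀.IsHermitian) {m : ℝ} (hm : 0 < m) (hA₀m : ∀ i, m ≤ hA₀.eigenvalues i)
    (h : ddot (A - A₀) (A - A₀) < m ^ 2) : A.PosDef := by
  rw [Matrix.posDef_iff_dotProduct_mulVec]
  refine ⟨by rw [Matrix.IsHermitian, Matrix.conjTranspose_eq_transpose_of_trivial]; exact hA,
    fun x hx => ?_⟩
  have hx0 : 0 < x ⬝ᵥ x := by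
    have := Matrix.dotProduct_star_self_pos_iff.2 hx
    simpa using this
  have h1 := dotProduct_mulVec_ge hA₀ hA₀m x
  have h2 := sq_dotProduct_mulVec_le (A - A₀) x
  -- The perturbation changes the quadratic form by less than `m |x|²`, which is at most its value
  -- for `A₀`.
  have h3 : (x ⬝ᵥ ((A - A₀) *ᵥ x)) ^ 2 < (m * (x ⬝ᵥ x)) ^ 2 := by
    rw [mul_pow]
    exact h2.trans_lt (mul_lt_mul_of_pos_right h (by positivity))
  have h4 := abs_lt_of_sq_lt_sq h3 (by positivity)
  rw [Matrix.sub_mulVec, dotProduct_sub] at h4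
  simp only [star_trivial]
  linarith [(abs_lt.1 h4).1]

/-! ### Implicit Euler steps by contraction -/

section ImplicitEuler

variable {E : Type*} [NormedAddCommGroup E] [InnerProductSpace ℝ E] [FiniteDimensional ℝ E]

/-- The Riesz representative of a linear functional on a finite-dimensional space. -/
theorem exists_riesz (ℓ : E →ₗ[ℝ] ℝ) : ∃ g : E, ∀ v, inner ℝ g v = ℓ v := by
  have := FiniteDimensional.complete ℝ E
  exact ⟨(InnerProductSpace.toDual ℝ E).symm (LinearMap.toContinuousLinearMap ℓ), fun v => by
    rw [InnerProductSpace.toDual_symm_apply]; rfl⟩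

/-- One implicit Euler step for a vector field that is bounded and Lipschitz on balls. -/
theorem exists_implicitEuler_step (f : E → E → (E →ₗ[ℝ] ℝ))
    (hf : ∀ R : ℝ, ∃ L : ℝ, ∀ y₀ y y' v : E, ‖y₀‖ ≤ R → ‖y‖ ≤ R → ‖y'‖ ≤ R →
      |f y₀ y v| ≤ L * ‖v‖ ∧ |f y₀ y v - f y₀ y' v| ≤ L * ‖y - y'‖ * ‖v‖)
    (R r : ℝ) (hr : 0 < r) :
    ∃ c₀ : ℝ, 0 < c₀ ∧ ∀ δ : ℝ, 0 < δ → δ < c₀ → ∀ y₀ : E, ‖y₀‖ ≤ R →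
      (∃ y, ‖y - y₀‖ ≤ r ∧ ∀ v, inner ℝ (y - y₀) v + δ * f y₀ y v = 0) ∧
      ∀ y y', ‖y‖ ≤ R → ‖y'‖ ≤ R → (∀ v, inner ℝ (y - y₀) v + δ * f y₀ y v = 0) →
        (∀ v, inner ℝ (y' - y₀) v + δ * f y₀ y' v = 0) → y = y' := by
  have := FiniteDimensional.complete ℝ E
  -- The iterates stay within `r` of a point `y₀` of norm at most `R`.
  obtain ⟨L₀, hL₀⟩ := hf (R + r)
  obtain ⟨L, hL0, hL⟩ : ∃ L : ℝ, 0 < L ∧ ∀ y₀ y y' v : E, ‖y₀‖ ≤ R + r → ‖y‖ ≤ R + r →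
      ‖y'‖ ≤ R + r → |f y₀ y v| ≤ L * ‖v‖ ∧ |f y₀ y v - f y₀ y' v| ≤ L * ‖y - y'‖ * ‖v‖ := by
    -- The given constant may have any sign; this one can be divided by.
    refine ⟨|L₀| + 1, by positivity, fun y₀ y y' v h0 h1 h2 => ?_⟩
    have hle : L₀ ≤ |L₀| + 1 := (le_abs_self _).trans (by linarith)
    obtain ⟨ha, hb⟩ := hL₀ y₀ y y' v h0 h1 h2
    exact ⟨ha.trans (by gcongr), hb.trans (by gcongr)⟩
  choose G hG using fun y₀ y => exists_riesz (f y₀ y)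
  have hGb : ∀ y₀ y : E, ‖y₀‖ ≤ R + r → ‖y‖ ≤ R + r → ‖G y₀ y‖ ≤ L := by
    intro y₀ y h0 h1
    by_contra! hlt
    -- Testing with the Riesz representative itself turns a bound on the functional into a bound on
    -- its norm.
    have h := (hL y₀ y y (G y₀ y) h0 h1 h1).1
    rw [← hG, real_inner_self_eq_norm_sq, abs_of_nonneg (by positivity)] at h
    nlinarith
  have hGl : ∀ y₀ y y' : E, ‖y₀‖ ≤ R + r → ‖y‖ ≤ R + r → ‖y'‖ ≤ R + r →
      ‖G y₀ y - G y₀ y'‖ ≤ L * ‖y - y'‖ := by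
    intro y₀ y y' h0 h1 h2
    by_contra! hlt
    have h := (hL y₀ y y' (G y₀ y - G y₀ y') h0 h1 h2).2
    rw [← hG, ← hG, ← inner_sub_left, real_inner_self_eq_norm_sq,
      abs_of_nonneg (by positivity)] at h
    have : 0 ≤ L * ‖y - y'‖ := by positivity
    nlinarith
  have heq : ∀ δ : ℝ, ∀ y₀ y : E, (∀ v, inner ℝ (y - y₀) v + δ * f y₀ y v = 0) ↔
      y = y₀ - δ • G y₀ y := by
    intro δ y₀ y
    have : ∀ v, inner ℝ (y - y₀) v + δ * f y₀ y v = inner ℝ (y - (y₀ - δ • G y₀ y)) v := by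
      intro v
      rw [← hG]
      simp only [inner_sub_left, inner_smul_left, RCLike.conj_to_real]
      ring
    simp_rw [this]
    rw [← sub_eq_zero (a := y) (b := y₀ - δ • G y₀ y)]
    exact ⟨fun h => inner_self_eq_zero.1 (h _), fun h v => by rw [h, inner_zero_left]⟩
  -- The first bound makes the contraction factor one half, the second keeps the ball of radius `r`
  -- invariant.
  refine ⟨min (1 / (2 * L)) (r / L), by positivity, fun δ hδ hδc y₀ hy₀ => ?_⟩
  have hδ1 : δ * L ≤ 1 / 2 := by
    have := (hδc.trans_le (min_le_left _ _)).le
    rw [le_div_iff₀ (by positivity)] at this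
    linarith
  have hδ2 : δ * L ≤ r := by
    have := (hδc.trans_le (min_le_right _ _)).le
    rwa [le_div_iff₀ hL0] at this
  constructor
  · have hball : ∀ y ∈ Metric.closedBall y₀ r, ‖y‖ ≤ R + r := fun y hy => by
      have := norm_le_norm_add_norm_sub' y y₀
      rw [mem_closedBall_iff_norm] at hy
      linarith
    have hmaps : Set.MapsTo (fun y => y₀ - δ • G y₀ y) (Metric.closedBall y₀ r)
        (Metric.closedBall y₀ r) := by
      intro y hy
      rw [mem_closedBall_iff_norm, sub_sub_cancel_left, norm_neg, norm_smul, Real.norm_eq_abs,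
        abs_of_pos hδ]
      exact (mul_le_mul_of_nonneg_left (hGb y₀ y (by linarith) (hball y hy)) hδ.le).trans hδ2
    have hcontr : ContractingWith (1 / 2) (hmaps.restrict _ _ _) := by
      refine ⟨by norm_num, LipschitzWith.of_dist_le_mul fun y y' => ?_⟩
      rw [Subtype.dist_eq, Subtype.dist_eq, dist_eq_norm, dist_eq_norm]
      simp only [Set.MapsTo.val_restrict_apply, sub_sub_sub_cancel_left]
      rw [← smul_sub, norm_smul, Real.norm_eq_abs, abs_of_pos hδ, norm_sub_rev (y : E)]
      have := hGl y₀ y' y (by linarith) (hball _ y'.2) (hball _ y.2)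
      calc δ * ‖G y₀ y' - G y₀ y‖ ≤ δ * (L * ‖(y' : E) - y‖) := by gcongr
        _ = (δ * L) * ‖(y' : E) - y‖ := by ring
        _ ≤ 1 / 2 * ‖(y' : E) - y‖ := by gcongr
        _ = _ := by simp
    obtain ⟨y, hy, hfix, -⟩ := hcontr.exists_fixedPoint' Metric.isClosed_closedBall.isComplete
      hmaps (Metric.mem_closedBall_self hr.le) (edist_ne_top _ _)
    exact ⟨y, mem_closedBall_iff_norm.1 hy, (heq δ y₀ y).2 hfix.symm⟩
  -- The two solutions need not be close to `y₀`: the Lipschitz bound on the large ball suffices.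
  · intro y y' hy hy' h h'
    rw [heq] at h h'
    have h1 : ‖y - y'‖ ≤ 1 / 2 * ‖y - y'‖ := by
      calc ‖y - y'‖ = ‖δ • (G y₀ y' - G y₀ y)‖ := by
            conv_lhs => rw [h, h', sub_sub_sub_cancel_left, ← smul_sub]
        _ = δ * ‖G y₀ y' - G y₀ y‖ := by rw [norm_smul, Real.norm_eq_abs, abs_of_pos hδ]
        _ ≤ δ * (L * ‖y' - y‖) := by
            gcongr
            exact hGl y₀ y' y (by linarith) (by linarith) (by linarith)
        _ = (δ * L) * ‖y - y'‖ := by rw [norm_sub_rev]; ring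
        _ ≤ 1 / 2 * ‖y - y'‖ := by gcongr
    rw [← sub_eq_zero, ← norm_eq_zero]
    linarith [norm_nonneg (y - y')]

end ImplicitEuler

/-! ### Continuity of multilinear forms in finite dimension -/

section FiniteDimensionalBounds

variable {E : Type*} [NormedAddCommGroup E] [NormedSpace ℝ E] [FiniteDimensional ℝ E]

theorem exists_bound_linear (t : E →ₗ[ℝ] ℝ) : ∃ C : ℝ, 0 ≤ C ∧ ∀ a, |t a| ≤ C * ‖a‖ :=
  ⟨‖LinearMap.toContinuousLinearMap t‖, norm_nonneg _,
    fun a => (LinearMap.toContinuousLinearMap t).le_opNorm a⟩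

theorem exists_bound_linear_of_finiteDimensional {F : Type*} [NormedAddCommGroup F]
    [NormedSpace ℝ F] (t : E →ₗ[ℝ] F) : ∃ C : ℝ, 0 ≤ C ∧ ∀ a, ‖t a‖ ≤ C * ‖a‖ :=
  ⟨‖LinearMap.toContinuousLinearMap t‖, norm_nonneg _,
    fun a => (LinearMap.toContinuousLinearMap t).le_opNorm a⟩

theorem exists_bound_bilinear (t : E →ₗ[ℝ] E →ₗ[ℝ] ℝ) :
    ∃ C : ℝ, 0 ≤ C ∧ ∀ a b, |t a b| ≤ C * ‖a‖ * ‖b‖ := by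
  obtain ⟨C, hC, h⟩ := exists_bound_linear_of_finiteDimensional
    ((LinearMap.toContinuousLinearMap (𝕜 := ℝ) (E := E) (F' := ℝ)).toLinearMap ∘ₗ t)
  refine ⟨C, hC, fun a b => ?_⟩
  have := (LinearMap.toContinuousLinearMap (t a)).le_opNorm b
  exact this.trans (mul_le_mul_of_nonneg_right (h a) (norm_nonneg _))

/-- After currying, `t` is a linear map from a finite-dimensional space into the normed space of
continuous bilinear forms, hence bounded. -/
theorem exists_bound_trilinear (t : E →ₗ[ℝ] E →ₗ[ℝ] E →ₗ[ℝ] ℝ) :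
    ∃ C : ℝ, 0 ≤ C ∧ ∀ a b c, |t a b c| ≤ C * ‖a‖ * ‖b‖ * ‖c‖ := by
  let Φ : (E →ₗ[ℝ] E →ₗ[ℝ] ℝ) →ₗ[ℝ] (E →L[ℝ] E →L[ℝ] ℝ) :=
    (LinearMap.toContinuousLinearMap (𝕜 := ℝ) (E := E) (F' := E →L[ℝ] ℝ)).toLinearMap ∘ₗ
      LinearMap.compRight ℝ
        (LinearMap.toContinuousLinearMap (𝕜 := ℝ) (E := E) (F' := ℝ)).toLinearMap
  obtain ⟨C, hC, h⟩ := exists_bound_linear_of_finiteDimensional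
    (F := E →L[ℝ] E →L[ℝ] ℝ) (Φ ∘ₗ t)
  refine ⟨C, hC, fun a b c => ?_⟩
  have h1 := ((Φ (t a)) b).le_opNorm c
  have h2 := (Φ (t a)).le_opNorm b
  have h3 := h a
  calc |t a b c| ≤ ‖(Φ (t a)) b‖ * ‖c‖ := h1
    _ ≤ ‖Φ (t a)‖ * ‖b‖ * ‖c‖ := by gcongr
    _ ≤ C * ‖a‖ * ‖b‖ * ‖c‖ := by gcongr; exact h3

end FiniteDimensionalBounds

/-- A finite-dimensional space with a positive definite symmetric form has orthonormal
coordinates. -/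
theorem exists_orthonormal_coordinates {Y : Type*} [AddCommGroup Y] [Module ℝ Y]
    [FiniteDimensional ℝ Y] (m : Y →ₗ[ℝ] Y →ₗ[ℝ] ℝ) (hsymm : ∀ a b, m a b = m b a)
    (hpos : ∀ a, a ≠ 0 → 0 < m a a) :
    ∃ (n : ℕ) (φ : EuclideanSpace ℝ (Fin n) ≃ₗ[ℝ] Y), ∀ a b, m (φ a) (φ b) = inner ℝ a b := by
  let core : InnerProductSpace.Core ℝ Y :=
    { inner := fun a b => m a b
      conj_inner_symm := fun a b => by simp [hsymm a b]
      re_inner_nonneg := fun a => by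
        rcases eq_or_ne a 0 with rfl | h
        · simp
        · exact (hpos a h).le
      add_left := fun a b c => by simp
      smul_left := fun a b r => by simp
      definite := fun a h => by
        by_contra h0
        exact (hpos a h0).ne' h }
  let _ : NormedAddCommGroup Y := core.toNormedAddCommGroup
  let _ : InnerProductSpace ℝ Y := InnerProductSpace.ofCore core.toCore
  refine ⟨_, (stdOrthonormalBasis ℝ Y).repr.symm.toLinearEquiv, fun a b => ?_⟩
  exact (stdOrthonormalBasis ℝ Y).repr.symm.inner_map_map a b

/-! ### Fubini with respect to a hyperplane and a transverse direction -/

section Hyperplane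

variable {d : ℕ}

local notation "𝔼" => EuclideanSpace ℝ (Fin d)

/-- The hyperplane through `p` orthogonal to `n`. -/
def hyperplane (n p : EuclideanSpace ℝ (Fin d)) : Set (EuclideanSpace ℝ (Fin d)) :=
  {y | inner ℝ n (y - p) = 0}

/-- The isometric parametrisation of a hyperplane by its direction. -/
def hyperplaneParam (n p : EuclideanSpace ℝ (Fin d)) (w : (ℝ ∙ n)ᗮ) : EuclideanSpace ℝ (Fin d) :=
  (w : EuclideanSpace ℝ (Fin d)) + p

theorem isometry_hyperplaneParam (n p : 𝔼) : Isometry (hyperplaneParam n p) :=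
  Isometry.of_dist_eq fun x y => by simp [hyperplaneParam, Subtype.dist_eq]

theorem range_hyperplaneParam (n p : 𝔼) : Set.range (hyperplaneParam n p) = hyperplane n p := by
  ext y
  constructor
  · rintro ⟨w, rfl⟩
    have := w.2
    rw [Submodule.mem_orthogonal_singleton_iff_inner_right] at this
    simpa [hyperplane, hyperplaneParam] using this
  · intro hy
    exact ⟨⟨y - p, Submodule.mem_orthogonal_singleton_iff_inner_right.2 hy⟩,
      by simp [hyperplaneParam]⟩

/-- Isometries preserve the Hausdorff measure, and on the direction of the hyperplane, of dimension
`d - 1`, the normalised Hausdorff measure is the volume. -/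
theorem map_hyperplaneParam {n : 𝔼} (hn : ‖n‖ = 1) (p : 𝔼) :
    (volume : Measure (ℝ ∙ n)ᗮ).map (hyperplaneParam n p) =
      (μHE[d - 1] : Measure 𝔼).restrict (hyperplane n p) := by
  have hn0 : n ≠ 0 := fun h => by simp [h] at hn
  have hfr : Module.finrank ℝ (ℝ ∙ n)ᗮ = d - 1 := by
    have h1 := (ℝ ∙ n).finrank_add_finrank_orthogonal
    rw [finrank_span_singleton hn0, finrank_euclideanSpace_fin] at h1
    omega
  rw [← range_hyperplaneParam, ← (isometry_hyperplaneParam n p).map_euclideanHausdorffMeasure,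
    ← InnerProductSpace.euclideanHausdorffMeasure_eq_volume, hfr]

theorem measure_lt_top_of_subset_hyperplane {n : 𝔼} (hn : ‖n‖ = 1) {p : 𝔼} {F : Set 𝔼}
    (hF : IsCompact F) (hFH : F ⊆ hyperplane n p) : (μHE[d - 1] : Measure 𝔼) F < ⊤ := by
  have h := map_hyperplaneParam hn p
  have h1 : (μHE[d - 1] : Measure 𝔼) F = (μHE[d - 1] : Measure 𝔼).restrict (hyperplane n p) F := by
    rw [Measure.restrict_apply hF.measurableSet, Set.inter_eq_left.2 hFH]
  rw [h1, ← h, Measure.map_apply (isometry_hyperplaneParam n p).continuous.measurable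
    hF.measurableSet]
  have hc : Topology.IsClosedEmbedding (hyperplaneParam n p) :=
    (isometry_hyperplaneParam n p).isClosedEmbedding
  exact (hc.isCompact_preimage hF).measure_lt_top

/-- Split `e = α n + w₀` with `w₀` orthogonal to `n`. The map is a shear `(s, w) ↦ (α s, s w₀ + w)`,
which contributes the factor `|α|⁻¹`, followed by the measure-preserving orthogonal decomposition.
-/
theorem map_add_smul_hyperplane {n : 𝔼} (hn : ‖n‖ = 1) (p e : 𝔼) (he : inner ℝ n e ≠ 0) :
    ((volume : Measure ℝ).prod ((μHE[d - 1] : Measure 𝔼).restrict (hyperplane n p))).map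
      (fun q => q.2 + q.1 • e) = ENNReal.ofReal |(inner ℝ n e)⁻¹| • (volume : Measure 𝔼) := by
  set α : ℝ := inner ℝ n e with hα
  have hw : e - α • n ∈ (ℝ ∙ n)ᗮ := by
    rw [Submodule.mem_orthogonal_singleton_iff_inner_right, inner_sub_right, inner_smul_right,
      real_inner_self_eq_norm_sq, hn, ← hα]
    ring
  let w₀ : (ℝ ∙ n)ᗮ := ⟨e - α • n, hw⟩
  -- the orthogonal decomposition
  have hT₀ : MeasurePreserving (fun q : ℝ × (ℝ ∙ n)ᗮ => (q.1 • n + (q.2 : 𝔼)) + p)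
      (volume.prod volume) (volume : Measure 𝔼) := by
    have h1 := ((ℝ ∙ n).measurePreserving_measurableEquivProd p).symm
    rw [finrank_euclideanSpace_fin, EuclideanSpace.euclideanHausdorffMeasure_eq_volume] at h1
    have h2 := (LinearIsometryEquiv.toSpanUnitSingleton (𝕜 := ℝ) n hn).measurePreserving
    have h3 := h1.comp (h2.prod (MeasurePreserving.id (volume : Measure (ℝ ∙ n)ᗮ)))
    have h4 : (fun q : ℝ × (ℝ ∙ n)ᗮ => (q.1 • n + (q.2 : 𝔼)) + p) =
        ((ℝ ∙ n).measurableEquivProd p).symm ∘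
          Prod.map (LinearIsometryEquiv.toSpanUnitSingleton (𝕜 := ℝ) n hn) id := by
      funext q
      simp [add_assoc]
    rw [h4]
    exact h3
  -- the shear
  have hS : MeasurePreserving (fun q : ℝ × (ℝ ∙ n)ᗮ => (α * q.1, q.1 • w₀ + q.2))
      (volume.prod volume) ((ENNReal.ofReal |α⁻¹| • volume).prod volume) := by
    refine MeasurePreserving.skew_product (f := fun s : ℝ => α * s)
      (g := fun s w => s • w₀ + w) ⟨by fun_prop, Real.map_volume_mul_left he⟩ ?_ ?_
    · exact Measurable.add (by fun_prop) (by fun_prop)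
    · exact Filter.Eventually.of_forall fun s => map_add_left_eq_self _ _
  rw [← map_hyperplaneParam hn p]
  have hid : (volume : Measure ℝ).prod ((volume : Measure (ℝ ∙ n)ᗮ).map (hyperplaneParam n p)) =
      (volume.prod volume).map (Prod.map id (hyperplaneParam n p)) := by
    rw [← Measure.map_prod_map _ _ measurable_id
      (isometry_hyperplaneParam n p).continuous.measurable, Measure.map_id]
  rw [hid, Measure.map_map (by fun_prop)
    (measurable_id.prodMap (isometry_hyperplaneParam n p).continuous.measurable)]
  have hcomp : (fun q : ℝ × 𝔼 => q.2 + q.1 • e) ∘ Prod.map id (hyperplaneParam n p) =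
      (fun q : ℝ × (ℝ ∙ n)ᗮ => (q.1 • n + (q.2 : 𝔼)) + p) ∘
        (fun q : ℝ × (ℝ ∙ n)ᗮ => (α * q.1, q.1 • w₀ + q.2)) := by
    funext q
    simp only [Function.comp, Prod.map, hyperplaneParam, id, w₀, Submodule.coe_add,
      Submodule.coe_smul, smul_sub, smul_smul, mul_comm α]
    abel
  rw [hcomp, ← Measure.map_map hT₀.measurable hS.measurable, hS.map_eq, Measure.prod_smul_left,
    Measure.map_smul, hT₀.map_eq]

/-- Integration over the space as an iterated integral over a hyperplane and along a transverse
direction. -/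
theorem integral_eq_integral_hyperplane {n : 𝔼} (hn : ‖n‖ = 1) (p e : 𝔼)
    (he : inner ℝ n e ≠ 0) {g : 𝔼 → ℝ} (hg : Integrable g) :
    ∫ x, g x = |inner ℝ n e| *
      ∫ y in hyperplane n p, (∫ s : ℝ, g (y + s • e)) ∂(μHE[d - 1] : Measure 𝔼) := by
  have hmap := map_add_smul_hyperplane hn p e he
  have hsf : SFinite ((μHE[d - 1] : Measure 𝔼).restrict (hyperplane n p)) := by
    rw [← map_hyperplaneParam hn p]
    infer_instance
  have hg' : Integrable g (ENNReal.ofReal |(inner ℝ n e)⁻¹| • (volume : Measure 𝔼)) :=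
    hg.smul_measure ENNReal.ofReal_ne_top
  have hmeas : Measurable (fun q : ℝ × 𝔼 => q.2 + q.1 • e) := by fun_prop
  have hint : Integrable (fun q : ℝ × 𝔼 => g (q.2 + q.1 • e))
      (volume.prod ((μHE[d - 1] : Measure 𝔼).restrict (hyperplane n p))) := by
    rw [← hmap] at hg'
    exact (integrable_map_measure hg'.aestronglyMeasurable hmeas.aemeasurable).1 hg'
  have h1 : ∫ y in hyperplane n p, (∫ s : ℝ, g (y + s • e)) ∂(μHE[d - 1] : Measure 𝔼) =
      |(inner ℝ n e)⁻¹| * ∫ x, g x := by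
    rw [← integral_prod_symm _ hint]
    have h2 := integral_map (f := g) hmeas.aemeasurable
      (by rw [hmap]; exact hg'.aestronglyMeasurable)
    rw [← h2, hmap, integral_smul_measure, ENNReal.toReal_ofReal (abs_nonneg _), smul_eq_mul]
  rw [h1, abs_inv, mul_inv_cancel_left₀ (abs_ne_zero.2 he)]

end Hyperplane

/-! ### Integration along the edges of a simplex -/

section Simplex

variable {d : ℕ} {ι : Type*} [Fintype ι] [DecidableEq ι]

local notation "𝔼" => EuclideanSpace ℝ (Fin d)

/-- The simplex spanned by an affine basis, in barycentric coordinates. -/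
def simplex (b : AffineBasis ι ℝ (EuclideanSpace ℝ (Fin d))) : Set (EuclideanSpace ℝ (Fin d)) :=
  {x | ∀ k, 0 ≤ b.coord k x}

/-- The facet of the simplex opposite to the vertex `i`. -/
def simplexFacet (b : AffineBasis ι ℝ (EuclideanSpace ℝ (Fin d))) (i : ι) :
    Set (EuclideanSpace ℝ (Fin d)) :=
  {x | b.coord i x = 0 ∧ ∀ k, 0 ≤ b.coord k x}

/-- Outward unit normals `n i` to the facets of a simplex. -/
structure IsOutwardNormal (b : AffineBasis ι ℝ (EuclideanSpace ℝ (Fin d)))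
    (n : ι → EuclideanSpace ℝ (Fin d)) : Prop where
  norm_eq : ∀ i, ‖n i‖ = 1
  coord : ∀ i, ∃ κ : ℝ, 0 < κ ∧ ∀ v, (b.coord i).linear v = -(κ * inner ℝ (n i) v)

variable (b : AffineBasis ι ℝ (EuclideanSpace ℝ (Fin d)))

theorem isCompact_simplex : IsCompact (simplex b) := by
  have : simplex b = convexHull ℝ (Set.range b) := by
    rw [b.convexHull_eq_nonneg_coord]
    rfl
  rw [this]
  exact (Set.finite_range b).isCompact_convexHull (𝕜 := ℝ)

theorem simplexFacet_eq_inter (i : ι) : simplexFacet b i = {x | b.coord i x = 0} ∩ simplex b := rfl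

theorem isCompact_simplexFacet (i : ι) : IsCompact (simplexFacet b i) :=
  (isCompact_simplex b).inter_left
    (isClosed_eq (continuous_barycentric_coord b i) continuous_const)

theorem coord_add_smul_sub {i j : ι} (k : ι) (y : 𝔼) (s : ℝ) :
    b.coord k (y + s • (b i - b j)) =
      b.coord k y + s * ((if k = i then 1 else 0) - (if k = j then 1 else 0)) := by
  rw [add_comm y, ← vadd_eq_add (s • (b i - b j)) y, AffineMap.map_vadd, map_smul,
    ← vsub_eq_sub (b i), AffineMap.linearMap_vsub, b.coord_apply, b.coord_apply]
  simp only [vsub_eq_sub, smul_eq_mul, vadd_eq_add]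
  ring

theorem coord_linear_sub {i j : ι} (k : ι) :
    (b.coord k).linear (b i - b j) = (if k = i then 1 else 0) - (if k = j then 1 else 0) := by
  rw [← vsub_eq_sub (b i), AffineMap.linearMap_vsub, b.coord_apply, b.coord_apply, vsub_eq_sub]

variable {b}

theorem IsOutwardNormal.hyperplane_eq {n : ι → 𝔼} (hn : IsOutwardNormal b n) {i j : ι}
    (hij : i ≠ j) : hyperplane (n i) (b j) = {x | b.coord i x = 0} := by
  obtain ⟨κ, hκ, h⟩ := hn.coord i
  ext y
  have h1 := h (y - b j)
  rw [← vsub_eq_sub, AffineMap.linearMap_vsub, b.coord_apply_ne hij, vsub_eq_sub, sub_zero] at h1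
  simp only [hyperplane, Set.mem_ofPred_eq, h1, vsub_eq_sub]
  simp [hκ.ne']

theorem IsOutwardNormal.measure_simplexFacet_lt_top [Nontrivial ι] {n : ι → 𝔼}
    (hn : IsOutwardNormal b n) (i : ι) :
    (μHE[d - 1] : Measure 𝔼) (simplexFacet b i) < ⊤ := by
  obtain ⟨j, hj⟩ := exists_ne i
  refine measure_lt_top_of_subset_hyperplane (hn.norm_eq i) (p := b j)
    (isCompact_simplexFacet b i) ?_
  rw [hn.hyperplane_eq hj.symm]
  exact fun x hx => hx.1

/-- From vertex `j` to vertex `i` the `i`-th barycentric coordinate grows, and `n i` is a negative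
multiple of its gradient. -/
theorem IsOutwardNormal.inner_neg {n : ι → 𝔼} (hn : IsOutwardNormal b n) {i j : ι}
    (hij : i ≠ j) : inner ℝ (n i) (b i - b j) < 0 := by
  obtain ⟨κ, hκ, h⟩ := hn.coord i
  have h1 := h (b i - b j)
  rw [coord_linear_sub, if_pos rfl, if_neg hij] at h1
  by_contra! h2
  nlinarith

theorem IsOutwardNormal.inner_eq_zero {n : ι → 𝔼} (hn : IsOutwardNormal b n) {i j k : ι}
    (hi : k ≠ i) (hj : k ≠ j) : inner ℝ (n k) (b i - b j) = 0 := by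
  obtain ⟨κ, hκ, h⟩ := hn.coord k
  have h1 := h (b i - b j)
  rw [coord_linear_sub, if_neg hi, if_neg hj] at h1
  simpa [hκ.ne'] using h1

theorem IsOutwardNormal.integrableOn_simplexFacet [Nontrivial ι] {n : ι → 𝔼}
    (hn : IsOutwardNormal b n) (i : ι) {f : 𝔼 → ℝ} (hf : Continuous f) :
    IntegrableOn f (simplexFacet b i) (μHE[d - 1] : Measure 𝔼) := by
  obtain ⟨C, hC⟩ := (isCompact_simplexFacet b i).exists_bound_of_continuousOn hf.continuousOn
  exact Measure.integrableOn_of_bounded (hn.measure_simplexFacet_lt_top i).ne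
    hf.aestronglyMeasurable (ae_restrict_of_forall_mem
      (isCompact_simplexFacet b i).measurableSet hC)

/-- The projection along an edge maps one facet onto the other and scales the surface measure by
the ratio of the transversal components of the edge. -/
theorem IsOutwardNormal.integral_facet_projection {n : ι → 𝔼} (hn : IsOutwardNormal b n) {i j : ι}
    (hij : i ≠ j) {f : 𝔼 → ℝ} (hf : Continuous f) :
    |inner ℝ (n i) (b i - b j)| * ∫ y in simplexFacet b i,
        f (y + b.coord j y • (b i - b j)) ∂(μHE[d - 1] : Measure 𝔼) =
      |inner ℝ (n j) (b i - b j)| * ∫ y in simplexFacet b j, f y ∂(μHE[d - 1] : Measure 𝔼) := by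
  have hi0 := (hn.inner_neg hij).ne
  have hj0 : inner ℝ (n j) (b i - b j) ≠ 0 := by
    rw [← neg_sub, inner_neg_right]
    exact (neg_pos.2 (hn.inner_neg hij.symm)).ne'
  set e := b i - b j with he
  -- Moving along `e` lowers the `j`-th coordinate at unit rate, so `π` projects along the edge onto
  -- the plane of facet `j`.
  let π : 𝔼 → 𝔼 := fun x => x + b.coord j x • e
  have hπc : Continuous π :=
    continuous_id.add ((continuous_barycentric_coord b j).smul continuous_const)
  -- A prism over facet `j`, swept along `-e` for `0 ≤ -coord j ≤ 1`. Slicing the integral of `f ∘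
  -- π` over it along `e`, from the plane of facet `i` and from that of facet `j`, gives the two
  -- sides of the identity.
  let S : Set 𝔼 := {x | π x ∈ simplexFacet b j ∧ -b.coord j x ∈ Set.Icc (0 : ℝ) 1}
  have hπS : ∀ (y : 𝔼) (s : ℝ), π (y + s • e) = π y := by
    intro y s
    simp only [π]
    rw [coord_add_smul_sub b j, if_neg hij.symm, if_pos rfl, add_assoc, ← add_smul]
    congr 2
    ring
  have hScoord : ∀ (y : 𝔼) (s : ℝ), b.coord j (y + s • e) = b.coord j y - s := by
    intro y s
    rw [coord_add_smul_sub b j, if_neg hij.symm, if_pos rfl]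
    ring
  have hSclosed : IsClosed S :=
    ((isCompact_simplexFacet b j).isClosed.preimage hπc).inter
      (isClosed_Icc.preimage (continuous_barycentric_coord b j).neg)
  have hScompact : IsCompact S := by
    have h1 : IsCompact ((fun q : 𝔼 × ℝ => q.1 + q.2 • e) ''
        (simplexFacet b j ×ˢ Set.Icc (0 : ℝ) 1)) :=
      ((isCompact_simplexFacet b j).prod isCompact_Icc).image (by fun_prop)
    refine h1.of_isClosed_subset hSclosed fun x hx => ⟨(π x, -b.coord j x), hx, ?_⟩
    simp [π]
  have hg : Integrable (S.indicator fun x => f (π x)) := by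
    rw [integrable_indicator_iff hSclosed.measurableSet]
    exact (hf.comp hπc).continuousOn.integrableOn_compact hScompact
  have h1 := integral_eq_integral_hyperplane (hn.norm_eq i) (b j) e hi0 hg
  have h2 := integral_eq_integral_hyperplane (hn.norm_eq j) (b i) e hj0 hg
  rw [hn.hyperplane_eq hij] at h1
  rw [hn.hyperplane_eq hij.symm] at h2
  rw [h1] at h2
  have inner_int : ∀ y, (∫ s : ℝ, S.indicator (fun x => f (π x)) (y + s • e)) =
      {y | π y ∈ simplexFacet b j}.indicator (fun y => f (π y)) y := by
    intro y
    have : ∀ s : ℝ, S.indicator (fun x => f (π x)) (y + s • e) =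
        (Set.Icc (b.coord j y) (b.coord j y + 1)).indicator
          (fun _ => {y | π y ∈ simplexFacet b j}.indicator (fun y => f (π y)) y) s := by
      intro s
      by_cases hy : π y ∈ simplexFacet b j
      · by_cases hs : s ∈ Set.Icc (b.coord j y) (b.coord j y + 1)
        · have hmem : y + s • e ∈ S := by
            refine ⟨by rw [hπS]; exact hy, ?_⟩
            rw [hScoord]
            exact ⟨by linarith [hs.1], by linarith [hs.2]⟩
          rw [Set.indicator_of_mem hs, Set.indicator_of_mem hmem,
            Set.indicator_of_mem (a := y) (by exact hy), hπS]
        · rw [Set.indicator_of_notMem hs, Set.indicator_of_notMem]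
          rintro ⟨-, h⟩
          rw [hScoord] at h
          exact hs ⟨by linarith [h.1], by linarith [h.2]⟩
      · rw [Set.indicator_of_notMem (a := y) (by exact hy), Set.indicator_of_notMem]
        · simp
        · rintro ⟨h, -⟩
          rw [hπS] at h
          exact hy h
    simp_rw [this]
    rw [integral_indicator measurableSet_Icc, setIntegral_const]
    simp [Measure.real]
  simp_rw [inner_int] at h2
  have hm : ∀ k, MeasurableSet {x : 𝔼 | b.coord k x = 0} := fun k =>
    (isClosed_eq (continuous_barycentric_coord b k) continuous_const).measurableSet
  have hm2 : MeasurableSet {y | π y ∈ simplexFacet b j} :=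
    ((isCompact_simplexFacet b j).isClosed.preimage hπc).measurableSet
  rw [setIntegral_indicator hm2, setIntegral_indicator hm2] at h2
  -- On the plane of facet `i` the `i`-th coordinate of `π y` is the `j`-th coordinate of `y`, so
  -- nonnegativity passes in both directions.
  have e1 : {x : 𝔼 | b.coord i x = 0} ∩ {y | π y ∈ simplexFacet b j} = simplexFacet b i := by
    ext y
    have hk : ∀ k, b.coord k (π y) = b.coord k y +
        b.coord j y * ((if k = i then 1 else 0) - (if k = j then 1 else 0)) :=
      fun k => coord_add_smul_sub b k y _
    constructor
    · rintro ⟨hy0, hyj, hyk⟩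
      refine ⟨hy0, fun k => ?_⟩
      have h := hyk k
      rw [hk] at h
      have hi := hyk i
      rw [hk, if_pos rfl, if_neg hij] at hi
      have hy0' : b.coord i y = 0 := hy0
      by_cases hki : k = i
      · rw [hki, hy0']
      · by_cases hkj : k = j
        · rw [hkj]; linarith
        · rw [if_neg hki, if_neg hkj] at h
          linarith
    · rintro ⟨hy0, hyk⟩
      refine ⟨hy0, ?_, fun k => ?_⟩
      · rw [hk, if_neg hij.symm, if_pos rfl]; ring
      · rw [hk]
        have := hyk k
        have := hyk j
        by_cases hki : k = i
        · subst hki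
          rw [if_pos rfl, if_neg hij]; linarith
        · by_cases hkj : k = j
          · subst hkj
            rw [if_neg hki, if_pos rfl]; linarith
          · rw [if_neg hki, if_neg hkj]; linarith
  have e2 : {x : 𝔼 | b.coord j x = 0} ∩ {y | π y ∈ simplexFacet b j} = simplexFacet b j := by
    ext y
    constructor
    · rintro ⟨hy0, hy⟩
      have hy0' : b.coord j y = 0 := hy0
      have : π y = y := by simp [π, hy0']
      rw [Set.mem_ofPred_eq, this] at hy
      exact hy
    · intro hy
      have : π y = y := by simp [π, hy.1]
      exact ⟨hy.1, by rw [Set.mem_ofPred_eq, this]; exact hy⟩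
  rw [e1, e2] at h2
  rw [h2]
  congr 1
  refine setIntegral_congr_fun (isCompact_simplexFacet b j).measurableSet fun y hy => ?_
  simp [π, hy.1]

/-- The divergence theorem on a simplex for derivatives along an edge. -/
theorem IsOutwardNormal.integral_deriv_edge [Nontrivial ι] {n : ι → 𝔼} (hn : IsOutwardNormal b n)
    {i j : ι} (hij : i ≠ j) {f f' : 𝔼 → ℝ} (hf : Continuous f) (hf' : Continuous f')
    (hd : ∀ (y : 𝔼) (s : ℝ),
      HasDerivAt (fun t : ℝ => f (y + t • (b i - b j))) (f' (y + s • (b i - b j))) s) :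
    ∫ x in simplex b, f' x =
      inner ℝ (n i) (b i - b j) * (∫ y in simplexFacet b i, f y ∂(μHE[d - 1] : Measure 𝔼)) +
      inner ℝ (n j) (b i - b j) * ∫ y in simplexFacet b j, f y ∂(μHE[d - 1] : Measure 𝔼) := by
  have hB := hn.integral_facet_projection hij hf
  have hi0 := hn.inner_neg hij
  have hj0 : 0 < inner ℝ (n j) (b i - b j) := by
    rw [← neg_sub, inner_neg_right]
    exact neg_pos.2 (hn.inner_neg hij.symm)
  rw [abs_of_neg hi0, abs_of_pos hj0] at hB
  set e := b i - b j with he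
  have hKm := (isCompact_simplex b).measurableSet
  have hg : Integrable ((simplex b).indicator f') := by
    rw [integrable_indicator_iff hKm]
    exact hf'.continuousOn.integrableOn_compact (isCompact_simplex b)
  have h1 := integral_eq_integral_hyperplane (hn.norm_eq i) (b j) e hi0.ne hg
  rw [hn.hyperplane_eq hij, integral_indicator hKm, abs_of_neg hi0] at h1
  rw [h1]
  -- The line through `y` in direction `e` meets the simplex exactly for `s` between `0` and the
  -- `j`-th coordinate of `y`, or not at all, so the fundamental theorem gives the difference of `f`
  -- at the two ends. The far end is the projection of `y` on facet `j`, and `hB` then moves its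
  -- contribution to that facet.
  have inner_int : ∀ y ∈ {x : 𝔼 | b.coord i x = 0},
      (∫ s : ℝ, (simplex b).indicator f' (y + s • e)) =
      (simplex b).indicator (fun y => f (y + b.coord j y • e) - f y) y := by
    intro y hy
    have hy0 : b.coord i y = 0 := hy
    have hk : ∀ k s, b.coord k (y + s • e) = b.coord k y +
        s * ((if k = i then 1 else 0) - (if k = j then 1 else 0)) :=
      fun k s => coord_add_smul_sub b k y s
    by_cases hyK : y ∈ simplex b
    · have hmem : ∀ s : ℝ, y + s • e ∈ simplex b ↔ s ∈ Set.Icc 0 (b.coord j y) := by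
        intro s
        constructor
        · intro h
          have hi := h i
          have hj := h j
          rw [hk, if_pos rfl, if_neg hij] at hi
          rw [hk, if_pos rfl, if_neg hij.symm] at hj
          exact ⟨by linarith, by linarith⟩
        · rintro ⟨hs0, hs1⟩ k
          rw [hk]
          have := hyK k
          by_cases hki : k = i
          · subst hki
            rw [if_pos rfl, if_neg hij]; linarith
          · by_cases hkj : k = j
            · subst hkj
              rw [if_neg hki, if_pos rfl]; linarith
            · rw [if_neg hki, if_neg hkj]; linarith
      have : ∀ s : ℝ, (simplex b).indicator f' (y + s • e) =
          (Set.Icc 0 (b.coord j y)).indicator (fun s => f' (y + s • e)) s := by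
        intro s
        by_cases hs : s ∈ Set.Icc 0 (b.coord j y)
        · rw [Set.indicator_of_mem hs, Set.indicator_of_mem ((hmem s).2 hs)]
        · rw [Set.indicator_of_notMem hs, Set.indicator_of_notMem (mt (hmem s).1 hs)]
      simp_rw [this]
      rw [integral_indicator measurableSet_Icc, integral_Icc_eq_integral_Ioc,
        ← intervalIntegral.integral_of_le (hyK j),
        intervalIntegral.integral_eq_sub_of_hasDerivAt (fun s _ => hd y s),
        Set.indicator_of_mem hyK]
      · simp
      · exact (hf'.comp (by fun_prop)).intervalIntegrable _ _
    · rw [Set.indicator_of_notMem hyK]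
      have : ∀ s : ℝ, (simplex b).indicator f' (y + s • e) = 0 := by
        intro s
        refine Set.indicator_of_notMem (fun h => hyK fun k => ?_) _
        have hi := h i
        have hj := h j
        have hk' := h k
        rw [hk, if_pos rfl, if_neg hij] at hi
        rw [hk, if_pos rfl, if_neg hij.symm] at hj
        rw [hk] at hk'
        by_cases hki : k = i
        · rw [hki, hy0]
        · by_cases hkj : k = j
          · rw [hkj]; linarith
          · rw [if_neg hki, if_neg hkj] at hk'; linarith
      simp [this]
  rw [setIntegral_congr_fun
    (isClosed_eq (continuous_barycentric_coord b i) continuous_const).measurableSet inner_int,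
    setIntegral_indicator hKm, ← simplexFacet_eq_inter, integral_sub, mul_sub, hB]
  · ring
  · exact hn.integrableOn_simplexFacet i (hf.comp (continuous_id.add
      ((continuous_barycentric_coord b j).smul continuous_const)))
  · exact hn.integrableOn_simplexFacet i hf

end Simplex

/-! ### Polynomials as functions and their directional derivatives -/

section Polynomials

variable {d : ℕ}

local notation "𝔼" => EuclideanSpace ℝ (Fin d)

@[simp] theorem value_add (p q : MvPolynomial (Fin d) ℝ) (x : 𝔼) :
    value (p + q) x = value p x + value q x := by simp [value]

@[simp] theorem value_mul (p q : MvPolynomial (Fin d) ℝ) (x : 𝔼) :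
    value (p * q) x = value p x * value q x := by simp [value]

@[simp] theorem value_sub (p q : MvPolynomial (Fin d) ℝ) (x : 𝔼) :
    value (p - q) x = value p x - value q x := by simp [value]

@[simp] theorem value_zero (x : 𝔼) : value (0 : MvPolynomial (Fin d) ℝ) x = 0 := by simp [value]

@[simp] theorem value_one (x : 𝔼) : value (1 : MvPolynomial (Fin d) ℝ) x = 1 := by simp [value]

@[simp] theorem value_C (a : ℝ) (x : 𝔼) : value (MvPolynomial.C a) x = a := by simp [value]

@[simp] theorem value_smul (a : ℝ) (p : MvPolynomial (Fin d) ℝ) (x : 𝔼) :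
    value (a • p) x = a * value p x := by simp [value, MvPolynomial.smul_eval]

@[simp] theorem value_sum {α : Type*} (s : Finset α) (p : α → MvPolynomial (Fin d) ℝ) (x : 𝔼) :
    value (∑ i ∈ s, p i) x = ∑ i ∈ s, value (p i) x := by simp [value]

theorem continuous_value (p : MvPolynomial (Fin d) ℝ) : Continuous (value p : 𝔼 → ℝ) :=
  (MvPolynomial.continuous_eval p).comp (by fun_prop)

theorem hasDerivAt_value (p : MvPolynomial (Fin d) ℝ) (y v : 𝔼) (s : ℝ) :
    HasDerivAt (fun t : ℝ => value p (y + t • v))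
      (value (∑ k, MvPolynomial.C (v k) * MvPolynomial.pderiv k p) (y + s • v)) s := by
  induction p using MvPolynomial.induction_on with
  | C a => simpa using hasDerivAt_const s a
  | add p q hp hq =>
    simp only [value_add]
    convert! hp.add hq using 1
    simp [mul_add, Finset.sum_add_distrib]
  | mul_X p i hp =>
    simp only [value_mul]
    have hX : HasDerivAt (fun t : ℝ => value (MvPolynomial.X i : MvPolynomial (Fin d) ℝ)
        (y + t • v)) (v i) s := by
      simp only [value, MvPolynomial.eval_X, PiLp.add_apply, PiLp.smul_apply, smul_eq_mul]
      simpa using ((hasDerivAt_id s).mul_const (v i)).const_add (y i)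
    convert! hp.mul hX using 1
    simp only [value_sum, value_mul, Derivation.leibniz, value_C, smul_eq_mul, value_add,
      MvPolynomial.pderiv_X, mul_add, Finset.sum_add_distrib, Finset.sum_mul]
    rw [add_comm]
    congr 1
    · exact Finset.sum_congr rfl fun k _ => by ring
    · rw [Finset.sum_eq_single i]
      · simp; ring
      · intro k _ hk
        simp [hk.symm]
      · simp

end Polynomials

/-! ### The divergence theorem on a simplex -/

section DivergenceTheorem

variable {d : ℕ} {ι : Type*} [Fintype ι] [DecidableEq ι]

local notation "𝔼" => EuclideanSpace ℝ (Fin d)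

variable {b : AffineBasis ι ℝ (EuclideanSpace ℝ (Fin d))}

theorem integrableOn_value {S : Set 𝔼} (hS : IsCompact S) (p : MvPolynomial (Fin d) ℝ) :
    IntegrableOn (value p) S :=
  (continuous_value p).continuousOn.integrableOn_compact hS

/-- Both sides are linear in `v`, and the edges issuing from one vertex form a basis. For an edge
only the facets opposite to its two endpoints contribute, since the other normals are orthogonal to
it. -/
theorem IsOutwardNormal.integral_directional [Nontrivial ι] {n : ι → 𝔼} (hn : IsOutwardNormal b n)
    (p : MvPolynomial (Fin d) ℝ) (v : 𝔼) :
    ∑ k, v k * ∫ x in simplex b, value (MvPolynomial.pderiv k p) x =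
      ∑ l, inner ℝ (n l) v * ∫ x in simplexFacet b l, value p x ∂(μHE[d - 1] : Measure 𝔼) := by
  let ℓ₁ : 𝔼 →ₗ[ℝ] ℝ :=
    { toFun := fun v => ∑ k, v k * ∫ x in simplex b, value (MvPolynomial.pderiv k p) x
      map_add' := fun v w => by simp [add_mul, Finset.sum_add_distrib]
      map_smul' := fun c v => by simp [mul_assoc, Finset.mul_sum] }
  let ℓ₂ : 𝔼 →ₗ[ℝ] ℝ :=
    { toFun := fun v => ∑ l, inner ℝ (n l) v *
        ∫ x in simplexFacet b l, value p x ∂(μHE[d - 1] : Measure 𝔼)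
      map_add' := fun v w => by simp [inner_add_right, add_mul, Finset.sum_add_distrib]
      map_smul' := fun c v => by simp [inner_smul_right, mul_assoc, Finset.mul_sum] }
  suffices h : ℓ₁ = ℓ₂ from LinearMap.congr_fun h v
  obtain ⟨j⟩ := b.nonempty
  refine (b.basisOf j).ext fun i => ?_
  obtain ⟨i, hij⟩ := i
  rw [b.basisOf_apply, vsub_eq_sub]
  have h := hn.integral_deriv_edge hij (continuous_value p) (continuous_value _)
    (fun y s => hasDerivAt_value p y (b i - b j) s)
  have hL : ℓ₁ (b i - b j) = ∫ x in simplex b, value (∑ k, MvPolynomial.C ((b i - b j) k) *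
      MvPolynomial.pderiv k p) x := by
    simp only [value_sum, value_mul, value_C]
    rw [integral_finsetSum]
    · simp_rw [integral_const_mul]
      rfl
    · exact fun k _ => (integrableOn_value (isCompact_simplex b) _).const_mul _
  have hR : ℓ₂ (b i - b j) = ∑ l, inner ℝ (n l) (b i - b j) *
      ∫ x in simplexFacet b l, value p x ∂(μHE[d - 1] : Measure 𝔼) := rfl
  rw [hL, h, hR, ← Finset.sum_subset (Finset.subset_univ {i, j}), Finset.sum_pair hij]
  intro l _ hl
  simp only [Finset.mem_insert, Finset.mem_singleton, not_or] at hl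
  rw [hn.inner_eq_zero hl.1 hl.2, zero_mul]

/-- The divergence theorem on a simplex for polynomial vector fields. -/
theorem IsOutwardNormal.integral_divergence [Nontrivial ι] {n : ι → 𝔼} (hn : IsOutwardNormal b n)
    (w : Fin d → MvPolynomial (Fin d) ℝ) :
    ∫ x in simplex b, value (divPoly w) x =
      ∑ l, ∫ x in simplexFacet b l, (∑ i, vecValue w x i * n l i) ∂(μHE[d - 1] : Measure 𝔼) := by
  have h1 : ∀ i, ∫ x in simplex b, value (MvPolynomial.pderiv i (w i)) x =
      ∑ l, n l i * ∫ x in simplexFacet b l, value (w i) x ∂(μHE[d - 1] : Measure 𝔼) := by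
    intro i
    have := hn.integral_directional (w i) (EuclideanSpace.single i 1)
    simpa [Pi.single_apply, EuclideanSpace.inner_single_right] using this
  have h2 : ∀ l, ∫ x in simplexFacet b l, (∑ i, vecValue w x i * n l i)
      ∂(μHE[d - 1] : Measure 𝔼) =
      ∑ i, n l i * ∫ x in simplexFacet b l, value (w i) x ∂(μHE[d - 1] : Measure 𝔼) := by
    intro l
    rw [integral_finsetSum]
    · refine Finset.sum_congr rfl fun i _ => ?_
      rw [← integral_const_mul]
      simp only [vecValue, mul_comm]
    · exact fun i _ => (hn.integrableOn_simplexFacet l (continuous_value (w i))).mul_const _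
  simp_rw [h2, divPoly, value_sum]
  rw [integral_finsetSum _ fun i _ => integrableOn_value (isCompact_simplex b) _, Finset.sum_comm]
  exact Finset.sum_congr rfl fun i _ => h1 i

end DivergenceTheorem

/-! ### Faces of a simplex in barycentric coordinates -/

section AffineBasisHull

variable {d : ℕ} {ι : Type*} [Fintype ι]

/-- The face of a simplex spanned by a set of vertices, in barycentric coordinates. -/
theorem mem_convexHull_image_iff (b : AffineBasis ι ℝ (EuclideanSpace ℝ (Fin d))) (S : Set ι)
    (x : EuclideanSpace ℝ (Fin d)) :
    x ∈ convexHull ℝ (b '' S) ↔ (∀ k, 0 ≤ b.coord k x) ∧ ∀ k ∉ S, b.coord k x = 0 := by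
  classical
  constructor
  · intro hx
    have hconv : Convex ℝ {x : EuclideanSpace ℝ (Fin d) |
        (∀ k, 0 ≤ b.coord k x) ∧ ∀ k ∉ S, b.coord k x = 0} := by
      intro y hy z hz s t hs ht hst
      have h : ∀ k, b.coord k (s • y + t • z) = s * b.coord k y + t * b.coord k z := fun k => by
        rw [Convex.combo_affine_apply hst, smul_eq_mul, smul_eq_mul]
      refine ⟨fun k => ?_, fun k hk => ?_⟩
      · rw [h]
        have := hy.1 k
        have := hz.1 k
        positivity
      · rw [h, hy.2 k hk, hz.2 k hk]
        simp
    refine convexHull_min ?_ hconv hx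
    rintro - ⟨i, hi, rfl⟩
    refine ⟨fun k => ?_, fun k hk => ?_⟩
    · rw [b.coord_apply]
      split_ifs <;> norm_num
    · rw [b.coord_apply_ne]
      rintro rfl
      exact hk hi
  · rintro ⟨h0, h1⟩
    rw [← b.linear_combination_coord_eq_self x]
    have hsum := b.sum_coord_apply_eq_one x
    have hs : ∀ f : ι → EuclideanSpace ℝ (Fin d), ∑ k, b.coord k x • f k =
        ∑ k ∈ Finset.univ.filter (· ∈ S), b.coord k x • f k := by
      intro f
      symm
      refine Finset.sum_subset (Finset.filter_subset _ _) fun k _ hk => ?_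
      rw [h1 k (by simpa using hk), zero_smul]
    rw [hs]
    refine (convex_convexHull ℝ _).sum_mem (fun k _ => h0 k) ?_ ?_
    · rw [← hsum]
      refine Finset.sum_subset (Finset.filter_subset _ _) fun k _ hk => ?_
      rw [h1 k (by simpa using hk)]
    · intro k hk
      exact subset_convexHull ℝ _ ⟨k, by simpa using hk, rfl⟩

end AffineBasisHull

/-! ### Facets of a conforming mesh: neighbours and boundary -/

namespace SimplicialMesh

variable {d : ℕ} {T : SimplicialMesh d}

/-- The barycentric coordinates of a cell. -/
def cellBasis (L : T.Cell) : AffineBasis L.1 ℝ (EuclideanSpace ℝ (Fin d)) where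
  toFun := (↑)
  ind' := T.indep L.2.1
  tot' := by
    rw [(T.indep L.2.1).affineSpan_eq_top_iff_card_eq_finrank_add_one]
    simp [L.2.2]

@[simp] theorem cellBasis_apply (L : T.Cell) (l : L.1) : cellBasis L l = l := rfl

theorem range_cellBasis (L : T.Cell) : Set.range (cellBasis L) = L.1 := by
  ext x
  simp

theorem region_eq_simplex (L : T.Cell) : region L = simplex (cellBasis L) := by
  rw [region, ← range_cellBasis, AffineBasis.convexHull_eq_nonneg_coord]
  rfl

theorem isCompact_region (L : T.Cell) : IsCompact (region L) := by
  rw [region_eq_simplex]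
  exact isCompact_simplex _

theorem mem_convexHull_iff_of_subset (L : T.Cell) {S : Finset (EuclideanSpace ℝ (Fin d))}
    (hS : S ⊆ L.1) (x : EuclideanSpace ℝ (Fin d)) :
    x ∈ convexHull ℝ (S : Set (EuclideanSpace ℝ (Fin d))) ↔
      (∀ k, 0 ≤ (cellBasis L).coord k x) ∧ ∀ k : L.1, k.1 ∉ S → (cellBasis L).coord k x = 0 := by
  have h := mem_convexHull_image_iff (cellBasis L) {k | k.1 ∈ S} x
  have himg : cellBasis L '' {k | k.1 ∈ S} = S := by
    ext y
    simp only [Set.mem_image, Set.mem_ofPred_eq, cellBasis_apply, Subtype.exists, exists_and_left,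
      exists_prop, Finset.mem_coe]
    constructor
    · rintro ⟨a, ha, -, rfl⟩; exact ha
    · exact fun hy => ⟨y, hy, hS hy, rfl⟩
  rw [himg] at h
  exact h

open Classical in
theorem convexHull_erase_eq_simplexFacet (L : T.Cell) (l : L.1) :
    convexHull ℝ (L.1.erase l.1 : Set (EuclideanSpace ℝ (Fin d))) =
      simplexFacet (cellBasis L) l := by
  ext x
  have h := mem_convexHull_iff_of_subset L (Finset.erase_subset l.1 L.1) x
  rw [h]
  constructor
  · rintro ⟨h0, h1⟩
    exact ⟨h1 l (by simp), h0⟩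
  · rintro ⟨h1, h0⟩
    refine ⟨h0, fun k hk => ?_⟩
    have : k = l := by
      simp only [Finset.mem_erase, k.2, and_true, not_not] at hk
      exact Subtype.ext hk
    rw [this, h1]

theorem mem_space_iff (x : EuclideanSpace ℝ (Fin d)) : x ∈ T.space ↔ ∃ K : T.Cell, x ∈ region K := by
  simp only [Geometry.SimplicialComplex.space, Set.mem_iUnion]
  constructor
  · rintro ⟨s, hs, hx⟩
    obtain ⟨t, ht, hst, hc⟩ := T.pure s hs
    exact ⟨⟨t, ht, hc⟩, convexHull_mono (by exact_mod_cast hst) hx⟩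
  · rintro ⟨K, hx⟩
    exact ⟨K.1, K.2.1, hx⟩

theorem mem_convexHull_commonFace {K L : T.Cell} {x : EuclideanSpace ℝ (Fin d)}
    (hK : x ∈ region K) (hL : x ∈ region L) :
    x ∈ convexHull ℝ (commonFace K L : Set (EuclideanSpace ℝ (Fin d))) := by
  have := T.inter_subset_convexHull K.2.1 L.2.1 ⟨hK, hL⟩
  simpa [commonFace] using this

theorem commonFace_comm (K L : T.Cell) : commonFace K L = commonFace L K := by
  classical
  exact Finset.inter_comm _ _

theorem commonFace_subset_left (K L : T.Cell) : commonFace K L ⊆ K.1 := by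
  classical
  exact Finset.inter_subset_left

theorem commonFace_subset_right (K L : T.Cell) : commonFace K L ⊆ L.1 := by
  classical
  exact Finset.inter_subset_right

theorem cell_eq_of_subset {K L : T.Cell} (h : K.1 ⊆ L.1) : K = L :=
  Subtype.ext (Finset.eq_of_subset_of_card_le h (by rw [K.2.2, L.2.2]))

open Classical in
theorem commonFace_eq_erase {K L : T.Cell} (hKL : K ≠ L) {l : L.1} (h : L.1.erase l.1 ⊆ K.1) :
    commonFace K L = L.1.erase l.1 := by
  refine Finset.Subset.antisymm (fun x hx => ?_) (fun x hx => ?_)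
  · rw [commonFace, Finset.mem_inter] at hx
    refine Finset.mem_erase.2 ⟨?_, hx.2⟩
    rintro rfl
    refine hKL (cell_eq_of_subset (K := L) (L := K) fun y hy => ?_).symm
    by_cases hyl : y = l.1
    · rw [hyl]; exact hx.1
    · exact h (Finset.mem_erase.2 ⟨hyl, hy⟩)
  · exact Finset.mem_inter.2 ⟨h hx, Finset.mem_of_mem_erase hx⟩

open Classical in
theorem exists_commonFace_eq_erase {K L : T.Cell} (h : (commonFace K L).card = d) :
    ∃ l : L.1, commonFace K L = L.1.erase l.1 := by
  have h1 : (L.1 \ commonFace K L).card = 1 := by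
    rw [Finset.card_sdiff_of_subset (commonFace_subset_right K L), h, L.2.2]
    omega
  obtain ⟨l, hl⟩ := Finset.card_eq_one.1 h1
  have hlm : l ∈ L.1 \ commonFace K L := by rw [hl]; simp
  refine ⟨⟨l, (Finset.mem_sdiff.1 hlm).1⟩, ?_⟩
  rw [Finset.erase_eq, ← hl, Finset.sdiff_sdiff_eq_self (commonFace_subset_right K L)]

theorem nontrivial_cell (hd : d ≠ 0) (L : T.Cell) : Nontrivial L.1 := by
  rw [← Fintype.one_lt_card_iff_nontrivial, Fintype.card_coe, L.2.2]
  omega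

theorem coord_combination {ι : Type*} [Fintype ι] (b : AffineBasis ι ℝ (EuclideanSpace ℝ (Fin d)))
    (i : ι) (x y : EuclideanSpace ℝ (Fin d)) (t : ℝ) :
    b.coord i (x + t • (y - x)) = (1 - t) * b.coord i x + t * b.coord i y := by
  have h : x + t • (y - x) = (1 - t) • x + t • y := by
    rw [smul_sub, sub_smul, one_smul]; abel
  rw [h, Convex.combo_affine_apply (by ring), smul_eq_mul, smul_eq_mul]

/-- The relative interior of a facet is not empty. -/
theorem exists_mem_interior_facet (hd : d ≠ 0) (L : T.Cell) (l : L.1) :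
    ∃ m, (cellBasis L).coord l m = 0 ∧ ∀ k, k ≠ l → 0 < (cellBasis L).coord k m := by
  classical
  have hcard : (Finset.univ.erase l).card = d := by
    rw [Finset.card_erase_of_mem (Finset.mem_univ _), Finset.card_univ, Fintype.card_coe, L.2.2]
    omega
  have hne : (Finset.univ.erase l).Nonempty := by
    rw [← Finset.card_pos, hcard]; omega
  refine ⟨(Finset.univ.erase l).centroid ℝ (cellBasis L), ?_, fun k hk => ?_⟩
  · rw [Finset.centroid_def, AffineBasis.coord_apply_combination_of_notMem _ (by simp)
      (Finset.sum_centroidWeights_eq_one_of_nonempty ℝ _ hne)]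
  · rw [AffineBasis.coord_apply_centroid _ (by simpa using hk), hcard]
    positivity

/-- Points close to the interior of a facet and on the side of the cell belong to the cell. -/
theorem eventually_mem_region {L : T.Cell} {l : L.1} {m y : EuclideanSpace ℝ (Fin d)}
    (hm : (cellBasis L).coord l m = 0) (hpos : ∀ k, k ≠ l → 0 < (cellBasis L).coord k m)
    (hy : 0 < (cellBasis L).coord l y) :
    ∀ᶠ t : ℝ in nhdsWithin 0 (Set.Ioi 0), m + t • (y - m) ∈ region L := by
  have h1 : ∀ᶠ t : ℝ in nhdsWithin 0 (Set.Ioi 0), ∀ k, 0 ≤ (cellBasis L).coord k (m + t • (y - m)) := by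
    rw [Filter.eventually_all]
    intro k
    by_cases hk : k = l
    · subst hk
      filter_upwards [self_mem_nhdsWithin] with t ht
      rw [coord_combination, hm]
      have : (0 : ℝ) < t := ht
      nlinarith
    · have hc : Filter.Tendsto (fun t : ℝ => (cellBasis L).coord k (m + t • (y - m)))
          (nhdsWithin 0 (Set.Ioi 0)) (nhds ((cellBasis L).coord k (m + (0 : ℝ) • (y - m)))) := by
        refine Filter.Tendsto.mono_left ?_ nhdsWithin_le_nhds
        exact ((continuous_barycentric_coord _ k).comp
          (by fun_prop : Continuous fun t : ℝ => m + t • (y - m))).tendsto 0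
      rw [zero_smul, add_zero] at hc
      exact (hc.eventually (lt_mem_nhds (hpos k hk))).mono fun t ht => ht.le
  filter_upwards [h1] with t ht
  rw [region_eq_simplex]
  exact ht

theorem combination_mem_region {K : T.Cell} {m k : EuclideanSpace ℝ (Fin d)} (hm : m ∈ region K)
    (hk : k ∈ region K) : ∀ᶠ t : ℝ in nhdsWithin 0 (Set.Ioi 0), m + t • (k - m) ∈ region K := by
  filter_upwards [Ioc_mem_nhdsGT one_pos] with t ht
  have h : m + t • (k - m) = (1 - t) • m + t • k := by
    rw [smul_sub, sub_smul, one_smul]; abel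
  rw [h]
  exact convex_convexHull ℝ _ hm hk (by linarith [ht.2]) ht.1.le (by ring)

theorem vertex_mem_region {K : T.Cell} {k : EuclideanSpace ℝ (Fin d)} (hk : k ∈ K.1) :
    k ∈ region K :=
  subset_convexHull ℝ _ (by exact_mod_cast hk)

open Classical in
/-- A vertex of a neighbouring cell is not on the side of the cell. -/
theorem coord_nonpos_of_commonFace (hd : d ≠ 0) {K L : T.Cell} {l : L.1}
    (h : commonFace K L = L.1.erase l.1) {k : EuclideanSpace ℝ (Fin d)} (hk : k ∈ K.1) :
    (cellBasis L).coord l k ≤ 0 := by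
  by_contra! hpos
  obtain ⟨m, hm0, hm⟩ := exists_mem_interior_facet hd L l
  have hmK : m ∈ region K := by
    have hmF : m ∈ convexHull ℝ (L.1.erase l.1 : Set (EuclideanSpace ℝ (Fin d))) := by
      rw [convexHull_erase_eq_simplexFacet]
      refine ⟨hm0, fun j => ?_⟩
      by_cases hj : j = l
      · rw [hj, hm0]
      · exact (hm j hj).le
    refine convexHull_mono ?_ hmF
    have := commonFace_subset_left K L
    rw [h] at this
    exact_mod_cast this
  -- If `k` were on the side of `L`, the segment from `m` to `k` would start inside both cells,
  -- hence in their common face, where the `l`-th coordinate is zero.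
  obtain ⟨t, ⟨htL, htK⟩, ht0⟩ := ((eventually_mem_region hm0 hm hpos).and
    (combination_mem_region hmK (vertex_mem_region hk))).and self_mem_nhdsWithin |>.exists
  have hx := mem_convexHull_commonFace htK htL
  rw [mem_convexHull_iff_of_subset L (commonFace_subset_right K L)] at hx
  have h0 := hx.2 l (by rw [h]; simp)
  rw [coord_combination, hm0] at h0
  have : (0 : ℝ) < t := ht0
  nlinarith

open Classical in
/-- An affine function that vanishes on a facet is a multiple of the barycentric coordinate. -/
theorem affine_eq_of_vanish_facet {L : T.Cell} {l : L.1}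
    (f : EuclideanSpace ℝ (Fin d) →ᵃ[ℝ] ℝ) (hf : ∀ y ∈ L.1.erase l.1, f y = 0)
    (x : EuclideanSpace ℝ (Fin d)) : f x = (cellBasis L).coord l x * f l.1 := by
  conv_lhs => rw [← (cellBasis L).affineCombination_coord_eq_self x]
  rw [Finset.map_affineCombination _ _ _ ((cellBasis L).sum_coord_apply_eq_one x),
    Finset.affineCombination_eq_linear_combination _ _ _ ((cellBasis L).sum_coord_apply_eq_one x),
    Finset.sum_eq_single l]
  · simp
  · intro k _ hk
    have : f (cellBasis L k) = 0 :=
      hf _ (Finset.mem_erase.2 ⟨fun h => hk (Subtype.ext h), k.2⟩)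
    simp only [Function.comp, this, smul_zero]
  · simp

open Classical in
-- Otherwise the `l`-th coordinate of `L` would vanish at all the vertices of `K`, hence everywhere,
-- although it is one at `l`.
theorem coord_neg_of_commonFace (hd : d ≠ 0) {K L : T.Cell} {l : L.1} {k : K.1}
    (h : commonFace K L = L.1.erase l.1) (hk : commonFace K L = K.1.erase k.1) :
    (cellBasis L).coord l k.1 < 0 := by
  refine lt_of_le_of_ne (coord_nonpos_of_commonFace hd h k.2) fun h0 => ?_
  have hv : ∀ y ∈ K.1.erase k.1, (cellBasis L).coord l y = 0 := by
    intro y hy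
    rw [← hk, h, Finset.mem_erase] at hy
    exact (cellBasis L).coord_apply_ne (i := l) (j := ⟨y, hy.2⟩)
      fun h => hy.1 (congrArg Subtype.val h).symm
  have h1 := affine_eq_of_vanish_facet ((cellBasis L).coord l) hv l.1
  rw [h0, mul_zero] at h1
  have h2 : (cellBasis L).coord l l.1 = 1 := (cellBasis L).coord_apply_eq l
  rw [h2] at h1
  norm_num at h1

open Classical in
/-- A facet of a cell belongs to at most one other cell. -/
theorem neighbour_unique (hd : d ≠ 0) {K K' L : T.Cell} {l : L.1}
    (h : commonFace K L = L.1.erase l.1) (h' : commonFace K' L = L.1.erase l.1) : K = K' := by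
  by_contra hne
  have hcard : (L.1.erase l.1).card = d := by
    rw [Finset.card_erase_of_mem l.2, L.2.2]; omega
  obtain ⟨k, hk⟩ := exists_commonFace_eq_erase (K := L) (L := K)
    (by rw [commonFace_comm, h, hcard])
  obtain ⟨k', hk'⟩ := exists_commonFace_eq_erase (K := L) (L := K')
    (by rw [commonFace_comm, h', hcard])
  rw [commonFace_comm] at hk hk'
  have hneg := coord_neg_of_commonFace hd h hk
  have hneg' := coord_neg_of_commonFace hd h' hk'
  have hv : ∀ y ∈ L.1.erase l.1, (cellBasis K).coord k y = 0 := by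
    intro y hy
    rw [← h, hk, Finset.mem_erase] at hy
    exact (cellBasis K).coord_apply_ne (i := k) (j := ⟨y, hy.2⟩)
      fun h => hy.1 (congrArg Subtype.val h).symm
  -- The coordinate of `K` vanishing on the facet is a multiple of that of `L`, negative because `k`
  -- lies across from `L`. Since `k'` lies across as well, it is strictly on the side of `K`, which
  -- the conformity of `K` and `K'` forbids.
  have h1 := affine_eq_of_vanish_facet ((cellBasis K).coord k) hv k.1
  have h2 := affine_eq_of_vanish_facet ((cellBasis K).coord k) hv k'.1
  have h3 : (cellBasis K).coord k k.1 = 1 := (cellBasis K).coord_apply_eq k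
  rw [h3] at h1
  have hsub : K.1.erase k.1 ⊆ K'.1 := by
    rw [← hk, h, ← h', hk']
    exact Finset.erase_subset _ _
  have hKK' := commonFace_eq_erase (K := K') (L := K) (Ne.symm hne) hsub
  have h4 := coord_nonpos_of_commonFace hd hKK' k'.2
  nlinarith

open Classical in
/-- A facet that belongs to a single cell lies on the boundary of the domain. -/
theorem facet_subset_frontier (hd : d ≠ 0) {L : T.Cell} {l : L.1}
    (h : ∀ K : T.Cell, commonFace K L ≠ L.1.erase l.1) :
    convexHull ℝ (L.1.erase l.1 : Set (EuclideanSpace ℝ (Fin d))) ⊆ frontier T.space := by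
  intro x hx
  have hxL : x ∈ region L := convexHull_mono (by simp) hx
  rw [convexHull_erase_eq_simplexFacet] at hx
  refine ⟨subset_closure ((mem_space_iff x).2 ⟨L, hxL⟩), fun hint => ?_⟩
  obtain ⟨m, hm0, hm⟩ := exists_mem_interior_facet hd L l
  have tend : ∀ p q : EuclideanSpace ℝ (Fin d), Filter.Tendsto (fun t : ℝ => p + t • (q - p))
      (nhdsWithin 0 (Set.Ioi 0)) (nhds p) := by
    intro p q
    have : Continuous fun t : ℝ => p + t • (q - p) := by fun_prop
    have h1 := (this.tendsto 0).mono_left (nhdsWithin_le_nhds (s := Set.Ioi 0))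
    simpa using h1
  -- A point interior to the domain can be moved slightly towards `m` inside the facet, so that all
  -- its coordinates but the `l`-th become positive.
  obtain ⟨t, ht, ht01⟩ := (((tend x m).eventually (isOpen_interior.mem_nhds hint)).and
    (Ioc_mem_nhdsGT one_pos)).exists
  set x' := x + t • (m - x) with hx'
  have hx'0 : (cellBasis L).coord l x' = 0 := by
    rw [coord_combination, hx.1, hm0]; ring
  have hx'pos : ∀ k, k ≠ l → 0 < (cellBasis L).coord k x' := by
    intro k hk
    rw [coord_combination]
    have h1 := hx.2 k
    have h2 := hm k hk
    have h3 : 0 ≤ (1 - t) * (cellBasis L).coord k x := mul_nonneg (by linarith [ht01.2]) h1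
    have h4 := mul_pos ht01.1 h2
    linarith
  have hx'L : x' ∈ region L := by
    rw [region_eq_simplex]
    intro k
    by_cases hk : k = l
    · rw [hk, hx'0]
    · exact (hx'pos k hk).le
  -- leave the cell through `x'`
  let q := x' - (l.1 - x')
  have hcoord : ∀ s : ℝ, (cellBasis L).coord l (x' + s • (q - x')) = -s := by
    intro s
    have e : x' + s • (q - x') = x' + (-s) • (l.1 - x') := by
      simp only [q, sub_sub_cancel_left, smul_neg, neg_smul]
    have h2 : (cellBasis L).coord l l.1 = 1 := (cellBasis L).coord_apply_eq l
    rw [e, coord_combination, hx'0, h2]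
    ring
  have hev : ∀ᶠ s : ℝ in nhdsWithin 0 (Set.Ioi 0), ∃ K : T.Cell, x' + s • (q - x') ∈ region K := by
    filter_upwards [(tend x' q).eventually (isOpen_interior.mem_nhds ht)] with s hs
    exact (mem_space_iff _).1 (interior_subset hs)
  -- There are finitely many cells, so one of them contains points of the outgoing ray arbitrarily
  -- close to `x'`; being closed, it contains `x'`.
  obtain ⟨K, hK⟩ : ∃ K : T.Cell, ∃ᶠ s : ℝ in nhdsWithin 0 (Set.Ioi 0),
      x' + s • (q - x') ∈ region K := by
    by_contra! hcon
    have : ∀ᶠ s : ℝ in nhdsWithin 0 (Set.Ioi 0), ∀ K : T.Cell, x' + s • (q - x') ∉ region K :=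
      Filter.eventually_all.2 hcon
    obtain ⟨s, ⟨K, hs⟩, hs'⟩ := (hev.and this).exists
    exact hs' K hs
  have hx'K : x' ∈ region K := (isCompact_region K).isClosed.mem_of_frequently_of_tendsto hK
    (tend x' q)
  have hKL : K ≠ L := by
    rintro rfl
    obtain ⟨s, hs, hs0⟩ := (hK.and_eventually self_mem_nhdsWithin).exists
    rw [region_eq_simplex] at hs
    have h1 := hs l
    rw [hcoord] at h1
    have : (0 : ℝ) < s := hs0
    linarith
  refine h K (commonFace_eq_erase hKL fun y hy => ?_)
  -- Now `x'` is in the face common to `K` and `L`; a vertex of `L` at which it has a positive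
  -- coordinate must belong to that face.
  have hmem := mem_convexHull_commonFace hx'K hx'L
  rw [mem_convexHull_iff_of_subset L (commonFace_subset_right K L)] at hmem
  rw [Finset.mem_erase] at hy
  by_contra hyK
  have h1 := hmem.2 ⟨y, hy.2⟩ fun h => hyK (commonFace_subset_left K L h)
  exact (hx'pos ⟨y, hy.2⟩ fun h => hy.1 (congrArg Subtype.val h)).ne' h1

end SimplicialMesh

/-- Normalise minus the gradient of each barycentric coordinate; `κ` is the length of the gradient.
-/
theorem exists_isOutwardNormal {d : ℕ} {ι : Type*} [Fintype ι] [Nontrivial ι]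
    (b : AffineBasis ι ℝ (EuclideanSpace ℝ (Fin d))) : ∃ n, IsOutwardNormal b n := by
  classical
  choose g hg using fun i => exists_riesz (b.coord i).linear
  have hg0 : ∀ i, 0 < ‖g i‖ := by
    intro i
    rw [norm_pos_iff]
    intro h0
    obtain ⟨j, hj⟩ := exists_ne i
    have h1 := hg i (b i - b j)
    rw [h0, inner_zero_left, coord_linear_sub, if_pos rfl, if_neg hj.symm] at h1
    norm_num at h1
  refine ⟨fun i => -(‖g i‖⁻¹ • g i), ⟨fun i => ?_, fun i => ⟨‖g i‖, hg0 i, fun v => ?_⟩⟩⟩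
  · rw [norm_neg, norm_smul, norm_inv, norm_norm, inv_mul_cancel₀ (hg0 i).ne']
  · rw [inner_neg_left, inner_smul_left, RCLike.conj_to_real, hg, mul_neg, neg_neg,
      mul_inv_cancel_left₀ (hg0 i).ne']

/-! ### Unit normals and the divergence theorem on the mesh -/

namespace SimplicialMesh

variable {d : ℕ} {T : SimplicialMesh d}

theorem unitNormal_comm (K L : T.Cell) : unitNormal K L = -unitNormal L K := by
  simp only [unitNormal]
  have e : vectorSpan ℝ (commonFace L K : Set (EuclideanSpace ℝ (Fin d))) =
      vectorSpan ℝ (commonFace K L : Set (EuclideanSpace ℝ (Fin d))) := by rw [commonFace_comm]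
  simp only [e]
  rw [← neg_sub (K.1.centroid ℝ id), map_neg, norm_neg, smul_neg]

theorem map_centroid (K : T.Cell) (f : EuclideanSpace ℝ (Fin d) →ᵃ[ℝ] ℝ) :
    f (K.1.centroid ℝ id) = (d + 1 : ℝ)⁻¹ * ∑ k ∈ K.1, f k := by
  have hne : K.1.Nonempty := by
    rw [← Finset.card_pos, K.2.2]; omega
  have h1 := Finset.sum_centroidWeights_eq_one_of_nonempty ℝ K.1 hne
  rw [Finset.centroid_def, Finset.map_affineCombination _ _ _ h1,
    Finset.affineCombination_eq_linear_combination _ _ _ h1, Finset.mul_sum]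
  refine Finset.sum_congr rfl fun k _ => ?_
  simp [Finset.centroidWeights_apply, K.2.2]

open Classical in
-- By a dimension count the orthogonal complement of the facet is the line spanned by `n l`. The
-- vector between the barycentres has a positive component on it, because the `l`-th coordinate is
-- positive at the barycentre of `L` and negative at that of `K`.
theorem unitNormal_eq (hd : d ≠ 0) {K L : T.Cell} {l : L.1}
    (h : commonFace K L = L.1.erase l.1) {n : L.1 → EuclideanSpace ℝ (Fin d)}
    (hn : IsOutwardNormal (cellBasis L) n) : unitNormal L K = n l := by
  obtain ⟨κ, hκ, hcoord⟩ := hn.coord l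
  have hcard : (L.1.erase l.1).card = d := by
    rw [Finset.card_erase_of_mem l.2, L.2.2]; omega
  obtain ⟨k, hk⟩ := exists_commonFace_eq_erase (K := L) (L := K)
    (by rw [commonFace_comm, h, hcard])
  rw [commonFace_comm] at hk
  have hneg := coord_neg_of_commonFace hd h hk
  have hF : ∀ y ∈ L.1.erase l.1, (cellBasis L).coord l y = 0 := by
    intro y hy
    rw [Finset.mem_erase] at hy
    exact (cellBasis L).coord_apply_ne (i := l) (j := ⟨y, hy.2⟩)
      fun h => hy.1 (congrArg Subtype.val h).symm
  set F : Set (EuclideanSpace ℝ (Fin d)) := ((L.1.erase l.1 : Finset (EuclideanSpace ℝ (Fin d))) :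
    Set (EuclideanSpace ℝ (Fin d))) with hFdef
  have hn0 : n l ≠ 0 := fun h0 => by
    have := hn.norm_eq l
    simp [h0] at this
  have hperp : (vectorSpan ℝ F)ᗮ = ℝ ∙ n l := by
    symm
    refine Submodule.eq_of_le_of_finrank_eq ?_ ?_
    · rw [Submodule.span_singleton_le_iff_mem, Submodule.mem_orthogonal]
      have hle : vectorSpan ℝ F ≤ LinearMap.ker ((cellBasis L).coord l).linear := by
        rw [vectorSpan_def, Submodule.span_le]
        rintro - ⟨y, hy, z, hz, rfl⟩
        simp only [SetLike.mem_coe, LinearMap.mem_ker]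
        rw [AffineMap.linearMap_vsub, hF y (by exact_mod_cast hy), hF z (by exact_mod_cast hz)]
        simp
      intro v hv
      have h1 := hcoord v
      rw [LinearMap.mem_ker.1 (hle hv)] at h1
      rw [real_inner_comm]
      have : κ * inner ℝ (n l) v = 0 := by linarith
      simpa [hκ.ne'] using this
    · have hind : AffineIndependent ℝ ((↑) : F → EuclideanSpace ℝ (Fin d)) :=
        (T.indep L.2.1).mono (by rw [hFdef]; exact_mod_cast Finset.erase_subset _ _)
      have h1 := hind.finrank_vectorSpan (n := d - 1)
        ((Fintype.card_coe (L.1.erase l.1)).trans (by omega))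
      rw [Subtype.range_coe] at h1
      have h2 := (vectorSpan ℝ F).finrank_add_finrank_orthogonal
      rw [h1, finrank_euclideanSpace_fin] at h2
      rw [finrank_span_singleton hn0]
      omega
  have hc : inner ℝ (n l) (K.1.centroid ℝ id - L.1.centroid ℝ id) > 0 := by
    have h1 := hcoord (K.1.centroid ℝ id - L.1.centroid ℝ id)
    have hK : ∑ j ∈ K.1, (cellBasis L).coord l j = (cellBasis L).coord l k.1 := by
      refine Finset.sum_eq_single_of_mem _ k.2 fun j hj hjk => hF j ?_
      rw [← h, hk]
      exact Finset.mem_erase.2 ⟨hjk, hj⟩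
    have hL : ∑ j ∈ L.1, (cellBasis L).coord l j = 1 := by
      rw [Finset.sum_eq_single_of_mem _ l.2 fun j hj hjl => hF j (Finset.mem_erase.2 ⟨hjl, hj⟩)]
      exact (cellBasis L).coord_apply_eq l
    rw [← vsub_eq_sub, AffineMap.linearMap_vsub, map_centroid, map_centroid, hK, hL,
      vsub_eq_sub, vsub_eq_sub] at h1
    have hd1 : (0 : ℝ) < (d + 1 : ℝ)⁻¹ := by positivity
    have h3 : 0 < κ * inner ℝ (n l) (K.1.centroid ℝ id - L.1.centroid ℝ id) := by nlinarith
    exact (mul_pos_iff_of_pos_left hκ).1 h3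
  simp only [unitNormal]
  have hFc : vectorSpan ℝ (commonFace L K : Set (EuclideanSpace ℝ (Fin d))) = vectorSpan ℝ F := by
    rw [commonFace_comm L K, h]
  simp only [hFc]
  have hproj : ∀ v, (vectorSpan ℝ F)ᗮ.starProjection v = inner ℝ (n l) v • n l := by
    intro v
    have e : (vectorSpan ℝ F)ᗮ.starProjection v = (ℝ ∙ n l).starProjection v := by
      simp only [hperp]
    rw [e, Submodule.starProjection_unit_singleton ℝ (hn.norm_eq l)]
  rw [hproj, norm_smul, hn.norm_eq, mul_one, Real.norm_eq_abs, abs_of_pos hc, smul_smul,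
    inv_mul_cancel₀ hc.ne', one_smul]

/-- The surface integral over the common facet of `K` and `L`, or zero if the cells are not
neighbours. -/
def facetIntegral {T : SimplicialMesh d} (K L : T.Cell) (f : EuclideanSpace ℝ (Fin d) → ℝ) : ℝ :=
  if (commonFace K L).card = d then
    ∫ x in convexHull ℝ (commonFace K L : Set (EuclideanSpace ℝ (Fin d))), f x ∂μHE[d - 1]
  else 0

theorem facetIntegral_comm (K L : T.Cell) (f : EuclideanSpace ℝ (Fin d) → ℝ) :
    facetIntegral K L f = facetIntegral L K f := by
  rw [facetIntegral, facetIntegral, commonFace_comm]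

theorem facetIntegral_neg (K L : T.Cell) (f : EuclideanSpace ℝ (Fin d) → ℝ) :
    facetIntegral K L (fun x => -f x) = -facetIntegral K L f := by
  rw [facetIntegral, facetIntegral]
  split_ifs
  · exact integral_neg _
  · simp

theorem facetIntegral_congr {K L : T.Cell} {f g : EuclideanSpace ℝ (Fin d) → ℝ}
    (h : ∀ x ∈ region K ∩ region L, f x = g x) : facetIntegral K L f = facetIntegral K L g := by
  rw [facetIntegral, facetIntegral]
  split_ifs
  · refine setIntegral_congr_fun (Set.Finite.isCompact_convexHull (𝕜 := ℝ)
      (Finset.finite_toSet _)).measurableSet fun x hx => h x ⟨?_, ?_⟩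
    · exact convexHull_mono (by exact_mod_cast commonFace_subset_left K L) hx
    · exact convexHull_mono (by exact_mod_cast commonFace_subset_right K L) hx
  · rfl

theorem integrableOn_commonFace (hd : d ≠ 0) {K L : T.Cell} (h : (commonFace K L).card = d)
    {f : EuclideanSpace ℝ (Fin d) → ℝ} (hf : Continuous f) :
    IntegrableOn f (convexHull ℝ (commonFace K L : Set (EuclideanSpace ℝ (Fin d)))) μHE[d - 1] := by
  classical
  have := nontrivial_cell hd L
  obtain ⟨n, hn⟩ := exists_isOutwardNormal (cellBasis L)
  obtain ⟨l, hl⟩ := exists_commonFace_eq_erase h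
  rw [hl, convexHull_erase_eq_simplexFacet]
  exact hn.integrableOn_simplexFacet l hf

/-- The divergence theorem on a cell, for a polynomial field vanishing on the boundary of the
domain. -/
theorem integral_divPoly_region (hd : d ≠ 0) (L : T.Cell) (w : Fin d → MvPolynomial (Fin d) ℝ)
    (hw : ∀ x ∈ region L ∩ frontier T.space, vecValue w x = 0) :
    ∫ x in region L, value (divPoly w) x =
      ∑ K : T.Cell, facetIntegral L K fun x => ∑ i, vecValue w x i * unitNormal L K i := by
  classical
  have := nontrivial_cell hd L
  obtain ⟨n, hn⟩ := exists_isOutwardNormal (cellBasis L)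
  rw [region_eq_simplex, hn.integral_divergence]
  let X : T.Cell → ℝ := fun K =>
    ∫ x in convexHull ℝ (commonFace K L : Set (EuclideanSpace ℝ (Fin d))),
      (∑ i, vecValue w x i * unitNormal L K i) ∂μHE[d - 1]
  -- Each facet contributes through its unique neighbour, or not at all when it lies on the
  -- boundary.
  have h1 : ∀ l : L.1, ∫ x in simplexFacet (cellBasis L) l, (∑ i, vecValue w x i * n l i)
      ∂(μHE[d - 1] : Measure (EuclideanSpace ℝ (Fin d))) =
      ∑ K : T.Cell, if commonFace K L = L.1.erase l.1 then X K else 0 := by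
    intro l
    by_cases hex : ∃ K : T.Cell, commonFace K L = L.1.erase l.1
    · obtain ⟨K, hK⟩ := hex
      rw [Finset.sum_eq_single K]
      · rw [if_pos hK, ← convexHull_erase_eq_simplexFacet, ← hK, ← unitNormal_eq hd hK hn]
      · intro K' _ hK'
        exact if_neg fun h => hK' (neighbour_unique hd h hK)
      · simp
    · push Not at hex
      rw [Finset.sum_eq_zero fun K _ => if_neg (hex K), ← convexHull_erase_eq_simplexFacet]
      have hfr := facet_subset_frontier hd hex
      rw [setIntegral_congr_fun (g := fun _ => (0 : ℝ))
        (Set.Finite.isCompact_convexHull (𝕜 := ℝ) (Finset.finite_toSet _)).measurableSet]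
      · simp
      · intro x hx
        have hxL : x ∈ region L := convexHull_mono (by simp) hx
        have := hw x ⟨hxL, hfr hx⟩
        simp [this]
  simp_rw [h1]
  rw [Finset.sum_comm]
  refine Finset.sum_congr rfl fun K _ => ?_
  rw [facetIntegral_comm, facetIntegral]
  split_ifs with hc
  · obtain ⟨l, hl⟩ := exists_commonFace_eq_erase hc
    rw [Finset.sum_eq_single l]
    · rw [if_pos hl]
    · intro l' _ hl'
      refine if_neg fun h => hl' ?_
      rw [hl] at h
      by_contra hne
      have : l.1 ∈ L.1.erase l'.1 := Finset.mem_erase.2 ⟨fun h => hne (Subtype.ext h.symm), l.2⟩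
      rw [← h] at this
      simp at this
    · simp
  · refine Finset.sum_eq_zero fun l _ => if_neg fun h => hc ?_
    rw [h, Finset.card_erase_of_mem l.2, L.2.2]
    omega

/-- The divergence theorem on the domain, for a continuous cellwise polynomial field vanishing on
the boundary. -/
theorem integral_divPoly (hd : d ≠ 0) (w : T.VectorField)
    (hc : ∀ K L, ∀ x ∈ region K ∩ region L, vecValue (w K) x = vecValue (w L) x)
    (hw : ∀ K, ∀ x ∈ region K ∩ frontier T.space, vecValue (w K) x = 0) :
    T.integral (fun K x => value (divPoly (w K)) x) = 0 := by
  rw [integral, Finset.sum_congr rfl fun L _ => integral_divPoly_region hd L (w L) (hw L)]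
  -- The values agree on a common facet and the normals are opposite, so the sum over ordered pairs
  -- equals its own negative.
  have hanti : ∀ K L : T.Cell,
      facetIntegral L K (fun x => ∑ i, vecValue (w L) x i * unitNormal L K i) =
      -facetIntegral K L (fun x => ∑ i, vecValue (w K) x i * unitNormal K L i) := by
    intro K L
    rw [facetIntegral_comm L K, ← facetIntegral_neg]
    refine facetIntegral_congr fun x hx => ?_
    rw [unitNormal_comm K L, hc K L x hx, ← Finset.sum_neg_distrib]
    exact Finset.sum_congr rfl fun i _ => by simp
  have h := Finset.sum_comm (s := (Finset.univ : Finset T.Cell)) (t := (Finset.univ : Finset T.Cell))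
    (f := fun L K => facetIntegral L K (fun x => ∑ i, vecValue (w L) x i * unitNormal L K i))
  have h2 : ∑ K : T.Cell, ∑ L : T.Cell,
      facetIntegral L K (fun x => ∑ i, vecValue (w L) x i * unitNormal L K i) =
      -∑ K : T.Cell, ∑ L : T.Cell,
        facetIntegral K L (fun x => ∑ i, vecValue (w K) x i * unitNormal K L i) := by
    simp_rw [← Finset.sum_neg_distrib]
    exact Finset.sum_congr rfl fun K _ => Finset.sum_congr rfl fun L _ => hanti K L
  linarith

end SimplicialMesh

/-! ### Linearity, continuity and degrees of discrete fields -/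

section Values

variable {d : ℕ}

theorem vecValue_add (u v : Fin d → MvPolynomial (Fin d) ℝ) (x : EuclideanSpace ℝ (Fin d)) :
    vecValue (u + v) x = vecValue u x + vecValue v x := by
  ext i; simp [vecValue]

theorem vecValue_sub (u v : Fin d → MvPolynomial (Fin d) ℝ) (x : EuclideanSpace ℝ (Fin d)) :
    vecValue (u - v) x = vecValue u x - vecValue v x := by
  ext i; simp [vecValue]

theorem vecValue_smul (r : ℝ) (u : Fin d → MvPolynomial (Fin d) ℝ) (x : EuclideanSpace ℝ (Fin d)) :
    vecValue (r • u) x = r • vecValue u x := by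
  ext i; simp [vecValue]

theorem gradValue_add (u v : Fin d → MvPolynomial (Fin d) ℝ) (x : EuclideanSpace ℝ (Fin d)) :
    gradValue (u + v) x = gradValue u x + gradValue v x := by
  ext i j; simp [gradValue]

theorem gradValue_smul (r : ℝ) (u : Fin d → MvPolynomial (Fin d) ℝ)
    (x : EuclideanSpace ℝ (Fin d)) : gradValue (r • u) x = r • gradValue u x := by
  ext i j; simp [gradValue]

theorem divPoly_add (u v : Fin d → MvPolynomial (Fin d) ℝ) :
    divPoly (u + v) = divPoly u + divPoly v := by
  simp [divPoly, Finset.sum_add_distrib]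

theorem divPoly_smul (r : ℝ) (u : Fin d → MvPolynomial (Fin d) ℝ) :
    divPoly (r • u) = r • divPoly u := by
  simp [divPoly, Finset.smul_sum]

theorem value_divPoly (u : Fin d → MvPolynomial (Fin d) ℝ) (x : EuclideanSpace ℝ (Fin d)) :
    value (divPoly u) x = (gradValue u x).trace := by
  simp [divPoly, gradValue, Matrix.trace]

theorem ddot_add_left (A B C : Matrix (Fin d) (Fin d) ℝ) :
    ddot (A + B) C = ddot A C + ddot B C := by
  simp [ddot, add_mul, Finset.sum_add_distrib]

theorem ddot_smul_left (r : ℝ) (A B : Matrix (Fin d) (Fin d) ℝ) :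
    ddot (r • A) B = r * ddot A B := by
  simp [ddot, mul_assoc, Finset.mul_sum]

theorem ddot_comm (A B : Matrix (Fin d) (Fin d) ℝ) : ddot A B = ddot B A := by
  simp [ddot, mul_comm]

theorem ddot_add_right (A B C : Matrix (Fin d) (Fin d) ℝ) :
    ddot A (B + C) = ddot A B + ddot A C := by
  rw [ddot_comm, ddot_add_left, ddot_comm B, ddot_comm C]

theorem ddot_smul_right (r : ℝ) (A B : Matrix (Fin d) (Fin d) ℝ) :
    ddot A (r • B) = r * ddot A B := by
  rw [ddot_comm, ddot_smul_left, ddot_comm]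

theorem eq_zero_of_ddot_self {A : Matrix (Fin d) (Fin d) ℝ} (h : ddot A A = 0) : A = 0 := by
  ext i j
  have h1 := (Finset.sum_eq_zero_iff_of_nonneg fun i _ => Finset.sum_nonneg fun j _ =>
    mul_self_nonneg (A i j)).1 h i (Finset.mem_univ _)
  have h2 := (Finset.sum_eq_zero_iff_of_nonneg fun j _ => mul_self_nonneg (A i j)).1 h1 j
    (Finset.mem_univ _)
  simpa using h2

attribute [fun_prop] continuous_value

@[fun_prop] theorem continuous_vecValue (u : Fin d → MvPolynomial (Fin d) ℝ) :
    Continuous (vecValue u) :=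
  continuous_pi fun i => continuous_value (u i)

@[fun_prop] theorem continuous_gradValue (u : Fin d → MvPolynomial (Fin d) ℝ) :
    Continuous (gradValue u) :=
  continuous_matrix fun _ _ => continuous_value _

@[fun_prop] theorem continuous_ddot {X : Type*} [TopologicalSpace X]
    {A B : X → Matrix (Fin d) (Fin d) ℝ} (hA : Continuous A) (hB : Continuous B) :
    Continuous fun x => ddot (A x) (B x) :=
  continuous_finsetSum _ fun i _ => continuous_finsetSum _ fun j _ =>
    (hA.matrix_elem i j).mul (hB.matrix_elem i j)

theorem pderiv_mem_restrictTotalDegree {p : MvPolynomial (Fin d) ℝ} {m : ℕ}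
    (hp : p ∈ MvPolynomial.restrictTotalDegree (Fin d) ℝ m) (i : Fin d) :
    MvPolynomial.pderiv i p ∈ MvPolynomial.restrictTotalDegree (Fin d) ℝ (m - 1) := by
  rw [MvPolynomial.mem_restrictTotalDegree] at hp
  rw [p.as_sum, map_sum]
  refine Submodule.sum_mem _ fun s hs => ?_
  rw [MvPolynomial.pderiv_monomial]
  by_cases h0 : s i = 0
  · simp [h0]
  · rw [MvPolynomial.mem_restrictTotalDegree]
    refine (MvPolynomial.totalDegree_monomial_le _ _).trans ?_
    have h1 : s.degree ≤ m := (MvPolynomial.le_totalDegree hs).trans hp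
    have h2 : (s - Finsupp.single i 1).degree + 1 = s.degree := by
      conv_rhs => rw [← tsub_add_cancel_of_le
        (Finsupp.single_le_iff.2 (Nat.one_le_iff_ne_zero.2 h0) : Finsupp.single i 1 ≤ s)]
      rw [map_add, Finsupp.degree_single]
    change (s - Finsupp.single i 1).degree ≤ m - 1
    omega

theorem divPoly_mem_restrictTotalDegree {u : Fin d → MvPolynomial (Fin d) ℝ} {m : ℕ}
    (hu : ∀ i, u i ∈ MvPolynomial.restrictTotalDegree (Fin d) ℝ m) :
    divPoly u ∈ MvPolynomial.restrictTotalDegree (Fin d) ℝ (m - 1) :=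
  Submodule.sum_mem _ fun i _ => pderiv_mem_restrictTotalDegree (hu i) i

/-- A polynomial that vanishes on a nonempty open set is zero. -/
theorem eq_zero_of_value_eq_zero {p : MvPolynomial (Fin d) ℝ} {U : Set (EuclideanSpace ℝ (Fin d))}
    (hU : IsOpen U) (hne : U.Nonempty) (h : ∀ x ∈ U, value p x = 0) : p = 0 := by
  obtain ⟨z, hz⟩ := hne
  have hV : IsOpen ((WithLp.toLp 2 : (Fin d → ℝ) → EuclideanSpace ℝ (Fin d)) ⁻¹' U) :=
    hU.preimage (PiLp.continuous_toLp 2 _)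
  obtain ⟨r, hr, hball⟩ := Metric.isOpen_iff.1 hV (WithLp.ofLp z) hz
  refine MvPolynomial.funext_set (fun i => Metric.ball (z i) r)
    (fun i => ?_) fun x hx => ?_
  · rw [Real.ball_eq_Ioo]
    exact Set.Ioo_infinite (by linarith)
  · rw [← ball_pi _ hr] at hx
    simpa [value] using h _ (hball hx)

end Values

/-! ### Integrals over the mesh and the bilinear and trilinear forms of the scheme -/

namespace SimplicialMesh

variable {d : ℕ} {T : SimplicialMesh d}

theorem interior_region_nonempty (K : T.Cell) : (interior (region K)).Nonempty := by
  rw [region, ← range_cellBasis]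
  exact ⟨_, (cellBasis K).centroid_mem_interior_convexHull⟩

/-- A continuous nonnegative function with zero integral over a cell vanishes inside. -/
theorem eqOn_zero_of_integral_region_eq_zero {K : T.Cell} {f : EuclideanSpace ℝ (Fin d) → ℝ}
    (hf : Continuous f) (h0 : ∀ x, 0 ≤ f x) (h : ∫ x in region K, f x = 0) :
    ∀ x ∈ interior (region K), f x = 0 := by
  have hae := (setIntegral_eq_zero_iff_of_nonneg_ae (Filter.Eventually.of_forall h0)
    (hf.continuousOn.integrableOn_compact (isCompact_region K))).1 h
  have := Measure.eqOn_open_of_ae_eq (ae_restrict_of_ae_restrict_of_subset interior_subset hae)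
    isOpen_interior hf.continuousOn continuousOn_const
  exact fun x hx => this hx

/-- The volume of a cell. -/
def vol (K : T.Cell) : ℝ := volume.real (region K)

theorem vol_pos (K : T.Cell) : 0 < vol K := by
  refine ENNReal.toReal_pos ?_ (isCompact_region K).measure_lt_top.ne
  exact (Measure.measure_pos_of_nonempty_interior _ (interior_region_nonempty K)).ne'

theorem integral_const_eq (f : T.Cell → ℝ) : T.integral (fun K _ => f K) = ∑ K, vol K * f K := by
  simp only [integral, setIntegral_const, smul_eq_mul]
  rfl

theorem integrableOn_region {K : T.Cell} {f : EuclideanSpace ℝ (Fin d) → ℝ} (hf : Continuous f) :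
    IntegrableOn f (region K) :=
  hf.continuousOn.integrableOn_compact (isCompact_region K)

theorem integral_add {f g : T.Cell → EuclideanSpace ℝ (Fin d) → ℝ} (hf : ∀ K, Continuous (f K))
    (hg : ∀ K, Continuous (g K)) :
    T.integral (fun K x => f K x + g K x) = T.integral f + T.integral g := by
  simp only [integral, ← Finset.sum_add_distrib]
  exact Finset.sum_congr rfl fun K _ =>
    MeasureTheory.integral_add (integrableOn_region (hf K)) (integrableOn_region (hg K))

theorem integral_sub {f g : T.Cell → EuclideanSpace ℝ (Fin d) → ℝ} (hf : ∀ K, Continuous (f K))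
    (hg : ∀ K, Continuous (g K)) :
    T.integral (fun K x => f K x - g K x) = T.integral f - T.integral g := by
  simp only [integral, ← Finset.sum_sub_distrib]
  exact Finset.sum_congr rfl fun K _ =>
    MeasureTheory.integral_sub (integrableOn_region (hf K)) (integrableOn_region (hg K))

theorem integral_const_mul (r : ℝ) (f : T.Cell → EuclideanSpace ℝ (Fin d) → ℝ) :
    T.integral (fun K x => r * f K x) = r * T.integral f := by
  simp only [integral, Finset.mul_sum, MeasureTheory.integral_const_mul]

theorem integral_nonneg {f : T.Cell → EuclideanSpace ℝ (Fin d) → ℝ} (hf : ∀ K x, 0 ≤ f K x) :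
    0 ≤ T.integral f :=
  Finset.sum_nonneg fun K _ => MeasureTheory.integral_nonneg fun x => hf K x

theorem integral_region_eq_zero {f : T.Cell → EuclideanSpace ℝ (Fin d) → ℝ}
    (h0 : ∀ K x, 0 ≤ f K x) (h : T.integral f = 0) (K : T.Cell) : ∫ x in region K, f K x = 0 :=
  (Finset.sum_eq_zero_iff_of_nonneg fun K _ => MeasureTheory.integral_nonneg fun x => h0 K x).1 h K
    (Finset.mem_univ _)

/-- A cellwise polynomial with vanishing `L²` norm is zero. -/
theorem eq_zero_of_integral_sq {q : T.ScalarField}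
    (h : T.integral (fun K x => value (q K) x * value (q K) x) = 0) : q = 0 := by
  funext K
  have h1 := eqOn_zero_of_integral_region_eq_zero (K := K)
    (f := fun x => value (q K) x * value (q K) x) (by fun_prop) (fun x => mul_self_nonneg _)
    (integral_region_eq_zero (fun _ _ => mul_self_nonneg _) h K)
  exact eq_zero_of_value_eq_zero isOpen_interior (interior_region_nonempty K)
    fun x hx => mul_self_eq_zero.1 (h1 x hx)

theorem eq_zero_of_integral_dotProduct {u : T.VectorField}
    (h : T.integral (fun K x => vecValue (u K) x ⬝ᵥ vecValue (u K) x) = 0) : u = 0 := by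
  funext K i
  have h1 := eqOn_zero_of_integral_region_eq_zero (K := K)
    (f := fun x => vecValue (u K) x ⬝ᵥ vecValue (u K) x) (by fun_prop)
    (fun x => Finset.sum_nonneg fun _ _ => mul_self_nonneg _)
    (integral_region_eq_zero (fun _ _ => Finset.sum_nonneg fun _ _ => mul_self_nonneg _) h K)
  refine eq_zero_of_value_eq_zero isOpen_interior (interior_region_nonempty K) fun x hx => ?_
  have h2 := congrFun (dotProduct_self_eq_zero.1 (h1 x hx)) i
  exact h2

/-! ### The forms of the scheme -/

variable (T)

/-- `∫ u · v`. -/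
def massForm (u v : T.VectorField) : ℝ :=
  T.integral fun K x => vecValue (u K) x ⬝ᵥ vecValue (v K) x

/-- `∫ (u₀ · ∇u) · v`. -/
def convForm (u₀ u v : T.VectorField) : ℝ :=
  T.integral fun K x => (gradValue (u K) x *ᵥ vecValue (u₀ K) x) ⬝ᵥ vecValue (v K) x

/-- `∫ ∇u : ∇v`. -/
def gradForm (u v : T.VectorField) : ℝ :=
  T.integral fun K x => ddot (gradValue (u K) x) (gradValue (v K) x)

/-- `∫ A : ∇v`. -/
def stressForm (A : T.TensorField) (v : T.VectorField) : ℝ :=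
  T.integral fun K x => ddot (A K) (gradValue (v K) x)

/-- `∫ A : B`. -/
def tensorForm (A B : T.TensorField) : ℝ := T.integral fun K _ => ddot (A K) (B K)

/-- `∫ (∇u A + A (∇u)ᵀ) : B`. -/
def stretchForm (u : T.VectorField) (A B : T.TensorField) : ℝ :=
  T.integral fun K x => ddot (gradValue (u K) x * A K + A K * (gradValue (u K) x)ᵀ) (B K)

variable {T}

theorem tensorForm_eq (A B : T.TensorField) : T.tensorForm A B = ∑ K, vol K * ddot (A K) (B K) :=
  integral_const_eq _

theorem weakForm_eq (Re We ε δt : ℝ) (u₀ : T.VectorField) (A₀ : T.TensorField)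
    (u : T.VectorField) (p : T.ScalarField) (A : T.TensorField)
    (v : T.VectorField) (q : T.ScalarField) (B : T.TensorField) :
    T.weakForm Re We ε δt u₀ A₀ u p A v q B =
      Re * (δt⁻¹ * T.massForm (u - u₀) v + T.convForm u₀ u v) - T.divForm p v + T.divForm q u
        + (1 - ε) * T.gradForm u v + ε / We * T.stressForm A v + 1 / We * T.tensorForm (A - 1) B
        + δt⁻¹ * T.tensorForm (A - A₀) B - T.stretchForm u A B + T.upwindForm u₀ A B := by
  rw [weakForm]
  congr 1
  rw [massForm, convForm, divForm, divForm, gradForm, stressForm, tensorForm, tensorForm,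
    stretchForm]
  simp only [← integral_const_mul]
  rw [← integral_add (by fun_prop) (by fun_prop), ← integral_const_mul,
    ← integral_sub (by fun_prop) (by fun_prop), ← integral_add (by fun_prop) (by fun_prop),
    ← integral_add (by fun_prop) (by fun_prop), ← integral_add (by fun_prop) (by fun_prop),
    ← integral_add (by fun_prop) (by fun_prop), ← integral_add (by fun_prop) (by fun_prop),
    ← integral_sub (by fun_prop) (by fun_prop)]
  congr 1
  funext K x
  simp only [Pi.sub_apply, vecValue_sub, Pi.one_apply, ddot_smul_left, add_dotProduct,
    smul_dotProduct, smul_eq_mul]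

end SimplicialMesh

/-! ### Testing the tensor equation with `I - A⁻¹`, pointwise -/

section PointwiseTensor

variable {d : ℕ}

theorem transpose_inv_of_posDef {A : Matrix (Fin d) (Fin d) ℝ} (hA : A.PosDef) : A⁻¹ᵀ = A⁻¹ := by
  have := hA.inv.isHermitian
  rwa [Matrix.IsHermitian, Matrix.conjTranspose_eq_transpose_of_trivial] at this

theorem transpose_of_posDef {A : Matrix (Fin d) (Fin d) ℝ} (hA : A.PosDef) : Aᵀ = A := by
  have := hA.isHermitian
  rwa [Matrix.IsHermitian, Matrix.conjTranspose_eq_transpose_of_trivial] at this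

theorem mul_inv_of_posDef {A : Matrix (Fin d) (Fin d) ℝ} (hA : A.PosDef) : A * A⁻¹ = 1 :=
  Matrix.mul_nonsing_inv _ (isUnit_iff_ne_zero.2 hA.det_pos.ne')

theorem inv_mul_of_posDef {A : Matrix (Fin d) (Fin d) ℝ} (hA : A.PosDef) : A⁻¹ * A = 1 :=
  Matrix.nonsing_inv_mul _ (isUnit_iff_ne_zero.2 hA.det_pos.ne')

theorem ddot_one_sub_inv {A : Matrix (Fin d) (Fin d) ℝ} (hA : A.PosDef)
    (X : Matrix (Fin d) (Fin d) ℝ) : ddot X (1 - A⁻¹) = X.trace - (X * A⁻¹).trace := by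
  rw [ddot_eq_trace, Matrix.transpose_sub, transpose_inv_of_posDef hA, Matrix.transpose_one,
    Matrix.mul_sub, mul_one, Matrix.trace_sub]

theorem ddot_sub_one_one_sub_inv {A : Matrix (Fin d) (Fin d) ℝ} (hA : A.PosDef) :
    ddot (A - 1) (1 - A⁻¹) =
      (A + A⁻¹ - (2 : ℝ) • (1 : Matrix (Fin d) (Fin d) ℝ)).trace := by
  rw [ddot_one_sub_inv hA, Matrix.sub_mul, mul_inv_of_posDef hA, one_mul]
  simp only [Matrix.trace_sub, Matrix.trace_add, Matrix.trace_smul, smul_eq_mul]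
  ring

/-- The convexity inequality for the free energy density `tr (A - ln A - I)`. -/
theorem trace_energy_sub_le {A A₀ : Matrix (Fin d) (Fin d) ℝ} (hA : A.PosDef) (hA₀ : A₀.PosDef) :
    (A - cfc Real.log A - 1).trace - (A₀ - cfc Real.log A₀ - 1).trace ≤
      ddot (A - A₀) (1 - A⁻¹) := by
  have h := log_det_sub_log_det_le hA₀ hA
  rw [trace_sub_cfc_log hA, trace_sub_cfc_log hA₀, ddot_one_sub_inv hA, Matrix.sub_mul,
    mul_inv_of_posDef hA]
  simp only [Matrix.trace_sub, Matrix.trace_one]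
  linarith

/-- In the part tested with `A⁻¹`, the factor `A` cancels under the trace and only the trace of `G`
survives. The other part is twice the stress power. -/
theorem ddot_stretch_one_sub_inv {A : Matrix (Fin d) (Fin d) ℝ} (hA : A.PosDef)
    (G : Matrix (Fin d) (Fin d) ℝ) :
    ddot (G * A + A * Gᵀ) (1 - A⁻¹) = 2 * ddot A G - 2 * G.trace := by
  have h1 : (G * A).trace = (A * Gᵀ).trace := by
    rw [← Matrix.trace_transpose, Matrix.transpose_mul, transpose_of_posDef hA]
  have h2 : ((G * A + A * Gᵀ) * A⁻¹).trace = 2 * G.trace := by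
    rw [Matrix.add_mul, mul_assoc G, mul_inv_of_posDef hA, mul_one, Matrix.trace_add,
      Matrix.trace_mul_comm (A * Gᵀ), ← mul_assoc, inv_mul_of_posDef hA, one_mul,
      Matrix.trace_transpose]
    ring
  rw [ddot_one_sub_inv hA, h2, Matrix.trace_add, h1, ddot_eq_trace A G]
  ring

end PointwiseTensor

/-! ### The discrete free energy estimate -/

namespace SimplicialMesh

variable {d : ℕ} {T : SimplicialMesh d}

/-! ### Divergence-free fields and the convective term -/

/-- Differentiation lowers the degree by one, so the divergence is itself a discrete pressure and
may be used to test against itself. -/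
theorem divPoly_eq_zero {u : T.VectorField} (hu : u ∈ T.divFreeSpace) (K : T.Cell) :
    divPoly (u K) = 0 := by
  have h := hu.2 (fun K => divPoly (u K)) fun K => divPoly_mem_restrictTotalDegree (hu.1.1 K)
  exact congrFun (eq_zero_of_integral_sq h) K

theorem integral_divPoly_eq_zero (hd : d ≠ 0) {v : T.VectorField} (hv : v ∈ T.velocitySpace) :
    T.integral (fun K x => value (divPoly (v K)) x) = 0 :=
  integral_divPoly hd v hv.2.1 hv.2.2

/-- The convective term does not contribute to the energy balance. -/
theorem convForm_self (hd : d ≠ 0) {u₀ u : T.VectorField} (hu₀ : u₀ ∈ T.divFreeSpace)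
    (hu : u ∈ T.velocitySpace) : T.convForm u₀ u u = 0 := by
  -- The field `|u|² u₀` is continuous and vanishes on the boundary; as `div u₀ = 0`, its divergence
  -- is twice the convective integrand.
  have h := integral_divPoly hd (T := T) (fun K j => u₀ K j * ∑ i, u K i * u K i)
    (fun K L x hx => by
      have h1 := hu₀.1.2.1 K L x hx
      have h2 := hu.2.1 K L x hx
      ext j
      have e1 := congrFun h1 j
      have e2 := congrFun h2
      simp only [vecValue] at e1 e2
      simp only [vecValue, value_mul, value_sum, e1, e2])
    (fun K x hx => by
      have e1 := congrFun (hu₀.1.2.2 K x hx)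
      simp only [vecValue, Pi.zero_apply] at e1
      ext j
      simp [vecValue, e1])
  have key : ∀ K x, value (divPoly fun j => u₀ K j * ∑ i, u K i * u K i) x =
      2 * ((gradValue (u K) x *ᵥ vecValue (u₀ K) x) ⬝ᵥ vecValue (u K) x) := by
    intro K x
    have hdiv : ∑ i, value (MvPolynomial.pderiv i (u₀ K i)) x = 0 := by
      rw [← value_sum, ← divPoly, divPoly_eq_zero hu₀, value_zero]
    simp only [divPoly, Derivation.leibniz, value_sum, value_add, value_mul, smul_eq_mul, map_sum,
      Finset.sum_add_distrib, dotProduct, Matrix.mulVec, gradValue, Matrix.of_apply, vecValue]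
    rw [← Finset.mul_sum, hdiv, mul_zero, add_zero, Finset.mul_sum]
    simp only [← two_mul, Finset.mul_sum, Finset.sum_mul]
    rw [Finset.sum_comm]
    exact Finset.sum_congr rfl fun i _ => Finset.sum_congr rfl fun j _ => by ring
  simp only [key, integral_const_mul] at h
  rw [convForm]
  linarith

/-! ### The upwind term -/

/-- The flux of a velocity from `K` into `L`. -/
def flux {T : SimplicialMesh d} (u : T.VectorField) (K L : T.Cell) : ℝ :=
  facetIntegral K L fun x => max (∑ i, vecValue (u K) x i * unitNormal K L i) 0

/-- The tensors are constant on the cells, so the facet integrals act on the velocity alone. -/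
theorem upwindForm_eq (u : T.VectorField) (A B : T.TensorField) :
    T.upwindForm u A B = ∑ K, ∑ L, flux u K L * ddot (A L - A K) (B L) := by
  refine Finset.sum_congr rfl fun K _ => Finset.sum_congr rfl fun L _ => ?_
  rw [flux, facetIntegral]
  split_ifs
  · rw [integral_mul_const]
  · rw [zero_mul]

theorem flux_nonneg (u : T.VectorField) (K L : T.Cell) : 0 ≤ flux u K L := by
  rw [flux, facetIntegral]
  split_ifs
  · exact MeasureTheory.integral_nonneg fun x => le_max_right _ _
  · exact le_rfl

/-- The normals are opposite, the velocity is continuous across the facet, and `max s 0 - max (-s) 0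
= s`. -/
theorem flux_sub_flux (hd : d ≠ 0) {u : T.VectorField} (hu : u ∈ T.velocitySpace) (K L : T.Cell) :
    flux u K L - flux u L K =
      -facetIntegral L K fun x => ∑ i, vecValue (u L) x i * unitNormal L K i := by
  have h1 : flux u K L =
      facetIntegral L K fun x => max (-∑ i, vecValue (u L) x i * unitNormal L K i) 0 := by
    rw [flux, facetIntegral_comm]
    refine facetIntegral_congr fun x hx => ?_
    rw [unitNormal_comm K L, hu.2.1 L K x hx, ← Finset.sum_neg_distrib]
    simp
  rw [h1, flux]
  simp only [facetIntegral]
  split_ifs with hc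
  · rw [← MeasureTheory.integral_sub, ← MeasureTheory.integral_neg]
    · refine integral_congr_ae (Filter.Eventually.of_forall fun x => ?_)
      simp only
      rcases le_total 0 (∑ i, vecValue (u L) x i * unitNormal L K i) with h | h
      · rw [max_eq_left h, max_eq_right (by linarith)]; ring
      · rw [max_eq_right h, max_eq_left (by linarith)]; ring
    · exact integrableOn_commonFace hd hc (by simp only [vecValue]; fun_prop)
    · exact integrableOn_commonFace hd hc (by simp only [vecValue]; fun_prop)
  · simp

/-- Summation by parts: the coefficient of `φ L` is the net inflow into `L`, which is minus the
integral of `div u` over `L`. -/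
theorem sum_flux_mul_sub (hd : d ≠ 0) {u : T.VectorField} (hu : u ∈ T.divFreeSpace)
    (φ : T.Cell → ℝ) : ∑ K, ∑ L, flux u K L * (φ L - φ K) = 0 := by
  have h1 : ∀ L, ∑ K, (flux u K L - flux u L K) = 0 := by
    intro L
    simp_rw [flux_sub_flux hd hu.1]
    rw [Finset.sum_neg_distrib, ← integral_divPoly_region hd L (u L) (hu.1.2.2 L),
      divPoly_eq_zero hu]
    simp
  have h2 : ∑ K, ∑ L, flux u K L * (φ L - φ K) =
      ∑ L, φ L * ∑ K, (flux u K L - flux u L K) := by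
    simp only [mul_sub, Finset.sum_sub_distrib, Finset.mul_sum]
    congr 1
    · rw [Finset.sum_comm]
      exact Finset.sum_congr rfl fun K _ => Finset.sum_congr rfl fun L _ => by ring
    · exact Finset.sum_congr rfl fun K _ => Finset.sum_congr rfl fun L _ => by ring
  rw [h2]
  simp [h1]

/-- The upwind term dissipates the free energy. -/
theorem upwindForm_nonneg (hd : d ≠ 0) {u : T.VectorField} (hu : u ∈ T.divFreeSpace)
    {A : T.TensorField} (hA : ∀ K, (A K).PosDef) :
    0 ≤ T.upwindForm u A fun K => 1 - (A K)⁻¹ := by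
  -- Zero is written as the flux-weighted sum of the jumps of the energy density; convexity then
  -- compares term by term.
  rw [upwindForm_eq, ← sum_flux_mul_sub hd hu fun K => (A K - cfc Real.log (A K) - 1).trace]
  exact Finset.sum_le_sum fun K _ => Finset.sum_le_sum fun L _ =>
    mul_le_mul_of_nonneg_left (trace_energy_sub_le (hA L) (hA K)) (flux_nonneg u K L)

/-! ### The free energy estimate -/

theorem massForm_sub_self (u u₀ : T.VectorField) :
    2 * T.massForm (u - u₀) u =
      T.massForm u u - T.massForm u₀ u₀ + T.massForm (u - u₀) (u - u₀) := by
  simp only [massForm, ← integral_const_mul]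
  rw [← integral_sub (by fun_prop) (by fun_prop), ← integral_add (by fun_prop) (by fun_prop)]
  congr 1
  funext K x
  simp only [Pi.sub_apply, vecValue_sub, sub_dotProduct, dotProduct_sub,
    dotProduct_comm (vecValue (u₀ K) x) (vecValue (u K) x)]
  ring

theorem stretchForm_one_sub_inv {A : T.TensorField} (hA : ∀ K, (A K).PosDef) (u : T.VectorField) :
    T.stretchForm u A (fun K => 1 - (A K)⁻¹) =
      2 * T.stressForm A u - 2 * T.integral fun K x => value (divPoly (u K)) x := by
  simp only [stretchForm, stressForm, ← integral_const_mul]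
  rw [← integral_sub (by fun_prop) (by fun_prop)]
  congr 1
  funext K x
  rw [ddot_stretch_one_sub_inv (hA K), value_divPoly]

theorem tensorForm_smul_right (A B : T.TensorField) (r : ℝ) :
    T.tensorForm A (r • B) = r * T.tensorForm A B := by
  simp only [tensorForm, Pi.smul_apply, ddot_smul_right, integral_const_mul]

theorem stretchForm_smul_right (u : T.VectorField) (A B : T.TensorField) (r : ℝ) :
    T.stretchForm u A (r • B) = r * T.stretchForm u A B := by
  simp only [stretchForm, Pi.smul_apply, ddot_smul_right, integral_const_mul]

theorem upwindForm_smul_right (u : T.VectorField) (A B : T.TensorField) (r : ℝ) :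
    T.upwindForm u A (r • B) = r * T.upwindForm u A B := by
  simp only [upwindForm_eq, Pi.smul_apply, ddot_smul_right, Finset.mul_sum]
  exact Finset.sum_congr rfl fun K _ => Finset.sum_congr rfl fun L _ => by ring

theorem freeEnergy_eq (Re We ε : ℝ) (u : T.VectorField) (A : T.TensorField) :
    T.freeEnergy Re We ε u A = Re / 2 * T.massForm u u
      + ε / (2 * We) * ∑ K, vol K * (A K - cfc Real.log (A K) - 1).trace := by
  rw [freeEnergy, integral_const_eq]
  rfl

theorem dissipation_eq (Re We ε δt : ℝ) (u₀ u : T.VectorField) (A : T.TensorField) :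
    T.dissipation Re We ε δt u₀ u A = Re / 2 * T.massForm (u - u₀) (u - u₀)
      + δt * ((1 - ε) * T.gradForm u u + ε / (2 * We ^ 2) * ∑ K, vol K *
        (A K + (A K)⁻¹ - (2 : ℝ) • (1 : Matrix (Fin d) (Fin d) ℝ)).trace) := by
  rw [dissipation, integral_add (by fun_prop) (by fun_prop), integral_const_mul,
    integral_const_mul, integral_const_mul, integral_const_eq]
  simp only [← vecValue_sub]
  rfl

theorem massForm_self_nonneg (u : T.VectorField) : 0 ≤ T.massForm u u :=
  integral_nonneg fun _ _ => Finset.sum_nonneg fun _ _ => mul_self_nonneg _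

theorem dissipation_nonneg {Re We ε δt : ℝ} (hRe : 0 < Re) (hε₀ : 0 < ε) (hε₁ : ε ≤ 1)
    (hδt : 0 < δt) (u₀ u : T.VectorField) {A : T.TensorField} (hA : ∀ K, (A K).PosDef) :
    0 ≤ T.dissipation Re We ε δt u₀ u A := by
  rw [dissipation_eq]
  have h1 := massForm_self_nonneg (u - u₀)
  have h2 : 0 ≤ T.gradForm u u := integral_nonneg fun _ _ => ddot_self_nonneg _
  have h3 : 0 ≤ ∑ K, vol K *
      (A K + (A K)⁻¹ - (2 : ℝ) • (1 : Matrix (Fin d) (Fin d) ℝ)).trace :=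
    Finset.sum_nonneg fun K _ => mul_nonneg (vol_pos K).le (trace_add_inv_sub_two_nonneg (hA K))
  have h4 : 0 ≤ 1 - ε := by linarith
  positivity

theorem const_mem_pressureSpace (c : ℝ) : (fun _ => MvPolynomial.C c) ∈ T.pressureSpace := by
  intro K
  rw [MvPolynomial.mem_restrictTotalDegree, MvPolynomial.totalDegree_C]
  exact Nat.zero_le _

/-- The discrete free energy estimate. -/
theorem freeEnergy_add_dissipation_le (hd : d ≠ 0) {Re We ε δt : ℝ} (hWe : 0 < We) (hε₀ : 0 < ε)
    (hδt : 0 < δt) {u₀ : T.VectorField} (hu₀ : u₀ ∈ T.divFreeSpace) {A₀ : T.TensorField}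
    (hA₀ : ∀ K, (A₀ K).PosDef) {u : T.VectorField} {p : T.ScalarField} {A : T.TensorField}
    (h : T.IsPosDefSolution Re We ε δt u₀ A₀ u p A) :
    T.freeEnergy Re We ε u A - T.freeEnergy Re We ε u₀ A₀
      + T.dissipation Re We ε δt u₀ u A ≤ 0 := by
  obtain ⟨hu, hp, hAs, hA, heq⟩ := h
  -- The weight `ε / (2 We)` makes the factor `2` of the stretching term match the coefficient `ε /
  -- We` of the stress.
  let D : T.TensorField := fun K => 1 - (A K)⁻¹
  have hD : (ε / (2 * We)) • D ∈ T.tensorSpace := by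
    intro K
    change ((ε / (2 * We)) • (1 - (A K)⁻¹))ᵀ = (ε / (2 * We)) • (1 - (A K)⁻¹)
    rw [Matrix.transpose_smul, Matrix.transpose_sub, transpose_inv_of_posDef (hA K),
      Matrix.transpose_one]
  have h1 := heq u hu p hp _ hD
  rw [weakForm_eq, convForm_self hd hu₀ hu, tensorForm_smul_right, tensorForm_smul_right,
    stretchForm_smul_right, upwindForm_smul_right, stretchForm_one_sub_inv hA,
    integral_divPoly_eq_zero hd hu] at h1
  have hup := upwindForm_nonneg hd hu₀ hA
  have ht1 : T.tensorForm (A - 1) D = ∑ K, vol K *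
      (A K + (A K)⁻¹ - (2 : ℝ) • (1 : Matrix (Fin d) (Fin d) ℝ)).trace := by
    rw [tensorForm_eq]
    exact Finset.sum_congr rfl fun K _ => by
      rw [← ddot_sub_one_one_sub_inv (hA K)]; rfl
  have ht2 : ∑ K, vol K * (A K - cfc Real.log (A K) - 1).trace -
      ∑ K, vol K * (A₀ K - cfc Real.log (A₀ K) - 1).trace ≤ T.tensorForm (A - A₀) D := by
    rw [tensorForm_eq, ← Finset.sum_sub_distrib]
    refine Finset.sum_le_sum fun K _ => ?_
    rw [← mul_sub]
    exact mul_le_mul_of_nonneg_left (trace_energy_sub_le (hA K) (hA₀ K)) (vol_pos K).le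
  have hm := massForm_sub_self u u₀
  rw [freeEnergy_eq, freeEnergy_eq, dissipation_eq, ← ht1]
  set φ := ∑ K, vol K * (A K - cfc Real.log (A K) - 1).trace
  set φ₀ := ∑ K, vol K * (A₀ K - cfc Real.log (A₀ K) - 1).trace
  have h2 : δt * (Re * (δt⁻¹ * T.massForm (u - u₀) u) + (1 - ε) * T.gradForm u u
      + 1 / We * (ε / (2 * We) * T.tensorForm (A - 1) D)
      + δt⁻¹ * (ε / (2 * We) * T.tensorForm (A - A₀) D)
      + ε / (2 * We) * T.upwindForm u₀ A D) = 0 := by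
    rw [mul_eq_zero]
    right
    rw [← h1]
    field_simp
    ring
  have h3 : Re * T.massForm (u - u₀) u + δt * ((1 - ε) * T.gradForm u u
      + ε / (2 * We ^ 2) * T.tensorForm (A - 1) D)
      + ε / (2 * We) * T.tensorForm (A - A₀) D
      + δt * (ε / (2 * We)) * T.upwindForm u₀ A D = 0 := by
    rw [← h2]
    field_simp
    ring
  have h4 : 0 ≤ δt * (ε / (2 * We)) * T.upwindForm u₀ A D := mul_nonneg (by positivity) hup
  have h5 := mul_le_mul_of_nonneg_left ht2 (by positivity : 0 ≤ ε / (2 * We))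
  have h6 : Re / 2 * (2 * T.massForm (u - u₀) u) = Re / 2 * (T.massForm u u - T.massForm u₀ u₀
      + T.massForm (u - u₀) (u - u₀)) := by rw [hm]
  linarith

end SimplicialMesh

/-! ### Multilinearity, finite-dimensional spaces and recovery of the pressure -/

namespace SimplicialMesh

variable {d : ℕ} {T : SimplicialMesh d}

/-! ### Linearity of the forms -/

theorem massForm_add_left (u u' v : T.VectorField) :
    T.massForm (u + u') v = T.massForm u v + T.massForm u' v := by
  simp only [massForm]
  rw [← integral_add (by fun_prop) (by fun_prop)]
  simp only [Pi.add_apply, vecValue_add, add_dotProduct]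

theorem massForm_smul_left (r : ℝ) (u v : T.VectorField) :
    T.massForm (r • u) v = r * T.massForm u v := by
  simp only [massForm]
  rw [← integral_const_mul]
  simp only [Pi.smul_apply, vecValue_smul, smul_dotProduct, smul_eq_mul]

theorem massForm_comm (u v : T.VectorField) : T.massForm u v = T.massForm v u := by
  simp only [massForm, dotProduct_comm]

theorem massForm_add_right (u v v' : T.VectorField) :
    T.massForm u (v + v') = T.massForm u v + T.massForm u v' := by
  rw [massForm_comm, massForm_add_left, massForm_comm v, massForm_comm v']

theorem massForm_smul_right (r : ℝ) (u v : T.VectorField) :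
    T.massForm u (r • v) = r * T.massForm u v := by
  rw [massForm_comm, massForm_smul_left, massForm_comm]

theorem convForm_add_left (u₀ u₀' u v : T.VectorField) :
    T.convForm (u₀ + u₀') u v = T.convForm u₀ u v + T.convForm u₀' u v := by
  simp only [convForm]
  rw [← integral_add (by fun_prop) (by fun_prop)]
  simp only [Pi.add_apply, vecValue_add, Matrix.mulVec_add, add_dotProduct]

theorem convForm_smul_left (r : ℝ) (u₀ u v : T.VectorField) :
    T.convForm (r • u₀) u v = r * T.convForm u₀ u v := by
  simp only [convForm]
  rw [← integral_const_mul]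
  simp only [Pi.smul_apply, vecValue_smul, Matrix.mulVec_smul, smul_dotProduct, smul_eq_mul]

theorem convForm_add_middle (u₀ u u' v : T.VectorField) :
    T.convForm u₀ (u + u') v = T.convForm u₀ u v + T.convForm u₀ u' v := by
  simp only [convForm]
  rw [← integral_add (by fun_prop) (by fun_prop)]
  simp only [Pi.add_apply, gradValue_add, Matrix.add_mulVec, add_dotProduct]

theorem convForm_smul_middle (r : ℝ) (u₀ u v : T.VectorField) :
    T.convForm u₀ (r • u) v = r * T.convForm u₀ u v := by
  simp only [convForm]
  rw [← integral_const_mul]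
  simp only [Pi.smul_apply, gradValue_smul, Matrix.smul_mulVec, smul_dotProduct, smul_eq_mul]

theorem convForm_add_right (u₀ u v v' : T.VectorField) :
    T.convForm u₀ u (v + v') = T.convForm u₀ u v + T.convForm u₀ u v' := by
  simp only [convForm]
  rw [← integral_add (by fun_prop) (by fun_prop)]
  simp only [Pi.add_apply, vecValue_add, dotProduct_add]

theorem convForm_smul_right (r : ℝ) (u₀ u v : T.VectorField) :
    T.convForm u₀ u (r • v) = r * T.convForm u₀ u v := by
  simp only [convForm]
  rw [← integral_const_mul]
  simp only [Pi.smul_apply, vecValue_smul, dotProduct_smul, smul_eq_mul]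

theorem divForm_add_left (q q' : T.ScalarField) (v : T.VectorField) :
    T.divForm (q + q') v = T.divForm q v + T.divForm q' v := by
  simp only [divForm]
  rw [← integral_add (by fun_prop) (by fun_prop)]
  simp only [Pi.add_apply, value_add, add_mul]

theorem divForm_smul_left (r : ℝ) (q : T.ScalarField) (v : T.VectorField) :
    T.divForm (r • q) v = r * T.divForm q v := by
  simp only [divForm]
  rw [← integral_const_mul]
  simp only [Pi.smul_apply, value_smul, mul_assoc]

theorem divForm_add_right (q : T.ScalarField) (v v' : T.VectorField) :
    T.divForm q (v + v') = T.divForm q v + T.divForm q v' := by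
  simp only [divForm]
  rw [← integral_add (by fun_prop) (by fun_prop)]
  simp only [Pi.add_apply, divPoly_add, value_add, mul_add]

theorem divForm_smul_right (r : ℝ) (q : T.ScalarField) (v : T.VectorField) :
    T.divForm q (r • v) = r * T.divForm q v := by
  simp only [divForm]
  rw [← integral_const_mul]
  simp only [Pi.smul_apply, divPoly_smul, value_smul, mul_left_comm]

theorem gradForm_add_left (u u' v : T.VectorField) :
    T.gradForm (u + u') v = T.gradForm u v + T.gradForm u' v := by
  simp only [gradForm]
  rw [← integral_add (by fun_prop) (by fun_prop)]
  simp only [Pi.add_apply, gradValue_add, ddot_add_left]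

theorem gradForm_smul_left (r : ℝ) (u v : T.VectorField) :
    T.gradForm (r • u) v = r * T.gradForm u v := by
  simp only [gradForm]
  rw [← integral_const_mul]
  simp only [Pi.smul_apply, gradValue_smul, ddot_smul_left]

theorem gradForm_comm (u v : T.VectorField) : T.gradForm u v = T.gradForm v u := by
  simp only [gradForm, ddot_comm]

theorem gradForm_add_right (u v v' : T.VectorField) :
    T.gradForm u (v + v') = T.gradForm u v + T.gradForm u v' := by
  rw [gradForm_comm, gradForm_add_left, gradForm_comm v, gradForm_comm v']

theorem gradForm_smul_right (r : ℝ) (u v : T.VectorField) :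
    T.gradForm u (r • v) = r * T.gradForm u v := by
  rw [gradForm_comm, gradForm_smul_left, gradForm_comm]

theorem stressForm_add_left (A A' : T.TensorField) (v : T.VectorField) :
    T.stressForm (A + A') v = T.stressForm A v + T.stressForm A' v := by
  simp only [stressForm]
  rw [← integral_add (by fun_prop) (by fun_prop)]
  simp only [Pi.add_apply, ddot_add_left]

theorem stressForm_smul_left (r : ℝ) (A : T.TensorField) (v : T.VectorField) :
    T.stressForm (r • A) v = r * T.stressForm A v := by
  simp only [stressForm]
  rw [← integral_const_mul]
  simp only [Pi.smul_apply, ddot_smul_left]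

theorem stressForm_add_right (A : T.TensorField) (v v' : T.VectorField) :
    T.stressForm A (v + v') = T.stressForm A v + T.stressForm A v' := by
  simp only [stressForm]
  rw [← integral_add (by fun_prop) (by fun_prop)]
  simp only [Pi.add_apply, gradValue_add, ddot_add_right]

theorem stressForm_smul_right (r : ℝ) (A : T.TensorField) (v : T.VectorField) :
    T.stressForm A (r • v) = r * T.stressForm A v := by
  simp only [stressForm]
  rw [← integral_const_mul]
  simp only [Pi.smul_apply, gradValue_smul, ddot_smul_right]

theorem tensorForm_add_left (A A' B : T.TensorField) :
    T.tensorForm (A + A') B = T.tensorForm A B + T.tensorForm A' B := by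
  simp only [tensorForm]
  rw [← integral_add (by fun_prop) (by fun_prop)]
  simp only [Pi.add_apply, ddot_add_left]

theorem tensorForm_smul_left (r : ℝ) (A B : T.TensorField) :
    T.tensorForm (r • A) B = r * T.tensorForm A B := by
  simp only [tensorForm]
  rw [← integral_const_mul]
  simp only [Pi.smul_apply, ddot_smul_left]

theorem tensorForm_comm (A B : T.TensorField) : T.tensorForm A B = T.tensorForm B A := by
  simp only [tensorForm, ddot_comm]

theorem tensorForm_add_right (A B B' : T.TensorField) :
    T.tensorForm A (B + B') = T.tensorForm A B + T.tensorForm A B' := by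
  rw [tensorForm_comm, tensorForm_add_left, tensorForm_comm B, tensorForm_comm B']

theorem tensorForm_sub_left (A A' B : T.TensorField) :
    T.tensorForm (A - A') B = T.tensorForm A B - T.tensorForm A' B := by
  rw [sub_eq_add_neg, ← neg_one_smul ℝ A', tensorForm_add_left, tensorForm_smul_left]
  ring

theorem stretchForm_add_left (u u' : T.VectorField) (A B : T.TensorField) :
    T.stretchForm (u + u') A B = T.stretchForm u A B + T.stretchForm u' A B := by
  simp only [stretchForm]
  rw [← integral_add (by fun_prop) (by fun_prop)]
  simp only [Pi.add_apply, gradValue_add, ← ddot_add_left, Matrix.transpose_add, Matrix.add_mul,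
    Matrix.mul_add, add_add_add_comm]

theorem stretchForm_smul_left (r : ℝ) (u : T.VectorField) (A B : T.TensorField) :
    T.stretchForm (r • u) A B = r * T.stretchForm u A B := by
  simp only [stretchForm]
  rw [← integral_const_mul]
  simp only [Pi.smul_apply, gradValue_smul, ← ddot_smul_left, Matrix.transpose_smul,
    Matrix.smul_mul, Matrix.mul_smul, smul_add]

theorem stretchForm_add_middle (u : T.VectorField) (A A' B : T.TensorField) :
    T.stretchForm u (A + A') B = T.stretchForm u A B + T.stretchForm u A' B := by
  simp only [stretchForm]
  rw [← integral_add (by fun_prop) (by fun_prop)]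
  simp only [Pi.add_apply, ← ddot_add_left, Matrix.add_mul, Matrix.mul_add, add_add_add_comm]

theorem stretchForm_smul_middle (r : ℝ) (u : T.VectorField) (A B : T.TensorField) :
    T.stretchForm u (r • A) B = r * T.stretchForm u A B := by
  simp only [stretchForm]
  rw [← integral_const_mul]
  simp only [Pi.smul_apply, ← ddot_smul_left, Matrix.smul_mul, Matrix.mul_smul, smul_add]

theorem stretchForm_add_right (u : T.VectorField) (A B B' : T.TensorField) :
    T.stretchForm u A (B + B') = T.stretchForm u A B + T.stretchForm u A B' := by
  simp only [stretchForm]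
  rw [← integral_add (by fun_prop) (by fun_prop)]
  simp only [Pi.add_apply, ddot_add_right]

theorem upwindForm_add_middle (u : T.VectorField) (A A' B : T.TensorField) :
    T.upwindForm u (A + A') B = T.upwindForm u A B + T.upwindForm u A' B := by
  simp only [upwindForm_eq, ← Finset.sum_add_distrib, Pi.add_apply, add_sub_add_comm,
    ddot_add_left, mul_add]

theorem upwindForm_add_right (u : T.VectorField) (A B B' : T.TensorField) :
    T.upwindForm u A (B + B') = T.upwindForm u A B + T.upwindForm u A B' := by
  simp only [upwindForm_eq, ← Finset.sum_add_distrib, Pi.add_apply, ddot_add_right, mul_add]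

/-! ### The finite element spaces as submodules -/

variable (T)

/-- The velocity space as a submodule. -/
def velocitySubmodule : Submodule ℝ T.VectorField where
  carrier := T.velocitySpace
  add_mem' := fun {u v} hu hv => ⟨fun K i => Submodule.add_mem _ (hu.1 K i) (hv.1 K i),
    fun K L x hx => by
      simp only [Pi.add_apply, vecValue_add, hu.2.1 K L x hx, hv.2.1 K L x hx],
    fun K x hx => by
      simp only [Pi.add_apply, vecValue_add, hu.2.2 K x hx, hv.2.2 K x hx, add_zero]⟩
  zero_mem' := ⟨fun K i => Submodule.zero_mem _, fun K L x hx => by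
      ext i; simp [vecValue], fun K x hx => by ext i; simp [vecValue]⟩
  smul_mem' := fun r u hu => ⟨fun K i => Submodule.smul_mem _ r (hu.1 K i),
    fun K L x hx => by simp only [Pi.smul_apply, vecValue_smul, hu.2.1 K L x hx],
    fun K x hx => by simp only [Pi.smul_apply, vecValue_smul, hu.2.2 K x hx, smul_zero]⟩

/-- The pressure space as a submodule. -/
def pressureSubmodule : Submodule ℝ T.ScalarField where
  carrier := T.pressureSpace
  add_mem' := fun hp hq K => Submodule.add_mem _ (hp K) (hq K)
  zero_mem' := fun _ => Submodule.zero_mem _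
  smul_mem' := fun r _ hq K => Submodule.smul_mem _ r (hq K)

/-- The divergence-free velocities as a submodule. -/
def divFreeSubmodule : Submodule ℝ T.VectorField where
  carrier := T.divFreeSpace
  add_mem' := fun hu hv => ⟨T.velocitySubmodule.add_mem hu.1 hv.1, fun q hq => by
    rw [divForm_add_right, hu.2 q hq, hv.2 q hq, add_zero]⟩
  zero_mem' := ⟨T.velocitySubmodule.zero_mem, fun q _ => by
    simpa using divForm_smul_right 0 q (0 : T.VectorField)⟩
  smul_mem' := fun r _ hu => ⟨T.velocitySubmodule.smul_mem r hu.1, fun q hq => by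
    rw [divForm_smul_right, hu.2 q hq, mul_zero]⟩

/-- The tensor space as a submodule. -/
def tensorSubmodule : Submodule ℝ T.TensorField where
  carrier := T.tensorSpace
  add_mem' := fun hA hB K => Matrix.IsSymm.add (hA K) (hB K)
  zero_mem' := fun _ => Matrix.isSymm_zero
  smul_mem' := fun r _ hA K => Matrix.IsSymm.smul (hA K) r

instance finiteDimensional_velocitySubmodule : FiniteDimensional ℝ T.velocitySubmodule := by
  let Φ : T.velocitySubmodule →ₗ[ℝ]
      (T.Cell → Fin d → MvPolynomial.restrictTotalDegree (Fin d) ℝ d) :=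
    { toFun := fun u K i => ⟨u.1 K i, u.2.1 K i⟩
      map_add' := fun u v => rfl
      map_smul' := fun r u => rfl }
  refine FiniteDimensional.of_injective Φ fun u v h => Subtype.ext ?_
  funext K i
  exact congrArg Subtype.val (congrFun (congrFun h K) i)

theorem divFreeSubmodule_le : T.divFreeSubmodule ≤ T.velocitySubmodule := fun _ h => h.1

instance finiteDimensional_divFreeSubmodule : FiniteDimensional ℝ T.divFreeSubmodule :=
  Submodule.finiteDimensional_of_le T.divFreeSubmodule_le

variable {T}

/-- A functional on the velocities that vanishes on the divergence-free ones is a pressure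
gradient. -/
theorem exists_pressure (ℓ : T.velocitySubmodule →ₗ[ℝ] ℝ)
    (hℓ : ∀ v : T.velocitySubmodule, v.1 ∈ T.divFreeSpace → ℓ v = 0) :
    ∃ p ∈ T.pressureSpace, ∀ v : T.velocitySubmodule, T.divForm p v = ℓ v := by
  let D : T.pressureSubmodule →ₗ[ℝ] T.velocitySubmodule →ₗ[ℝ] ℝ :=
    LinearMap.mk₂ ℝ (fun q v => T.divForm q v) (fun q q' v => divForm_add_left _ _ _)
      (fun r q v => divForm_smul_left _ _ _) (fun q v v' => divForm_add_right _ _ _)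
      (fun r q v => divForm_smul_right _ _ _)
  -- The common kernel of the functionals `D q` is the divergence-free space; a functional vanishing
  -- there is in their span, which is the range of `D`.
  have h := FiniteDimensional.mem_span_of_iInf_ker_le_ker (L := fun q => D q) (K := ℓ)
    (fun v hv => by
      rw [Submodule.mem_iInf] at hv
      exact hℓ v ⟨v.2, fun q hq => hv ⟨q, hq⟩⟩)
  have hr : Submodule.span ℝ (Set.range fun q => D q) = LinearMap.range D := by
    rw [← LinearMap.coe_range, Submodule.span_eq]
  rw [hr] at h
  obtain ⟨p, hp⟩ := h
  exact ⟨p.1, p.2, fun v => LinearMap.congr_fun hp v⟩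

end SimplicialMesh

/-! ### Calculus of forms that are bounded and Lipschitz on balls -/

section LocallyLipschitz

variable {E : Type*} [NormedAddCommGroup E]

/-- Functionals of the last argument that are bounded, and Lipschitz in the middle argument,
uniformly for bounded first and middle arguments. -/
def IsLipschitzOnBalls (f : E → E → E → ℝ) : Prop :=
  ∀ R : ℝ, ∃ L : ℝ, ∀ y₀ y y' v : E, ‖y₀‖ ≤ R → ‖y‖ ≤ R → ‖y'‖ ≤ R →
    |f y₀ y v| ≤ L * ‖v‖ ∧ |f y₀ y v - f y₀ y' v| ≤ L * ‖y - y'‖ * ‖v‖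

namespace IsLipschitzOnBalls

theorem add {f g : E → E → E → ℝ} (hf : IsLipschitzOnBalls f) (hg : IsLipschitzOnBalls g) :
    IsLipschitzOnBalls fun a b c => f a b c + g a b c := by
  intro R
  obtain ⟨L, hL⟩ := hf R
  obtain ⟨L', hL'⟩ := hg R
  refine ⟨L + L', fun y₀ y y' v h0 h1 h2 => ?_⟩
  obtain ⟨a1, a2⟩ := hL y₀ y y' v h0 h1 h2
  obtain ⟨b1, b2⟩ := hL' y₀ y y' v h0 h1 h2
  refine ⟨(abs_add_le _ _).trans (by linarith), ?_⟩
  rw [add_sub_add_comm]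
  exact (abs_add_le _ _).trans (by linarith)

theorem const_mul {f : E → E → E → ℝ} (hf : IsLipschitzOnBalls f) (r : ℝ) :
    IsLipschitzOnBalls fun a b c => r * f a b c := by
  intro R
  obtain ⟨L, hL⟩ := hf R
  refine ⟨|r| * L, fun y₀ y y' v h0 h1 h2 => ?_⟩
  obtain ⟨a1, a2⟩ := hL y₀ y y' v h0 h1 h2
  rw [← mul_sub, abs_mul, abs_mul]
  exact ⟨(mul_le_mul_of_nonneg_left a1 (abs_nonneg r)).trans_eq (by ring),
    (mul_le_mul_of_nonneg_left a2 (abs_nonneg r)).trans_eq (by ring)⟩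

theorem of_linear {f : E → ℝ} {C : ℝ} (hf : ∀ v, |f v| ≤ C * ‖v‖) :
    IsLipschitzOnBalls fun _ _ c : E => f c := by
  intro R
  refine ⟨|C|, fun y₀ y y' v _ _ _ =>
    ⟨(hf v).trans (mul_le_mul_of_nonneg_right (le_abs_self C) (norm_nonneg v)), ?_⟩⟩
  rw [sub_self, abs_zero]
  positivity

/-- Linearity in the first argument is not needed: the upwind flux depends on the old velocity only
through a positive part. -/
theorem of_trilinear {f : E → E → E → ℝ} {C : ℝ}
    (hsub : ∀ a b b' c, f a (b - b') c = f a b c - f a b' c)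
    (hf : ∀ a b c, |f a b c| ≤ C * ‖a‖ * ‖b‖ * ‖c‖) : IsLipschitzOnBalls f := by
  intro R
  have key : ∀ y₀ y v : E, ‖y₀‖ ≤ R → |f y₀ y v| ≤ |C| * |R| * ‖y‖ * ‖v‖ := fun y₀ y v h0 => by
    calc |f y₀ y v| ≤ C * ‖y₀‖ * ‖y‖ * ‖v‖ := hf _ _ _
      _ ≤ |C| * |R| * ‖y‖ * ‖v‖ := by
        gcongr
        · exact le_abs_self C
        · exact h0.trans (le_abs_self R)
  refine ⟨|C| * |R| * (1 + |R|), fun y₀ y y' v h0 h1 h2 => ⟨?_, ?_⟩⟩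
  · refine (key y₀ y v h0).trans ?_
    gcongr
    exact (h1.trans (le_abs_self R)).trans (by linarith)
  · rw [← hsub]
    refine (key y₀ _ v h0).trans ?_
    have : |C| * |R| ≤ |C| * |R| * (1 + |R|) :=
      le_mul_of_one_le_right (by positivity) (by linarith [abs_nonneg R])
    gcongr

theorem of_bilinear {f : E → E → ℝ} {C : ℝ}
    (hsub : ∀ b b' c, f (b - b') c = f b c - f b' c)
    (hf : ∀ b c, |f b c| ≤ C * ‖b‖ * ‖c‖) : IsLipschitzOnBalls fun _ b c => f b c := by
  intro R
  refine ⟨|C| * (1 + |R|), fun y₀ y y' v h0 h1 h2 => ⟨?_, ?_⟩⟩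
  · calc |f y v| ≤ C * ‖y‖ * ‖v‖ := hf _ _
      _ ≤ |C| * (1 + |R|) * ‖v‖ := by
        gcongr
        · exact le_abs_self C
        · exact (h1.trans (le_abs_self R)).trans (by linarith)
  · rw [← hsub]
    refine (hf _ v).trans ?_
    gcongr
    exact (le_abs_self C).trans
      (le_mul_of_one_le_right (by positivity) (by linarith [abs_nonneg R]))

/-- Use `f y y - f y' y' = f y (y - y') + f (y - y') y'`. -/
theorem of_quadratic {f : E → E → E → ℝ} {C : ℝ}
    (hsub : ∀ a a' b c, f (a - a') b c = f a b c - f a' b c)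
    (hsub' : ∀ a b b' c, f a (b - b') c = f a b c - f a b' c)
    (hf : ∀ a b c, |f a b c| ≤ C * ‖a‖ * ‖b‖ * ‖c‖) :
    IsLipschitzOnBalls fun _ b c => f b b c := by
  intro R
  have key : ∀ a b c : E, |f a b c| ≤ |C| * ‖a‖ * ‖b‖ * ‖c‖ := fun a b c => by
    refine (hf a b c).trans ?_
    gcongr
    exact le_abs_self C
  refine ⟨|C| * |R| * (2 + |R|), fun y₀ y y' v h0 h1 h2 => ⟨?_, ?_⟩⟩
  · refine (key y y v).trans ?_
    gcongr
    · exact h1.trans (le_abs_self R)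
    · exact (h1.trans (le_abs_self R)).trans (by linarith)
  · have h : f y y v - f y' y' v = f y (y - y') v + f (y - y') y' v := by
      rw [hsub, hsub']
      ring
    rw [h]
    calc |f y (y - y') v + f (y - y') y' v|
        ≤ |C| * ‖y‖ * ‖y - y'‖ * ‖v‖ + |C| * ‖y - y'‖ * ‖y'‖ * ‖v‖ :=
          (abs_add_le _ _).trans (add_le_add (key _ _ _) (key _ _ _))
      _ ≤ |C| * |R| * ‖y - y'‖ * ‖v‖ + |C| * ‖y - y'‖ * |R| * ‖v‖ := by
          gcongr
          · exact h1.trans (le_abs_self R)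
          · exact h2.trans (le_abs_self R)
      _ = |C| * |R| * 2 * ‖y - y'‖ * ‖v‖ := by ring
      _ ≤ |C| * |R| * (2 + |R|) * ‖y - y'‖ * ‖v‖ := by
          gcongr
          linarith [abs_nonneg R]

end IsLipschitzOnBalls

variable [NormedSpace ℝ E] [FiniteDimensional ℝ E]

theorem exists_bound_of_linear (f : E → ℝ) (hadd : ∀ a b, f (a + b) = f a + f b)
    (hsmul : ∀ (r : ℝ) a, f (r • a) = r * f a) : ∃ C : ℝ, 0 ≤ C ∧ ∀ a, |f a| ≤ C * ‖a‖ :=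
  exists_bound_linear { toFun := f, map_add' := hadd, map_smul' := hsmul }

theorem exists_bound_of_bilinear (f : E → E → ℝ)
    (hadd : ∀ a a' b, f (a + a') b = f a b + f a' b)
    (hsmul : ∀ (r : ℝ) a b, f (r • a) b = r * f a b)
    (hadd' : ∀ a b b', f a (b + b') = f a b + f a b')
    (hsmul' : ∀ (r : ℝ) a b, f a (r • b) = r * f a b) :
    ∃ C : ℝ, 0 ≤ C ∧ ∀ a b, |f a b| ≤ C * ‖a‖ * ‖b‖ :=
  exists_bound_bilinear (LinearMap.mk₂ ℝ f hadd hsmul hadd' hsmul')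

theorem exists_bound_of_trilinear (f : E → E → E → ℝ)
    (hadd : ∀ a a' b c, f (a + a') b c = f a b c + f a' b c)
    (hsmul : ∀ (r : ℝ) a b c, f (r • a) b c = r * f a b c)
    (hadd' : ∀ a b b' c, f a (b + b') c = f a b c + f a b' c)
    (hsmul' : ∀ (r : ℝ) a b c, f a (r • b) c = r * f a b c)
    (hadd'' : ∀ a b c c', f a b (c + c') = f a b c + f a b c')
    (hsmul'' : ∀ (r : ℝ) a b c, f a b (r • c) = r * f a b c) :
    ∃ C : ℝ, 0 ≤ C ∧ ∀ a b c, |f a b c| ≤ C * ‖a‖ * ‖b‖ * ‖c‖ :=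
  exists_bound_trilinear (LinearMap.mk₂ ℝ
    (fun a b => ({ toFun := f a b, map_add' := hadd'' a b,
                   map_smul' := fun r c => hsmul'' r a b c } : E →ₗ[ℝ] ℝ))
    (fun a a' b => LinearMap.ext fun c => hadd a a' b c)
    (fun r a b => LinearMap.ext fun c => hsmul r a b c)
    (fun a b b' => LinearMap.ext fun c => hadd' a b b' c)
    (fun r a b => LinearMap.ext fun c => hsmul' r a b c))

end LocallyLipschitz

/-! ### The right-hand side of the Euler step is Lipschitz on balls -/

namespace SimplicialMesh

variable {d : ℕ} {T : SimplicialMesh d}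

/-! ### The evolution form -/

/-- The terms of the scheme that do not involve the timestep and the pressure. -/
def evolutionForm (T : SimplicialMesh d) (Re We ε : ℝ) (u₀ u : T.VectorField) (A : T.TensorField)
    (v : T.VectorField) (B : T.TensorField) : ℝ :=
  Re * T.convForm u₀ u v + (1 - ε) * T.gradForm u v + ε / We * T.stressForm A v
    + 1 / We * T.tensorForm (A - 1) B + -1 * T.stretchForm u A B + T.upwindForm u₀ A B

theorem evolutionForm_add_right (Re We ε : ℝ) (u₀ u : T.VectorField) (A : T.TensorField)
    (v v' : T.VectorField) (B B' : T.TensorField) :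
    T.evolutionForm Re We ε u₀ u A (v + v') (B + B') =
      T.evolutionForm Re We ε u₀ u A v B + T.evolutionForm Re We ε u₀ u A v' B' := by
  simp only [evolutionForm, convForm_add_right, gradForm_add_right, stressForm_add_right,
    tensorForm_add_right, stretchForm_add_right, upwindForm_add_right]
  ring

theorem evolutionForm_smul_right (Re We ε : ℝ) (u₀ u : T.VectorField) (A : T.TensorField)
    (r : ℝ) (v : T.VectorField) (B : T.TensorField) :
    T.evolutionForm Re We ε u₀ u A (r • v) (r • B) = r * T.evolutionForm Re We ε u₀ u A v B := by
  simp only [evolutionForm, convForm_smul_right, gradForm_smul_right, stressForm_smul_right,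
    tensorForm_smul_right, stretchForm_smul_right, upwindForm_smul_right]
  ring

section Bounds

variable {n : ℕ} (U : EuclideanSpace ℝ (Fin n) →ₗ[ℝ] T.VectorField)
  (S : EuclideanSpace ℝ (Fin n) →ₗ[ℝ] T.TensorField)

/-- The positive part of a linear functional of `a` is at most `‖a‖` times the sum of its absolute
values on the coordinate vectors; this majorant is integrable on the facet. -/
theorem exists_bound_flux (hd : d ≠ 0) (K L : T.Cell) :
    ∃ C : ℝ, 0 ≤ C ∧ ∀ a, flux (U a) K L ≤ C * ‖a‖ := by
  by_cases hKL : (commonFace K L).card = d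
  swap
  · exact ⟨0, le_rfl, fun a => by rw [flux, facetIntegral, if_neg hKL, zero_mul]⟩
  let e := EuclideanSpace.basisFun (Fin n) ℝ
  let g : EuclideanSpace ℝ (Fin n) → EuclideanSpace ℝ (Fin d) → ℝ := fun a x =>
    ∑ i, vecValue (U a K) x i * unitNormal K L i
  have hg : ∀ a, Continuous (g a) := fun a => by
    simp only [g]
    fun_prop
  have hlin : ∀ a x, g a x = ∑ k, a k * g (e k) x := by
    intro a x
    let G : EuclideanSpace ℝ (Fin n) →ₗ[ℝ] ℝ :=
      { toFun := fun a => g a x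
        map_add' := fun a b => by
          simp only [g, map_add, Pi.add_apply, vecValue_add, add_mul, Finset.sum_add_distrib]
        map_smul' := fun r a => by
          simp only [g, map_smul, Pi.smul_apply, vecValue_smul, smul_eq_mul, mul_assoc,
            Finset.mul_sum, RingHom.id_apply] }
    have h : G a = G (∑ k, e.repr a k • e k) := by rw [e.sum_repr]
    rw [map_sum] at h
    simpa [G, e] using h
  refine ⟨∑ k, ∫ x in convexHull ℝ (commonFace K L : Set (EuclideanSpace ℝ (Fin d))),
    |g (e k) x| ∂μHE[d - 1], Finset.sum_nonneg fun k _ =>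
      MeasureTheory.integral_nonneg fun x => abs_nonneg _, fun a => ?_⟩
  have hint : ∀ k, IntegrableOn (fun x => |g (e k) x|)
      (convexHull ℝ (commonFace K L : Set (EuclideanSpace ℝ (Fin d)))) μHE[d - 1] := fun k =>
    integrableOn_commonFace hd hKL (hg _).abs
  rw [flux, facetIntegral, if_pos hKL, ← integral_finsetSum _ fun k _ => hint k,
    ← integral_mul_const]
  refine integral_mono (integrableOn_commonFace hd hKL ((hg a).max continuous_const))
    ((integrable_finsetSum _ fun k _ => hint k).mul_const _) fun x => ?_
  refine max_le ?_ (by positivity)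
  change g a x ≤ _
  rw [hlin, Finset.sum_mul]
  refine Finset.sum_le_sum fun k _ => ?_
  calc a k * g (e k) x ≤ |a k| * |g (e k) x| := (le_abs_self _).trans_eq (abs_mul _ _)
    _ ≤ |g (e k) x| * ‖a‖ := by
      rw [mul_comm]
      gcongr
      exact PiLp.norm_apply_le a k

theorem exists_bound_upwindForm (hd : d ≠ 0) :
    ∃ C : ℝ, ∀ a b c, |T.upwindForm (U a) (S b) (S c)| ≤ C * ‖a‖ * ‖b‖ * ‖c‖ := by
  choose C hC hflux using exists_bound_flux U hd
  have hjump : ∀ K L, ∃ C : ℝ, 0 ≤ C ∧ ∀ b c, |ddot (S b L - S b K) (S c L)| ≤ C * ‖b‖ * ‖c‖ := by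
    intro K L
    refine exists_bound_of_bilinear (fun b c => ddot (S b L - S b K) (S c L)) ?_ ?_ ?_ ?_
    · intro b b' c
      simp only [map_add, Pi.add_apply, add_sub_add_comm, ddot_add_left]
    · intro r b c
      simp only [map_smul, Pi.smul_apply, ← smul_sub, ddot_smul_left]
    · intro b c c'
      simp only [map_add, Pi.add_apply, ddot_add_right]
    · intro r b c
      simp only [map_smul, Pi.smul_apply, ddot_smul_right]
  choose C' hC' hddot using hjump
  refine ⟨∑ K, ∑ L, C K L * C' K L, fun a b c => ?_⟩
  rw [upwindForm_eq]
  simp only [Finset.sum_mul]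
  refine (Finset.abs_sum_le_sum_abs _ _).trans (Finset.sum_le_sum fun K _ =>
    (Finset.abs_sum_le_sum_abs _ _).trans (Finset.sum_le_sum fun L _ => ?_))
  rw [abs_mul, abs_of_nonneg (flux_nonneg _ _ _)]
  calc flux (U a) K L * |ddot (S b L - S b K) (S c L)|
      ≤ (C K L * ‖a‖) * (C' K L * ‖b‖ * ‖c‖) :=
        mul_le_mul (hflux K L a) (hddot K L b c) (abs_nonneg _)
          (mul_nonneg (hC K L) (norm_nonneg a))
    _ = _ := by ring

/-- Only stretching is quadratic in the new state. The other terms are affine in it, convection and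
upwinding with coefficients taken from the old state. -/
theorem isLipschitzOnBalls_evolutionForm (hd : d ≠ 0) (Re We ε : ℝ) :
    IsLipschitzOnBalls fun a b c =>
      T.evolutionForm Re We ε (U a) (U b) (S b) (U c) (S c) := by
  have sub : ∀ {F : EuclideanSpace ℝ (Fin n) → ℝ}, (∀ a b, F (a + b) = F a + F b) →
      ∀ a b, F (a - b) = F a - F b := fun h a b => by
    rw [eq_sub_iff_add_eq, ← h, sub_add_cancel]
  have h1 : IsLipschitzOnBalls fun a b c => T.convForm (U a) (U b) (U c) := by
    obtain ⟨C, -, hC⟩ := exists_bound_of_trilinear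
      (fun a b c => T.convForm (U a) (U b) (U c))
      (by simp [convForm_add_left]) (by simp [convForm_smul_left])
      (by simp [convForm_add_middle]) (by simp [convForm_smul_middle])
      (by simp [convForm_add_right]) (by simp [convForm_smul_right])
    exact .of_trilinear (fun a b b' c => sub (F := fun b => T.convForm (U a) (U b) (U c))
      (by simp [convForm_add_middle]) b b') hC
  have h2 : IsLipschitzOnBalls fun a b c : EuclideanSpace ℝ (Fin n) =>
      T.gradForm (U b) (U c) := by
    obtain ⟨C, -, hC⟩ := exists_bound_of_bilinear (fun b c => T.gradForm (U b) (U c))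
      (by simp [gradForm_add_left]) (by simp [gradForm_smul_left])
      (by simp [gradForm_add_right]) (by simp [gradForm_smul_right])
    exact .of_bilinear (fun b b' c => sub (F := fun b => T.gradForm (U b) (U c))
      (by simp [gradForm_add_left]) b b') hC
  have h3 : IsLipschitzOnBalls fun a b c : EuclideanSpace ℝ (Fin n) =>
      T.stressForm (S b) (U c) := by
    obtain ⟨C, -, hC⟩ := exists_bound_of_bilinear (fun b c => T.stressForm (S b) (U c))
      (by simp [stressForm_add_left]) (by simp [stressForm_smul_left])
      (by simp [stressForm_add_right]) (by simp [stressForm_smul_right])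
    exact .of_bilinear (fun b b' c => sub (F := fun b => T.stressForm (S b) (U c))
      (by simp [stressForm_add_left]) b b') hC
  have h4 : IsLipschitzOnBalls fun a b c : EuclideanSpace ℝ (Fin n) =>
      T.tensorForm (S b - 1) (S c) := by
    obtain ⟨C, -, hC⟩ := exists_bound_of_bilinear (fun b c => T.tensorForm (S b) (S c))
      (by simp [tensorForm_add_left]) (by simp [tensorForm_smul_left])
      (by simp [tensorForm_add_right]) (by simp [tensorForm_smul_right])
    obtain ⟨C', -, hC'⟩ := exists_bound_of_linear (fun c => T.tensorForm 1 (S c))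
      (by simp [tensorForm_add_right]) (by simp [tensorForm_smul_right])
    have h := (IsLipschitzOnBalls.of_bilinear
      (fun b b' c => sub (F := fun b => T.tensorForm (S b) (S c))
      (by simp [tensorForm_add_left]) b b') hC).add ((IsLipschitzOnBalls.of_linear hC').const_mul (-1))
    simpa only [tensorForm_sub_left, neg_one_mul, ← sub_eq_add_neg] using h
  have h5 : IsLipschitzOnBalls fun a b c : EuclideanSpace ℝ (Fin n) =>
      T.stretchForm (U b) (S b) (S c) := by
    obtain ⟨C, -, hC⟩ := exists_bound_of_trilinear
      (fun a b c => T.stretchForm (U a) (S b) (S c))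
      (by simp [stretchForm_add_left]) (by simp [stretchForm_smul_left])
      (by simp [stretchForm_add_middle]) (by simp [stretchForm_smul_middle])
      (by simp [stretchForm_add_right]) (by simp [stretchForm_smul_right])
    exact .of_quadratic
      (fun a a' b c => sub (F := fun a => T.stretchForm (U a) (S b) (S c))
        (by simp [stretchForm_add_left]) a a')
      (fun a b b' c => sub (F := fun b => T.stretchForm (U a) (S b) (S c))
        (by simp [stretchForm_add_middle]) b b') hC
  have h6 : IsLipschitzOnBalls fun a b c => T.upwindForm (U a) (S b) (S c) := by
    obtain ⟨C, hC⟩ := exists_bound_upwindForm U S hd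
    exact .of_trilinear (fun a b b' c => sub (F := fun b => T.upwindForm (U a) (S b) (S c))
      (by simp [upwindForm_add_middle]) b b') hC
  exact (((((h1.const_mul Re).add (h2.const_mul (1 - ε))).add (h3.const_mul (ε / We))).add
    (h4.const_mul (1 / We))).add (h5.const_mul (-1))).add h6

end Bounds

end SimplicialMesh

/-! ### The reduced Euler step, a priori bounds and pressure modes -/

namespace SimplicialMesh

variable {d : ℕ} {T : SimplicialMesh d}

/-! ### Elimination of the pressure -/

theorem weakForm_eq_evolutionForm (Re We ε δt : ℝ) (u₀ : T.VectorField) (A₀ : T.TensorField)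
    (u : T.VectorField) (p : T.ScalarField) (A : T.TensorField)
    (v : T.VectorField) (q : T.ScalarField) (B : T.TensorField) :
    T.weakForm Re We ε δt u₀ A₀ u p A v q B =
      δt⁻¹ * (Re * T.massForm (u - u₀) v + T.tensorForm (A - A₀) B)
        + T.evolutionForm Re We ε u₀ u A v B - T.divForm p v + T.divForm q u := by
  rw [weakForm_eq, evolutionForm]
  ring

theorem divForm_zero_left (v : T.VectorField) : T.divForm 0 v = 0 := by
  simpa using divForm_smul_left (T := T) 0 0 v

theorem divForm_zero_right (q : T.ScalarField) : T.divForm q 0 = 0 := by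
  simpa using divForm_smul_right (T := T) 0 q 0

theorem massForm_zero_right (u : T.VectorField) : T.massForm u 0 = 0 := by
  simpa using massForm_smul_right (T := T) 0 u 0

theorem tensorForm_zero_right (A : T.TensorField) : T.tensorForm A 0 = 0 := by
  simpa using tensorForm_smul_right (T := T) A 0 0

theorem evolutionForm_zero_right (Re We ε : ℝ) (u₀ u : T.VectorField) (A : T.TensorField) :
    T.evolutionForm Re We ε u₀ u A 0 0 = 0 := by
  simpa using evolutionForm_smul_right (T := T) Re We ε u₀ u A 0 0 0

variable {Re We ε δt : ℝ} {u₀ u : T.VectorField} {A₀ A : T.TensorField} {p p' : T.ScalarField}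

theorem IsPosDefSolution.divForm_eq (h : T.IsPosDefSolution Re We ε δt u₀ A₀ u p A)
    {v : T.VectorField} (hv : v ∈ T.velocitySpace) {B : T.TensorField} (hB : B ∈ T.tensorSpace) :
    T.divForm p v = δt⁻¹ * (Re * T.massForm (u - u₀) v + T.tensorForm (A - A₀) B)
      + T.evolutionForm Re We ε u₀ u A v B := by
  have := h.2.2.2.2 v hv 0 T.pressureSubmodule.zero_mem B hB
  rw [weakForm_eq_evolutionForm, divForm_zero_left] at this
  linarith

theorem IsPosDefSolution.mem_divFreeSpace (h : T.IsPosDefSolution Re We ε δt u₀ A₀ u p A) :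
    u ∈ T.divFreeSpace := by
  refine ⟨h.1, fun q hq => ?_⟩
  have := h.2.2.2.2 0 T.velocitySubmodule.zero_mem q hq 0 T.tensorSubmodule.zero_mem
  rwa [weakForm_eq_evolutionForm, divForm_zero_right, massForm_zero_right, tensorForm_zero_right,
    evolutionForm_zero_right, mul_zero, zero_add, mul_zero, zero_add, sub_zero, zero_add] at this

theorem IsPosDefSolution.eulerStep (hδt : δt ≠ 0)
    (h : T.IsPosDefSolution Re We ε δt u₀ A₀ u p A)
    {v : T.VectorField} (hv : v ∈ T.divFreeSpace) {B : T.TensorField} (hB : B ∈ T.tensorSpace) :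
    Re * T.massForm (u - u₀) v + T.tensorForm (A - A₀) B
      + δt * T.evolutionForm Re We ε u₀ u A v B = 0 := by
  have := h.divForm_eq hv.1 hB
  rw [hv.2 p h.2.1] at this
  field_simp at this
  linarith

/-- The residual of the momentum equation vanishes on divergence-free fields, hence it is
represented by a pressure; the tensor equation is the case `v = 0`. -/
theorem exists_isPosDefSolution (hδt : δt ≠ 0) (hu : u ∈ T.divFreeSpace) (hA : ∀ K, (A K).PosDef)
    (h : ∀ v ∈ T.divFreeSpace, ∀ B ∈ T.tensorSpace,
      Re * T.massForm (u - u₀) v + T.tensorForm (A - A₀) B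
        + δt * T.evolutionForm Re We ε u₀ u A v B = 0) :
    ∃ p, T.IsPosDefSolution Re We ε δt u₀ A₀ u p A := by
  let ℓ : T.velocitySubmodule →ₗ[ℝ] ℝ :=
    { toFun := fun v => δt⁻¹ * (Re * T.massForm (u - u₀) v) + T.evolutionForm Re We ε u₀ u A v 0
      map_add' := fun v v' => by
        have := evolutionForm_add_right Re We ε u₀ u A v.1 v'.1 0 0
        rw [add_zero] at this
        rw [Submodule.coe_add, this, massForm_add_right]
        ring
      map_smul' := fun r v => by
        have := evolutionForm_smul_right Re We ε u₀ u A r v.1 0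
        rw [smul_zero] at this
        rw [Submodule.coe_smul, this, massForm_smul_right, RingHom.id_apply, smul_eq_mul]
        ring }
  have hdiv : ∀ v ∈ T.divFreeSpace, ∀ B ∈ T.tensorSpace,
      δt⁻¹ * (Re * T.massForm (u - u₀) v + T.tensorForm (A - A₀) B)
        + T.evolutionForm Re We ε u₀ u A v B = 0 := fun v hv B hB => by
    have := h v hv B hB
    field_simp
    linarith
  obtain ⟨p, hp, hpℓ⟩ := exists_pressure ℓ fun v hv => by
    have := hdiv v hv 0 T.tensorSubmodule.zero_mem
    rwa [tensorForm_zero_right, add_zero] at this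
  refine ⟨p, hu.1, hp, fun K => transpose_of_posDef (hA K), hA, fun v hv q hq B hB => ?_⟩
  have h1 : T.divForm p v = δt⁻¹ * (Re * T.massForm (u - u₀) v)
    + T.evolutionForm Re We ε u₀ u A v 0 := hpℓ ⟨v, hv⟩
  have h2 := hdiv 0 T.divFreeSubmodule.zero_mem B hB
  have h3 := evolutionForm_add_right Re We ε u₀ u A v 0 0 B
  rw [add_zero, zero_add] at h3
  rw [massForm_zero_right] at h2
  rw [weakForm_eq_evolutionForm, hu.2 q hq, h1, h3]
  linarith

theorem IsPosDefSolution.pressure_iff (h : T.IsPosDefSolution Re We ε δt u₀ A₀ u p A) :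
    T.IsPosDefSolution Re We ε δt u₀ A₀ u p' A ↔ p' - p ∈ T.pressureModes := by
  have hsub : ∀ v, T.divForm p' v = T.divForm (p' - p) v + T.divForm p v := fun v => by
    rw [← divForm_add_left, sub_add_cancel]
  constructor
  · intro h'
    refine ⟨T.pressureSubmodule.sub_mem h'.2.1 h.2.1, fun v hv => ?_⟩
    have h1 := h.divForm_eq hv T.tensorSubmodule.zero_mem
    have h2 := h'.divForm_eq hv T.tensorSubmodule.zero_mem
    linarith [hsub v]
  · intro hp
    refine ⟨h.1, ?_, h.2.2.1, h.2.2.2.1, fun v hv q hq B hB => ?_⟩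
    · have := T.pressureSubmodule.add_mem hp.1 h.2.1
      rwa [sub_add_cancel] at this
    · have h1 := h.2.2.2.2 v hv q hq B hB
      rw [weakForm_eq_evolutionForm] at h1 ⊢
      rw [hsub, hp.2 v hv, zero_add, h1]

/-! ### A priori bounds and coordinates -/

/-- Both parts of the energy are nonnegative, so each is bounded by `M`. As every cell has positive
volume, this bounds the energy density on each cell, and with it the trace and the smallest
eigenvalue. -/
theorem exists_bound_of_freeEnergy_le (T : SimplicialMesh d) (hRe : 0 < Re) (hWe : 0 < We)
    (hε : 0 < ε) (M : ℝ) :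
    ∃ R m : ℝ, 0 ≤ R ∧ 0 < m ∧ ∀ (u : T.VectorField) (A : T.TensorField)
      (hA : ∀ K, (A K).PosDef), T.freeEnergy Re We ε u A ≤ M →
        Re * T.massForm u u + T.tensorForm A A ≤ R ^ 2 ∧
          ∀ K i, m ≤ (hA K).isHermitian.eigenvalues i := by
  -- The bound on a single cell is `M / (ε / (2 We)) / vol K`; the sum of absolute values serves all
  -- the cells at once.
  let N : ℝ := ∑ K : T.Cell, |M / (ε / (2 * We)) / vol K|
  refine ⟨√(2 * |M| + ∑ K : T.Cell, vol K * (2 * (N + d)) ^ 2), Real.exp (-1 - N),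
    Real.sqrt_nonneg _, Real.exp_pos _, fun u A hA hF => ?_⟩
  rw [freeEnergy_eq] at hF
  have hc : 0 < ε / (2 * We) := by positivity
  have hterm : ∀ K, 0 ≤ vol K * (A K - cfc Real.log (A K) - 1).trace := fun K =>
    mul_nonneg (vol_pos K).le (trace_sub_cfc_log_nonneg (hA K))
  have hmass := mul_nonneg (half_pos hRe).le (massForm_self_nonneg u)
  have htr : ∀ K, (A K - cfc Real.log (A K) - 1).trace ≤ N := by
    intro K
    have h1 := Finset.single_le_sum (fun K _ => hterm K) (Finset.mem_univ K)
    have h2 : vol K * (A K - cfc Real.log (A K) - 1).trace ≤ M / (ε / (2 * We)) := by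
      rw [le_div_iff₀ hc]
      have := mul_le_mul_of_nonneg_left h1 hc.le
      linarith
    rw [← le_div_iff₀' (vol_pos K)] at h2
    exact (h2.trans (le_abs_self _)).trans
      (Finset.single_le_sum (f := fun K : T.Cell => |M / (ε / (2 * We)) / vol K|)
        (fun K _ => abs_nonneg _) (Finset.mem_univ K))
  refine ⟨?_, fun K i => le_eigenvalues_of_trace_le (hA K) (htr K) i⟩
  have hsum : T.tensorForm A A ≤ ∑ K : T.Cell, vol K * (2 * (N + d)) ^ 2 := by
    rw [tensorForm_eq]
    refine Finset.sum_le_sum fun K _ => mul_le_mul_of_nonneg_left ?_ (vol_pos K).le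
    rw [ddot_eq_trace, transpose_of_posDef (hA K)]
    refine (trace_mul_self_le (hA K)).trans
      (pow_le_pow_left₀ (hA K).posSemidef.trace_nonneg ?_ 2)
    simpa using trace_le_of_trace_le (hA K) (htr K)
  have hM : Re * T.massForm u u ≤ 2 * |M| := by
    have := mul_nonneg hc.le (Finset.sum_nonneg fun K (_ : K ∈ Finset.univ) => hterm K)
    linarith [le_abs_self M]
  rw [Real.sq_sqrt]
  · linarith
  · have : 0 ≤ ∑ K : T.Cell, vol K * (2 * (N + d)) ^ 2 :=
      Finset.sum_nonneg fun K _ => mul_nonneg (vol_pos K).le (sq_nonneg _)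
    positivity

/-- The inner product is the one multiplying the discrete time derivative, so in these coordinates
the scheme reads as an Euler step. -/
theorem exists_orthonormal_state_coordinates (T : SimplicialMesh d) (hRe : 0 < Re) :
    ∃ n, ∃ φ : EuclideanSpace ℝ (Fin n) ≃ₗ[ℝ] T.divFreeSubmodule × T.tensorSubmodule,
      ∀ a b, Re * T.massForm (φ a).1.1 (φ b).1.1 + T.tensorForm (φ a).2.1 (φ b).2.1 =
        inner ℝ a b := by
  refine exists_orthonormal_coordinates (LinearMap.mk₂ ℝ
    (fun y z : T.divFreeSubmodule × T.tensorSubmodule =>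
      Re * T.massForm y.1.1 z.1.1 + T.tensorForm y.2.1 z.2.1) ?_ ?_ ?_ ?_) ?_ ?_
  · intro y y' z
    simp only [Prod.fst_add, Prod.snd_add, Submodule.coe_add, massForm_add_left, tensorForm_add_left]
    ring
  · intro r y z
    simp only [Prod.smul_fst, Prod.smul_snd, Submodule.coe_smul, massForm_smul_left,
      tensorForm_smul_left, smul_eq_mul]
    ring
  · intro y z z'
    simp only [Prod.fst_add, Prod.snd_add, Submodule.coe_add, massForm_add_right,
      tensorForm_add_right]
    ring
  · intro r y z
    simp only [Prod.smul_fst, Prod.smul_snd, Submodule.coe_smul, massForm_smul_right,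
      tensorForm_smul_right, smul_eq_mul]
    ring
  · intro y z
    simp only [LinearMap.mk₂_apply]
    rw [massForm_comm, tensorForm_comm]
  · intro y hy
    simp only [LinearMap.mk₂_apply]
    have hmass := mul_nonneg hRe.le (massForm_self_nonneg y.1.1)
    have hterm : ∀ K, 0 ≤ vol K * ddot (y.2.1 K) (y.2.1 K) := fun K =>
      mul_nonneg (vol_pos K).le (ddot_self_nonneg _)
    have htens : 0 ≤ T.tensorForm y.2.1 y.2.1 := by
      rw [tensorForm_eq]
      exact Finset.sum_nonneg fun K _ => hterm K
    refine lt_of_le_of_ne (add_nonneg hmass htens) fun h => hy ?_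
    have h1 : Re * T.massForm y.1.1 y.1.1 = 0 := by linarith
    have h2 : T.tensorForm y.2.1 y.2.1 = 0 := by linarith
    refine Prod.ext (Subtype.ext ?_) (Subtype.ext (funext fun K => ?_))
    · exact eq_zero_of_integral_dotProduct ((mul_eq_zero.1 h1).resolve_left hRe.ne')
    · rw [tensorForm_eq, Finset.sum_eq_zero_iff_of_nonneg fun K _ => hterm K] at h2
      exact eq_zero_of_ddot_self
        ((mul_eq_zero.1 (h2 K (Finset.mem_univ K))).resolve_left (vol_pos K).ne')

/-- The `L²` distance controls the distance on each cell, because the finitely many volumes are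
positive: any `r` with `r² < m² vol K` for all `K` will do. -/
theorem exists_posDef_radius (T : SimplicialMesh d) {m : ℝ} (hm : 0 < m) :
    ∃ r : ℝ, 0 < r ∧ ∀ A A₀ : T.TensorField, (∀ K, (A K).IsSymm) → ∀ hA₀ : ∀ K, (A₀ K).PosDef,
      (∀ K i, m ≤ (hA₀ K).isHermitian.eigenvalues i) →
        T.tensorForm (A - A₀) (A - A₀) ≤ r ^ 2 → ∀ K, (A K).PosDef := by
  have h : ∀ᶠ r : ℝ in nhdsWithin 0 (Set.Ioi 0), ∀ K : T.Cell, r ^ 2 < m ^ 2 * vol K :=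
    Filter.eventually_all.2 fun K => nhdsWithin_le_nhds
      (((continuous_pow 2).tendsto' (0 : ℝ) 0 (by simp)).eventually_lt_const
        (mul_pos (by positivity) (vol_pos K)))
  obtain ⟨r, hr, hr0⟩ := (h.and self_mem_nhdsWithin).exists
  refine ⟨r, hr0, fun A A₀ hA hA₀ hm' hle K => ?_⟩
  refine posDef_of_ddot_sub_lt (hA K) (hA₀ K).isHermitian hm (hm' K) ?_
  rw [tensorForm_eq] at hle
  have h1 := Finset.single_le_sum (fun K _ => mul_nonneg (vol_pos K).le
    (ddot_self_nonneg ((A - A₀) K))) (Finset.mem_univ K)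
  have h2 := (h1.trans hle).trans_lt (hr K)
  rw [mul_comm (m ^ 2)] at h2
  exact lt_of_mul_lt_mul_left h2 (vol_pos K).le

/-! ### Pressures with zero mean -/

theorem const_mem_pressureModes (hd : d ≠ 0) (c : ℝ) :
    (fun _ => MvPolynomial.C c) ∈ T.pressureModes := by
  refine ⟨const_mem_pressureSpace c, fun v hv => ?_⟩
  have h := integral_const_mul (T := T) c fun K x => value (divPoly (v K)) x
  rw [integral_divPoly_eq_zero hd hv, mul_zero] at h
  simpa [divForm] using h

theorem exists_integral_sub_const_eq_zero (p : T.ScalarField) :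
    ∃ c : ℝ, T.integral (fun K x => value (p K - MvPolynomial.C c) x) = 0 := by
  rcases isEmpty_or_nonempty T.Cell with h | h
  · exact ⟨0, Finset.sum_of_isEmpty _⟩
  have hpos : 0 < ∑ K : T.Cell, vol K :=
    Finset.sum_pos (fun K _ => vol_pos K) Finset.univ_nonempty
  refine ⟨T.integral (fun K x => value (p K) x) / ∑ K : T.Cell, vol K, ?_⟩
  simp only [value_sub, value_C]
  rw [integral_sub (fun K => by fun_prop) (fun K => by fun_prop), integral_const_eq,
    ← Finset.sum_mul, mul_div_cancel₀ _ hpos.ne', sub_self]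

/-- By stability `q = div v`, so `∫ q² = ∫ q div v = 0`. -/
theorem eq_zero_of_mem_pressureModes (hT : T.StablePair) {q : T.ScalarField}
    (hq : q ∈ T.pressureModes) (hmean : T.integral (fun K x => value (q K) x) = 0) : q = 0 := by
  obtain ⟨v, hv, hvq⟩ := hT q ⟨hq.1, hmean⟩
  have h := hq.2 v hv
  simp only [divForm, hvq] at h
  exact eq_zero_of_integral_sq h

end SimplicialMesh

end OldroydB

end

/-! ### Existence, uniqueness and energy decay for small timesteps -/

theorem mainTheorem1 (d : ℕ) (hd : d = 2 ∨ d = 3) (T : OldroydB.SimplicialMesh d)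
    (Re We ε : ℝ) (hRe : 0 < Re) (hWe : 0 < We) (hε₀ : 0 < ε) (hε₁ : ε ≤ 1) (M : ℝ) :
    ∃ c₀ : ℝ, 0 < c₀ ∧ ∀ δt : ℝ, 0 < δt → δt < c₀ →
      ∀ u₀ ∈ T.divFreeSpace, ∀ A₀ : T.TensorField, (∀ K, (A₀ K).PosDef) →
        T.freeEnergy Re We ε u₀ A₀ ≤ M →
        (∃ u p A, T.IsPosDefSolution Re We ε δt u₀ A₀ u p A ∧
          (∀ u' p' A', T.IsPosDefSolution Re We ε δt u₀ A₀ u' p' A' ↔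
            u' = u ∧ p' - p ∈ T.pressureModes ∧ A' = A) ∧
          T.freeEnergy Re We ε u A - T.freeEnergy Re We ε u₀ A₀
            + T.dissipation Re We ε δt u₀ u A ≤ 0) ∧
        (T.StablePair →
          ∃! w : T.VectorField × T.ScalarField × T.TensorField,
            w.2.1 ∈ T.meanZeroPressureSpace ∧
              T.IsPosDefSolution Re We ε δt u₀ A₀ w.1 w.2.1 w.2.2) := by
  have hd0 : d ≠ 0 := by omega
  -- All the constants are fixed before the data: `R` and `m` from `M`, `r` from `m`, and later `c₀`
  -- from `R` and `r`.
  obtain ⟨R, m, hR, hm, hbound⟩ := T.exists_bound_of_freeEnergy_le hRe hWe hε₀ M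
  obtain ⟨r, hr, hposDef⟩ := T.exists_posDef_radius hm
  obtain ⟨n, φ, hφ⟩ := T.exists_orthonormal_state_coordinates hRe
  let U : EuclideanSpace ℝ (Fin n) →ₗ[ℝ] T.VectorField :=
    T.divFreeSubmodule.subtype ∘ₗ LinearMap.fst ℝ _ _ ∘ₗ φ.toLinearMap
  let S : EuclideanSpace ℝ (Fin n) →ₗ[ℝ] T.TensorField :=
    T.tensorSubmodule.subtype ∘ₗ LinearMap.snd ℝ _ _ ∘ₗ φ.toLinearMap
  have hU : ∀ a, U a ∈ T.divFreeSpace := fun a => (φ a).1.2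
  have hS : ∀ a, S a ∈ T.tensorSpace := fun a => (φ a).2.2
  have hinner : ∀ a b, Re * T.massForm (U a) (U b) + T.tensorForm (S a) (S b) = inner ℝ a b := hφ
  have hsurj : ∀ u ∈ T.divFreeSpace, ∀ A ∈ T.tensorSpace, ∃ a, U a = u ∧ S a = A :=
    fun u hu A hA => ⟨φ.symm (⟨u, hu⟩, ⟨A, hA⟩), by simp [U], by simp [S]⟩
  let f : EuclideanSpace ℝ (Fin n) → EuclideanSpace ℝ (Fin n) → EuclideanSpace ℝ (Fin n) →ₗ[ℝ] ℝ :=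
    fun a b =>
      { toFun := fun c => T.evolutionForm Re We ε (U a) (U b) (S b) (U c) (S c)
        map_add' := fun c c' => by
          rw [map_add, map_add, OldroydB.SimplicialMesh.evolutionForm_add_right]
        map_smul' := fun s c => by
          rw [map_smul, map_smul, OldroydB.SimplicialMesh.evolutionForm_smul_right]
          rfl }
  obtain ⟨c₀, hc₀, hstep⟩ := OldroydB.exists_implicitEuler_step f
    (OldroydB.SimplicialMesh.isLipschitzOnBalls_evolutionForm U S hd0 Re We ε) R r hr
  refine ⟨c₀, hc₀, fun δt hδt hδc u₀ hu₀ A₀ hA₀ hF => ?_⟩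
  have henergy : ∀ {u p A}, T.IsPosDefSolution Re We ε δt u₀ A₀ u p A →
      T.freeEnergy Re We ε u A - T.freeEnergy Re We ε u₀ A₀
        + T.dissipation Re We ε δt u₀ u A ≤ 0 := fun h =>
    OldroydB.SimplicialMesh.freeEnergy_add_dissipation_le hd0 hWe hε₀ hδt hu₀ hA₀ h
  have hnorm : ∀ a (hA : ∀ K, (S a K).PosDef), T.freeEnergy Re We ε (U a) (S a) ≤ M →
      ‖a‖ ≤ R := fun a hA h => by
    have := (hbound _ _ hA h).1
    rw [hinner, real_inner_self_eq_norm_sq] at this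
    exact (pow_le_pow_iff_left₀ (norm_nonneg a) hR two_ne_zero).1 this
  obtain ⟨y₀, rfl, rfl⟩ := hsurj u₀ hu₀ A₀ fun K => OldroydB.transpose_of_posDef (hA₀ K)
  obtain ⟨⟨y, hyr, hy⟩, huniq⟩ := hstep δt hδt hδc y₀ (hnorm y₀ hA₀ hF)
  have hinner' : ∀ y c, inner ℝ (y - y₀) c + δt * f y₀ y c =
      Re * T.massForm (U y - U y₀) (U c) + T.tensorForm (S y - S y₀) (S c)
        + δt * T.evolutionForm Re We ε (U y₀) (U y) (S y) (U c) (S c) := fun y c => by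
    rw [← hinner, map_sub, map_sub]
    rfl
  -- The velocity part of `‖y - y₀‖²` is nonnegative, so the tensor part alone is at most `r²`.
  have hA : ∀ K, (S y K).PosDef := by
    refine hposDef _ _ (hS y) hA₀ (hbound _ _ hA₀ hF).2 ?_
    have h1 : ‖y - y₀‖ ^ 2 ≤ r ^ 2 := pow_le_pow_left₀ (norm_nonneg _) hyr 2
    rw [← real_inner_self_eq_norm_sq, ← hinner, map_sub, map_sub] at h1
    linarith [mul_nonneg hRe.le (OldroydB.SimplicialMesh.massForm_self_nonneg (U y - U y₀))]
  obtain ⟨p, hp⟩ := OldroydB.SimplicialMesh.exists_isPosDefSolution hδt.ne' (hU y) hA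
    fun v hv B hB => by
      obtain ⟨c, rfl, rfl⟩ := hsurj v hv B hB
      rw [← hinner', hy]
  -- Every positive definite solution inherits the energy bound `M`, hence the a priori norm bound
  -- `R`: this makes uniqueness global.
  have hle : ∀ {u p A}, T.IsPosDefSolution Re We ε δt (U y₀) (S y₀) u p A →
      T.freeEnergy Re We ε u A ≤ M := fun {u p A} h => by
    have h1 := OldroydB.SimplicialMesh.dissipation_nonneg (We := We) hRe hε₀ hε₁ hδt (U y₀) u h.2.2.2.1
    linarith [henergy h]
  have heq : ∀ {u' p' A'}, T.IsPosDefSolution Re We ε δt (U y₀) (S y₀) u' p' A' →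
      u' = U y ∧ A' = S y := fun {u' p' A'} h => by
    obtain ⟨y', rfl, rfl⟩ := hsurj u' h.mem_divFreeSpace A' h.2.2.1
    have : y' = y := huniq y' y (hnorm y' h.2.2.2.1 (hle h)) (hnorm y hA (hle hp))
      (fun c => by rw [hinner', h.eulerStep hδt.ne' (hU c) (hS c)]) hy
    rw [this]
    exact ⟨rfl, rfl⟩
  refine ⟨⟨U y, p, S y, hp, fun u' p' A' => ⟨fun h => ?_, ?_⟩, henergy hp⟩, fun hT => ?_⟩
  · obtain ⟨rfl, rfl⟩ := heq h
    exact ⟨rfl, hp.pressure_iff.1 h, rfl⟩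
  · rintro ⟨rfl, h, rfl⟩
    exact hp.pressure_iff.2 h
  -- Subtracting the mean keeps a solution, since constants are unseen pressure modes; stability
  -- then excludes any further mode of zero mean.
  · obtain ⟨c, hc⟩ := OldroydB.SimplicialMesh.exists_integral_sub_const_eq_zero p
    have hq : T.IsPosDefSolution Re We ε δt (U y₀) (S y₀) (U y)
        (p - fun _ => MvPolynomial.C c) (S y) := by
      rw [hp.pressure_iff, sub_sub_cancel_left]
      convert OldroydB.SimplicialMesh.const_mem_pressureModes (T := T) hd0 (-c) using 1
      funext K
      exact (map_neg _ c).symm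
    refine ⟨(U y, p - fun _ => MvPolynomial.C c, S y), ⟨⟨hq.2.1, hc⟩, hq⟩, ?_⟩
    rintro ⟨u', p', A'⟩ ⟨hp', h'⟩
    obtain ⟨rfl, rfl⟩ := heq h'
    have hmode := hq.pressure_iff.1 h'
    have hzero := OldroydB.SimplicialMesh.eq_zero_of_mem_pressureModes hT hmode <| by
      simp only [Pi.sub_apply, OldroydB.value_sub (p' _)]
      rw [OldroydB.SimplicialMesh.integral_sub (fun K => by fun_prop) (fun K => by fun_prop),
        hp'.2, hc, sub_self]
    rw [show p' = _ from sub_eq_zero.1 hzero]
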